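/- Graphs are finite, simple and undirected, and the graph with no vertices is allowed; $|F|$ is the number of vertices of $F$, and $\hom(F,G)$ is the number of homomorphisms from $F$ to $G$. A star is a connected graph with at most one vertex of degree greater than $1$ (the one-vertex graph and the single edge are stars). Consider the problem StarHomRec. Input: pairs $(F_1,m_1),\dots,(F_k,m_k)$, where $F_1,\dots,F_k$ are stars, given by their adjacency matrices, and $m_1,\dots,m_k\in\mathbb N=\{0,1,2,\dots\}$ are given in unary. Question: is there a graph $G$ with $\hom(F_i,G)=m_i$ for all $i\in[k]$? Let $\ell=\max_i|F_i|$ and $m=\max_i m_i$ (both $0$ if $k=0$), and let $N$ be the length of the encoding of the input as a bit string. **Theorem.** There are a constant $C$ and a program of a random access machine (unit cost; the only arithmetic operations are addition and truncated subtraction) that decides StarHomRec and, whenever the answer is yes, also outputs the adjacency matrix of a graph $G$ with $\hom(F_i,G)=m_i$ for all $i\in[k]$, such that on every input - it runs in time at most $C\cdot\max(m,2)^{C\ell^2}$ if $F_1,\dots,F_k$ are pairwise non-isomorphic, so in time $m^{O(\ell^2)}$ for $m\ge 2$ and $k\ge1$; - it runs in time at most $C\cdot(N+1)\cdot\max(m,2)^{C\ell^2}$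 if constraint graphs may be repeated. -/

import Mathlib

namespace StarHomRec

/-! ### The machine model: structured programs on a random access machine -/

/-- A memory state: registers holding natural numbers, and arrays of natural numbers.
A program mentions only finitely many registers and arrays. -/
structure State where
  /-- the content of each register -/
  reg : ℕ → ℕ
  /-- `arr a i` is the content of cell `i` of array `a` -/
  arr : ℕ → ℕ → ℕ

/-- Overwrite register `r` with the value `x`. -/
def State.setReg (s : State) (r x : ℕ) : State where
  reg := Function.update s.reg r x
  arr := s.arr

/-- Overwrite cell `i` of array `a` with the value `x`. -/
def State.setArr (s : State) (a i x : ℕ) : State where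
  reg := s.reg
  arr := Function.update s.arr a (Function.update (s.arr a) i x)

/-- Programs of a random access machine. The arithmetic is addition and truncated subtraction
only (no multiplication), so that unit cost is polynomially equivalent to Turing machine time. -/
inductive Prog where
  /-- do nothing -/
  | skip : Prog
  /-- `reg r := c` -/
  | const (r c : ℕ) : Prog
  /-- `reg r := reg x + reg y` -/
  | add (r x y : ℕ) : Prog
  /-- `reg r := max (reg x - reg y) 0` -/
  | sub (r x y : ℕ) : Prog
  /-- `reg r := arr a [reg i]` -/
  | load (r a i : ℕ) : Prog
  /-- `arr a [reg i] := reg x` -/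
  | store (a i x : ℕ) : Prog
  /-- first `p`, then `q` -/
  | seq (p q : Prog) : Prog
  /-- if `reg r ≠ 0` then `p` else `q` -/
  | ite (r : ℕ) (p q : Prog) : Prog
  /-- while `reg r ≠ 0` do `p` -/
  | loop (r : ℕ) (p : Prog) : Prog

/-- `Exec p s t s'`: started in the state `s`, the program `p` halts in the state `s'` after
exactly `t` steps. Every elementary instruction and every test of a register costs one step. -/
inductive Exec : Prog → State → ℕ → State → Prop where
  | skip (s : State) : Exec Prog.skip s 1 s
  | const (r c : ℕ) (s : State) : Exec (Prog.const r c) s 1 (s.setReg r c)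
  | add (r x y : ℕ) (s : State) : Exec (Prog.add r x y) s 1 (s.setReg r (s.reg x + s.reg y))
  | sub (r x y : ℕ) (s : State) : Exec (Prog.sub r x y) s 1 (s.setReg r (s.reg x - s.reg y))
  | load (r a i : ℕ) (s : State) : Exec (Prog.load r a i) s 1 (s.setReg r (s.arr a (s.reg i)))
  | store (a i x : ℕ) (s : State) :
      Exec (Prog.store a i x) s 1 (s.setArr a (s.reg i) (s.reg x))
  | seq {p q : Prog} {s s' s'' : State} {t t' : ℕ} (hp : Exec p s t s') (hq : Exec q s' t' s'') :
      Exec (Prog.seq p q) s (t + t') s''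
  | iteTrue {r : ℕ} {p q : Prog} {s s' : State} {t : ℕ} (h : s.reg r ≠ 0) (hp : Exec p s t s') :
      Exec (Prog.ite r p q) s (t + 1) s'
  | iteFalse {r : ℕ} {p q : Prog} {s s' : State} {t : ℕ} (h : s.reg r = 0) (hq : Exec q s t s') :
      Exec (Prog.ite r p q) s (t + 1) s'
  | loopDone {r : ℕ} {p : Prog} {s : State} (h : s.reg r = 0) : Exec (Prog.loop r p) s 1 s
  | loopStep {r : ℕ} {p : Prog} {s s' s'' : State} {t t' : ℕ} (h : s.reg r ≠ 0)
      (hp : Exec p s t s') (hl : Exec (Prog.loop r p) s' t' s'') :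
      Exec (Prog.loop r p) s (t + 1 + t') s''

/-- Programs are deterministic: the running time and the final state are determined by the
initial state. -/
theorem Exec.deterministic {p : Prog} {s s₁ : State} {t₁ : ℕ} (h₁ : Exec p s t₁ s₁) :
    ∀ {t₂ : ℕ} {s₂ : State}, Exec p s t₂ s₂ → t₁ = t₂ ∧ s₁ = s₂ := by
  induction h₁ with
  | skip | const | add | sub | load | store =>
    intro t₂ s₂ h₂; cases h₂; exact ⟨rfl, rfl⟩
  | seq _ _ ihp ihq =>
    intro t₂ s₂ h₂
    cases h₂ with
    | seq hp hq =>
      obtain ⟨rfl, rfl⟩ := ihp hp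
      obtain ⟨rfl, rfl⟩ := ihq hq
      exact ⟨rfl, rfl⟩
  | iteTrue h _ ih =>
    intro t₂ s₂ h₂
    cases h₂ with
    | iteTrue _ hp => obtain ⟨rfl, rfl⟩ := ih hp; exact ⟨rfl, rfl⟩
    | iteFalse h' _ => exact absurd h' h
  | iteFalse h _ ih =>
    intro t₂ s₂ h₂
    cases h₂ with
    | iteTrue h' _ => exact absurd h h'
    | iteFalse _ hq => obtain ⟨rfl, rfl⟩ := ih hq; exact ⟨rfl, rfl⟩
  | loopDone h =>
    intro t₂ s₂ h₂
    cases h₂ with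
    | loopDone _ => exact ⟨rfl, rfl⟩
    | loopStep h' _ _ => exact absurd h h'
  | loopStep h _ _ ihp ihl =>
    intro t₂ s₂ h₂
    cases h₂ with
    | loopDone h' => exact absurd h' h
    | loopStep _ hp hl =>
      obtain ⟨rfl, rfl⟩ := ihp hp
      obtain ⟨rfl, rfl⟩ := ihl hl
      exact ⟨rfl, rfl⟩

/-- The initial state on the input word `w`: register `0` holds the length of `w`, array `0` holds
the bits of `w`, and everything else is `0`. -/
def initState (w : List Bool) : State where
  reg r := if r = 0 then w.length else 0
  arr a i := if a = 0 then (w.getD i false).toNat else 0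

/-! ### Stars, homomorphism counts and instances -/

/-- A star: a connected graph that has at most one vertex of degree greater than `1`. -/
def IsStar {V : Type*} (F : SimpleGraph V) : Prop :=
  F.Connected ∧ {v : V | 1 < (F.neighborSet v).ncard}.Subsingleton

/-- The number of homomorphisms from `F` to `G`. -/
noncomputable def homCount {V W : Type*} (F : SimpleGraph V) (G : SimpleGraph W) : ℕ :=
  Nat.card (F →g G)

/-- A constraint `(F, m)`: a constraint graph `F` and a count `m`. -/
structure Constraint where
  /-- the order of the constraint graph -/
  order : ℕ
  /-- the constraint graph -/
  graph : SimpleGraph (Fin order)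
  /-- the required number of homomorphisms -/
  count : ℕ

/-- The largest order `ℓ` of a constraint graph (`0` if there is no constraint). -/
def maxOrder (I : List Constraint) : ℕ := (I.map Constraint.order).foldr max 0

/-- The largest count `m` (`0` if there is no constraint). -/
def maxCount (I : List Constraint) : ℕ := (I.map Constraint.count).foldr max 0

/-- `G` satisfies all the constraints: `hom (Fᵢ, G) = mᵢ` for every `i`. -/
def Satisfies {W : Type*} (G : SimpleGraph W) (I : List Constraint) : Prop :=
  ∀ c ∈ I, homCount c.graph G = c.count

/-- There is a finite graph satisfying all the constraints. -/
def Solvable (I : List Constraint) : Prop :=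
  ∃ (n : ℕ) (G : SimpleGraph (Fin n)), Satisfies G I

/-- A number in unary: `n` ones and a terminating zero. -/
def encodeUnary (n : ℕ) : List Bool := List.replicate n true ++ [false]

open scoped Classical in
/-- The adjacency matrix of a graph, row by row. -/
noncomputable def encodeGraph {n : ℕ} (F : SimpleGraph (Fin n)) : List Bool :=
  (List.finRange n).flatMap fun u => (List.finRange n).map fun v => decide (F.Adj u v)

/-- A constraint is encoded by the order (in unary) and the adjacency matrix of the constraint
graph, followed by the count in unary. -/
noncomputable def Constraint.encode (c : Constraint) : List Bool :=
  encodeUnary c.order ++ encodeGraph c.graph ++ encodeUnary c.count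

/-- The encoding of an instance: the concatenation of the encodings of its constraints. -/
noncomputable def encode (I : List Constraint) : List Bool := I.flatMap Constraint.encode

open scoped Classical in
/-- The graph `G` on `{0, …, n - 1}` is written in the state `s`: register `1` holds `n`, and
array `1` holds the adjacency matrix of `G`, row by row. -/
def HoldsGraph (s : State) {n : ℕ} (G : SimpleGraph (Fin n)) : Prop :=
  s.reg 1 = n ∧ ∀ u v : Fin n, s.arr 1 (u.val * n + v.val) = if G.Adj u v then 1 else 0

end StarHomRec

namespace StarHomRec

/-! ### A structured language with expressions and bounded loops -/

/-! A homomorphism from a star with q vertices is an image of the centre together with a free choice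
of a neighbour for each of the q - 1 leaves, so the count is the power sum of the degrees with
exponent q - 1 (`IsStar.homCount_eq`). The question is therefore which power sums are attained by
degree sequences of graphs. A solution with at most m vertices exists if there is any
(`Solvable.exists_le`): the one-vertex star counts the vertices, and without it isolated vertices
can be deleted.

All required power sums are packed as the digits of one number T in the base B = (m+2)^(ℓ+1). A
vertex of degree a receives the weight that collects the terms (aB)^j for the exponents j that
occur. With at most m vertices no digit overflows, so all constraints hold iff the weights add up to
T (`Table.satisfies_iff`). Since T < B^ℓ, a running weight takes only m^{O(ℓ²)} values for m ≥ 2,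
and this is where the exponent ℓ² comes from.

It remains to recognise degree sequences by a search with a short memory. A nonincreasing sequence d
is graphic iff it is dominated, in prefix sums and with equal totals, by the degree sequence of a
shifted graph, one whose neighbourhoods are nested along the order of the vertices. In one
direction, moving edges towards smaller vertices only raises prefix sums and ends in a shifted graph
(`exists_shifted`). In the other, a transfer of an edge from the first vertex with too large a
degree to the first with too small a degree keeps the domination and lowers the total excess by one
(`transfer`), so iteration realises d and also constructs the witness.

A shifted graph can be dismantled from the two ends of an interval [x, y) of vertices. Either the
first vertex is joined to the whole rest of the interval, and then its degree is y - 1, or the last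
vertex is joined to none of it, and then its degree is x. So the shifted graph need not be stored.
The interval, the last degree chosen at either end, the prefix surplus on the left, the suffix
deficit on the right and the running weight suffice, which gives at most (T+1)(m+2)^8 configurations
(`Search.length_le`). The search lists all reachable configurations. Completeness is `exists_goal`;
soundness follows by tracing parents back from a goal (`Completes.top`, `Completes.bot`).

The machine side rests on a language with bounded loops. A weakest precondition `wp M` demands that
no loop runs more than `M` times, so one proof gives correctness together with a time bound
polynomial in `M` (`exec_compile`, `exists_bound_le_pow`). Reading the input is linear in its
length, and everything afterwards depends on ℓ and m only. -/

/-- Arithmetic expressions over registers and arrays. -/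
inductive AExp where
  | lit (c : ℕ) : AExp
  | var (r : ℕ) : AExp
  | add (e f : AExp) : AExp
  | sub (e f : AExp) : AExp
  | load (a : ℕ) (e : AExp) : AExp

namespace AExp

/-- The value of an expression. -/
def eval : AExp → State → ℕ
  | lit c, _ => c
  | var r, s => s.reg r
  | add e f, s => e.eval s + f.eval s
  | sub e f, s => e.eval s - f.eval s
  | load a e, s => s.arr a (e.eval s)

/-- The time needed to evaluate an expression. -/
def time : AExp → ℕ
  | lit _ => 1
  | var _ => 2
  | add e f => e.time + f.time + 1
  | sub e f => e.time + f.time + 1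
  | load _ e => e.time + 1

/-- All registers of the expression are below `D`. -/
def wf (D : ℕ) : AExp → Bool
  | lit _ => true
  | var r => decide (r < D)
  | add e f => e.wf D && f.wf D
  | sub e f => e.wf D && f.wf D
  | load _ e => e.wf D

/-- Evaluate an expression into the scratch register `d`. -/
def compile : AExp → ℕ → Prog
  | lit c, d => .const d c
  | var r, d => .seq (.const d 0) (.add d r d)
  | add e f, d => .seq (e.compile d) (.seq (f.compile (d + 1)) (.add d d (d + 1)))
  | sub e f, d => .seq (e.compile d) (.seq (f.compile (d + 1)) (.sub d d (d + 1)))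
  | load a e, d => .seq (e.compile d) (.load d a d)

/-- Conjunction: the minimum. -/
def and (e f : AExp) : AExp := e.sub (e.sub f)

/-- The test `e < f`. -/
def lt (e f : AExp) : AExp := f.sub e

/-- The test `e ≤ f`. -/
def le (e f : AExp) : AExp := (f.add (lit 1)).sub e

/-- The test `e = f`. -/
def eq (e f : AExp) : AExp := (lit 1).sub ((e.sub f).add (f.sub e))

end AExp

@[simp] theorem State.reg_setReg (s : State) (r x r' : ℕ) :
    (s.setReg r x).reg r' = if r' = r then x else s.reg r' := by
  simp [State.setReg, Function.update_apply]

@[simp] theorem State.arr_setReg (s : State) (r x : ℕ) : (s.setReg r x).arr = s.arr := rfl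

@[simp] theorem State.reg_setArr (s : State) (a i x : ℕ) : (s.setArr a i x).reg = s.reg := rfl

theorem State.arr_setArr_eq (s : State) (a i x a' : ℕ) :
    (s.setArr a i x).arr a' = if a' = a then Function.update (s.arr a) i x else s.arr a' := by
  by_cases h : a' = a
  · subst h; simp [State.setArr]
  · simp [State.setArr, h]

@[simp] theorem State.arr_setArr (s : State) (a i x a' i' : ℕ) :
    (s.setArr a i x).arr a' i' = if a' = a ∧ i' = i then x else s.arr a' i' := by
  by_cases h : a' = a
  · subst h; simp [State.setArr, Function.update_apply]
  · simp [State.setArr, h]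

namespace AExp

@[simp] theorem eval_lit (c : ℕ) (s : State) : (lit c).eval s = c := rfl
@[simp] theorem eval_var (r : ℕ) (s : State) : (var r).eval s = s.reg r := rfl
@[simp] theorem eval_add (e f : AExp) (s : State) : (add e f).eval s = e.eval s + f.eval s := rfl
@[simp] theorem eval_sub (e f : AExp) (s : State) : (sub e f).eval s = e.eval s - f.eval s := rfl
@[simp] theorem eval_load (a : ℕ) (e : AExp) (s : State) :
    (load a e).eval s = s.arr a (e.eval s) := rfl

@[simp] theorem eval_and (e f : AExp) (s : State) :
    (and e f).eval s = 0 ↔ ¬ (e.eval s ≠ 0 ∧ f.eval s ≠ 0) := by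
  simp only [and, eval]; omega

@[simp] theorem eval_lt (e f : AExp) (s : State) :
    (lt e f).eval s = 0 ↔ ¬ e.eval s < f.eval s := by
  simp only [lt, eval]; omega

@[simp] theorem eval_le (e f : AExp) (s : State) :
    (le e f).eval s = 0 ↔ ¬ e.eval s ≤ f.eval s := by
  simp only [le, eval]; omega

@[simp] theorem eval_eq (e f : AExp) (s : State) :
    (eq e f).eval s = 0 ↔ ¬ e.eval s = f.eval s := by
  simp only [eq, eval]; omega

end AExp

/-- The two states have the same arrays and agree on the registers below `D`. -/
def Agree (D : ℕ) (s s' : State) : Prop := (∀ r < D, s.reg r = s'.reg r) ∧ s.arr = s'.arr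

theorem Agree.refl (D : ℕ) (s : State) : Agree D s s := ⟨fun _ _ => rfl, rfl⟩

theorem Agree.eval {D : ℕ} {s s' : State} (h : Agree D s s') :
    ∀ {e : AExp}, e.wf D = true → e.eval s' = e.eval s
  | .lit _, _ => rfl
  | .var r, hw => (h.1 r (by simpa [AExp.wf] using hw)).symm
  | .add e f, hw => by
    simp only [AExp.wf, Bool.and_eq_true] at hw
    simp [h.eval hw.1, h.eval hw.2]
  | .sub e f, hw => by
    simp only [AExp.wf, Bool.and_eq_true] at hw
    simp [h.eval hw.1, h.eval hw.2]
  | .load a e, hw => by simp [h.eval (e := e) hw, h.2]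

/-- The compiled expression is correct and does not touch anything below the scratch register. -/
theorem AExp.exec_compile : ∀ (e : AExp) {D d : ℕ} (s : State), e.wf D = true → D ≤ d →
    ∃ s', Exec (e.compile d) s e.time s' ∧ s'.reg d = e.eval s ∧ s'.arr = s.arr ∧
      ∀ r < d, s'.reg r = s.reg r
  | .lit c, D, d, s, _, _ => ⟨_, .const _ _ _, by simp, by simp, fun r hr => by simp [hr.ne]⟩
  | .var v, D, d, s, hw, hd => by
    have hv : v < D := by simpa [AExp.wf] using hw
    refine ⟨_, .seq (.const _ _ _) (.add _ _ _ _), ?_, by simp, fun r hr => by simp [hr.ne]⟩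
    simp [(hv.trans_le hd).ne]
  | .add e f, D, d, s, hw, hd => by
    simp only [AExp.wf, Bool.and_eq_true] at hw
    obtain ⟨s₁, h₁, r₁, a₁, k₁⟩ := e.exec_compile s hw.1 hd
    obtain ⟨s₂, h₂, r₂, a₂, k₂⟩ := f.exec_compile s₁ hw.2 (hd.trans (Nat.le_succ d))
    have hag : Agree D s s₁ := ⟨fun r hr => (k₁ r (hr.trans_le hd)).symm, a₁.symm⟩
    have hex := Exec.seq h₁ (.seq h₂ (.add d d (d + 1) s₂))
    refine ⟨_, hex, ?_, ?_, ?_⟩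
    · simp [r₂, k₂ d (Nat.lt_succ_self d), r₁, hag.eval hw.2]
    · simp [a₂, a₁]
    · intro r hr; simp [hr.ne, k₂ r (hr.trans (Nat.lt_succ_self d)), k₁ r hr]
  | .sub e f, D, d, s, hw, hd => by
    simp only [AExp.wf, Bool.and_eq_true] at hw
    obtain ⟨s₁, h₁, r₁, a₁, k₁⟩ := e.exec_compile s hw.1 hd
    obtain ⟨s₂, h₂, r₂, a₂, k₂⟩ := f.exec_compile s₁ hw.2 (hd.trans (Nat.le_succ d))
    have hag : Agree D s s₁ := ⟨fun r hr => (k₁ r (hr.trans_le hd)).symm, a₁.symm⟩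
    have hex := Exec.seq h₁ (.seq h₂ (.sub d d (d + 1) s₂))
    refine ⟨_, hex, ?_, ?_, ?_⟩
    · simp [r₂, k₂ d (Nat.lt_succ_self d), r₁, hag.eval hw.2]
    · simp [a₂, a₁]
    · intro r hr; simp [hr.ne, k₂ r (hr.trans (Nat.lt_succ_self d)), k₁ r hr]
  | .load a e, D, d, s, hw, hd => by
    obtain ⟨s₁, h₁, r₁, a₁, k₁⟩ := e.exec_compile s hw hd
    exact ⟨_, .seq h₁ (.load _ _ _ _), by simp [r₁, a₁], by simp [a₁],
      fun r hr => by simp [hr.ne, k₁ r hr]⟩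

/-- Structured statements. All loops are bounded. -/
inductive Stmt where
  | skip : Stmt
  | set (r : ℕ) (e : AExp) : Stmt
  | put (a : ℕ) (i e : AExp) : Stmt
  | seq (c d : Stmt) : Stmt
  | cond (e : AExp) (c d : Stmt) : Stmt
  /-- `for r in [0, e) do c`, where `e` is evaluated once -/
  | loop (r : ℕ) (e : AExp) (c : Stmt) : Stmt

namespace Stmt

/-- All registers of the statement are below `D`. -/
def wf (D : ℕ) : Stmt → Bool
  | skip => true
  | set r e => decide (r < D) && e.wf D
  | put _ i e => i.wf D && e.wf D
  | seq c d => c.wf D && d.wf D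
  | cond e c d => e.wf D && c.wf D && d.wf D
  | loop r e c => decide (r < D) && e.wf D && c.wf D

/-- Translation to the machine; scratch registers start at `d`. -/
def compile : Stmt → ℕ → Prog
  | skip, _ => .skip
  | set r e, d => .seq (e.compile d) (.seq (.const (d + 1) 0) (.add r d (d + 1)))
  | put a i e, d => .seq (i.compile d) (.seq (e.compile (d + 1)) (.store a d (d + 1)))
  | seq c c', d => .seq (c.compile d) (c'.compile d)
  | cond e c c', d => .seq (e.compile d) (.ite d (c.compile d) (c'.compile d))
  | loop r e c, d => .seq (e.compile d) (.seq (.const (d + 1) 0) (.loop d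
      (.seq (.const (d + 2) 0) (.seq (.add r (d + 1) (d + 2)) (.seq (c.compile (d + 2))
        (.seq (.const (d + 2) 1) (.seq (.add (d + 1) (d + 1) (d + 2)) (.sub d d (d + 2)))))))))

/-- A bound for the running time when no loop runs more than `M` times. -/
def bound (M : ℕ) : Stmt → ℕ
  | skip => 1
  | set _ e => e.time + 2
  | put _ i e => i.time + e.time + 1
  | seq c d => c.bound M + d.bound M
  | cond e c d => e.time + 1 + (c.bound M + d.bound M)
  | loop _ e c => e.time + 2 + M * (c.bound M + 6)

/-- The weakest precondition of `n` further rounds of a loop whose counter stands at `k`. -/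
def loopWp (W : (State → Prop) → State → Prop) (r : ℕ) (Q : State → Prop) :
    ℕ → ℕ → State → Prop
  | 0, _, s => Q s
  | n + 1, k, s => W (loopWp W r Q n (k + 1)) (s.setReg r k)

/-- The weakest precondition for ending in `Q` without a loop that runs more than `M` times. -/
def wp (M : ℕ) : Stmt → (State → Prop) → State → Prop
  | skip, Q, s => Q s
  | set r e, Q, s => Q (s.setReg r (e.eval s))
  | put a i e, Q, s => Q (s.setArr a (i.eval s) (e.eval s))
  | seq c d, Q, s => wp M c (wp M d Q) s
  | cond e c d, Q, s => (e.eval s ≠ 0 → wp M c Q s) ∧ (e.eval s = 0 → wp M d Q s)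
  | loop r e c, Q, s => e.eval s ≤ M ∧ loopWp (wp M c) r Q (e.eval s) 0 s

/-- The registers that a statement may change. -/
def regs : Stmt → ℕ → Bool
  | skip, _ => false
  | set r _, x => x == r
  | put _ _ _, _ => false
  | seq c d, x => c.regs x || d.regs x
  | cond _ c d, x => c.regs x || d.regs x
  | loop r _ c, x => x == r || c.regs x

/-- The arrays that a statement may change. -/
def arrs : Stmt → ℕ → Bool
  | skip, _ => false
  | set _ _, _ => false
  | put a _ _, x => x == a
  | seq c d, x => c.arrs x || d.arrs x
  | cond _ c d, x => c.arrs x || d.arrs x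
  | loop _ _ c, x => c.arrs x

/-- The two states differ only where the statement may change something. -/
structure Frame (c : Stmt) (s s' : State) : Prop where
  reg : ∀ r, c.regs r = false → s'.reg r = s.reg r
  arr : ∀ a, c.arrs a = false → s'.arr a = s.arr a

theorem wp_mono {M : ℕ} : ∀ {c : Stmt} {Q Q' : State → Prop} {s : State},
    wp M c Q s → (∀ s', Q s' → Q' s') → wp M c Q' s
  | skip, _, _, _, h, hQ => hQ _ h
  | set _ _, _, _, _, h, hQ => hQ _ h
  | put _ _ _, _, _, _, h, hQ => hQ _ h
  | seq c d, _, _, _, h, hQ => wp_mono (c := c) h fun _ h' => wp_mono (c := d) h' hQ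
  | cond _ c d, _, _, _, h, hQ =>
    ⟨fun he => wp_mono (c := c) (h.1 he) hQ, fun he => wp_mono (c := d) (h.2 he) hQ⟩
  | loop r e c, Q, Q', s, h, hQ => by
    refine ⟨h.1, ?_⟩
    have key : ∀ n k s, loopWp (wp M c) r Q n k s → loopWp (wp M c) r Q' n k s := by
      intro n
      induction n with
      | zero => exact fun k s => hQ s
      | succ n ih => exact fun k s h => wp_mono (c := c) h (ih _)
    exact key _ _ _ h.2

/-- What a statement can write is visible in its syntax, so every postcondition may be strengthened
by the frame. Loop invariants then mention only what the loop changes, and the rest is recovered by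
evaluating `regs` and `arrs`. -/
theorem wp_frame {M : ℕ} : ∀ {c : Stmt} {Q : State → Prop} {s : State},
    wp M c Q s → wp M c (fun s' => Q s' ∧ Frame c s s') s
  | skip, _, _, h => ⟨h, fun _ _ => rfl, fun _ _ => rfl⟩
  | set r _, _, _, h => ⟨h, fun x hx => by simp_all [regs], fun _ _ => rfl⟩
  | put a _ _, _, _, h =>
    ⟨h, fun _ _ => rfl, fun x hx => by funext i; simp_all [arrs]⟩
  | seq c d, _, s, h => by
    refine wp_mono (c := c) (wp_frame (c := c) h) fun s₁ h₁ =>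
      wp_mono (c := d) (wp_frame (c := d) h₁.1) fun s₂ h₂ => ⟨h₂.1, fun r hr => ?_, fun a ha => ?_⟩
    · simp only [regs, Bool.or_eq_false_iff] at hr
      rw [h₂.2.reg r hr.2, h₁.2.reg r hr.1]
    · simp only [arrs, Bool.or_eq_false_iff] at ha
      rw [h₂.2.arr a ha.2, h₁.2.arr a ha.1]
  | cond e c d, _, s, h => by
    refine ⟨fun he => wp_mono (c := c) (wp_frame (c := c) (h.1 he)) fun s₁ h₁ =>
      ⟨h₁.1, fun r hr => ?_, fun a ha => ?_⟩, fun he => wp_mono (c := d) (wp_frame (c := d) (h.2 he))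
      fun s₁ h₁ => ⟨h₁.1, fun r hr => ?_, fun a ha => ?_⟩⟩ <;>
    simp only [regs, arrs, Bool.or_eq_false_iff] at *
    · exact h₁.2.reg r hr.1
    · exact h₁.2.arr a ha.1
    · exact h₁.2.reg r hr.2
    · exact h₁.2.arr a ha.2
  | loop r e c, Q, s, h => by
    refine ⟨h.1, ?_⟩
    have key : ∀ n k s', Frame (loop r e c) s s' → loopWp (wp M c) r Q n k s' →
        loopWp (wp M c) r (fun s' => Q s' ∧ Frame (loop r e c) s s') n k s' := by
      intro n
      induction n with
      | zero => exact fun k s' hf h => ⟨h, hf⟩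
      | succ n ih =>
        intro k s' hf h
        refine wp_mono (c := c) (wp_frame (c := c) h) fun s₁ h₁ =>
          ih _ _ ⟨fun x hx => ?_, fun a ha => ?_⟩ h₁.1
        · have hx' := hx
          simp only [regs, Bool.or_eq_false_iff, beq_eq_false_iff_ne] at hx'
          rw [h₁.2.reg x hx'.2, ← hf.reg x hx]
          simp [hx'.1]
        · rw [h₁.2.arr a ha, ← hf.arr a ha]; rfl
    exact key _ _ _ ⟨fun _ _ => rfl, fun _ _ => rfl⟩ h.2

/-- The invariant rule for bounded loops. -/
theorem wp_loop {M r : ℕ} {e : AExp} {c : Stmt} {Q : State → Prop} {s : State}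
    (Inv : ℕ → State → Prop) (hM : e.eval s ≤ M) (h0 : Inv 0 s)
    (hs : ∀ k s', k < e.eval s → Frame (loop r e c) s s' → Inv k s' →
      wp M c (Inv (k + 1)) (s'.setReg r k))
    (hQ : ∀ s', Frame (loop r e c) s s' → Inv (e.eval s) s' → Q s') :
    wp M (loop r e c) Q s := by
  have key : ∀ n k s', n + k = e.eval s → Inv k s' → Frame (loop r e c) s s' →
      loopWp (wp M c) r (fun s' => Frame (loop r e c) s s' ∧ Inv (e.eval s) s') n k s' := by
    intro n
    induction n with
    | zero => exact fun k s' hk h hf => ⟨hf, by rwa [← hk, Nat.zero_add]⟩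
    | succ n ih =>
      intro k s' hk h hf
      refine wp_mono (c := c) (wp_frame (hs k s' (by omega) hf h)) fun s₁ h₁ =>
        ih _ _ (by omega) h₁.1 ⟨fun x hx => ?_, fun a ha => ?_⟩
      · have hx' := hx
        simp only [regs, Bool.or_eq_false_iff, beq_eq_false_iff_ne] at hx'
        rw [h₁.2.reg x hx'.2, ← hf.reg x hx]
        simp [hx'.1]
      · rw [h₁.2.arr a ha, ← hf.arr a ha]; rfl
  exact wp_mono (c := loop r e c)
    ⟨hM, key _ 0 s rfl h0 ⟨fun _ _ => rfl, fun _ _ => rfl⟩⟩ fun s' h => hQ s' h.1 h.2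

theorem wp_seq {M : ℕ} {c d : Stmt} {Q : State → Prop} {s : State} (Q' : State → Prop)
    (hc : wp M c Q' s) (hd : ∀ s', Frame c s s' → Q' s' → wp M d Q s') : wp M (seq c d) Q s :=
  wp_mono (c := c) (wp_frame hc) fun s' h => hd s' h.2 h.1

/-- The compiled statement ends in `Q` within the time bound. -/
theorem exec_compile {M D : ℕ} : ∀ (c : Stmt) {d : ℕ} {Q : State → Prop} {s u : State},
    c.wf D = true → D ≤ d → Agree D s u → wp M c Q s →
    ∃ t u' s', Exec (c.compile d) u t u' ∧ t ≤ c.bound M ∧ Agree D s' u' ∧ Q s' ∧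
      ∀ r, D ≤ r → r < d → u'.reg r = u.reg r
  | skip, d, Q, s, u, _, _, ha, h => ⟨_, _, s, .skip u, le_rfl, ha, h, fun _ _ _ => rfl⟩
  | set r e, d, Q, s, u, hw, hd, ha, h => by
    simp only [wf, Bool.and_eq_true, decide_eq_true_eq] at hw
    obtain ⟨u₁, h₁, r₁, a₁, k₁⟩ := e.exec_compile u hw.2 hd
    refine ⟨_, _, _, .seq h₁ (.seq (.const _ _ _) (.add _ _ _ _)), le_rfl,
      ⟨fun x hx => ?_, ?_⟩, h, fun x hx hx' => ?_⟩
    · by_cases hxr : x = r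
      · simp [hxr, r₁, ha.eval hw.2]
      · have : x ≠ d + 1 := by omega
        simp [hxr, this, k₁ x (by omega), ha.1 x hx]
    · simp [a₁, ha.2]
    · have h1 : x ≠ r := by omega
      have h2 : x ≠ d + 1 := by omega
      simp [h1, h2, k₁ x hx']
  | put a i e, d, Q, s, u, hw, hd, ha, h => by
    simp only [wf, Bool.and_eq_true] at hw
    obtain ⟨u₁, h₁, r₁, a₁, k₁⟩ := i.exec_compile u hw.1 hd
    obtain ⟨u₂, h₂, r₂, a₂, k₂⟩ := e.exec_compile u₁ hw.2 (hd.trans (Nat.le_succ d))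
    have hag : Agree D s u₁ :=
      ⟨fun r hr => by rw [k₁ r (hr.trans_le hd), ha.1 r hr], by rw [a₁, ha.2]⟩
    refine ⟨_, _, _, .seq h₁ (.seq h₂ (.store _ _ _ _)), ?_,
      ⟨fun x hx => ?_, ?_⟩, h, fun x hx hx' => ?_⟩
    · simp only [bound]; omega
    · simp [k₂ x (by omega), k₁ x (by omega), ha.1 x hx]
    · funext b j
      simp [r₂, k₂ d (Nat.lt_succ_self d), r₁, hag.eval hw.2, ha.eval hw.1, a₂, a₁, ha.2]
    · simp [k₂ x (by omega), k₁ x hx']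
  | seq c c', d, Q, s, u, hw, hd, ha, h => by
    simp only [wf, Bool.and_eq_true] at hw
    obtain ⟨t₁, u₁, s₁, e₁, b₁, a₁, q₁, k₁⟩ := exec_compile c hw.1 hd ha h
    obtain ⟨t₂, u₂, s₂, e₂, b₂, a₂, q₂, k₂⟩ := exec_compile c' hw.2 hd a₁ q₁
    exact ⟨_, _, s₂, .seq e₁ e₂, by simp only [bound]; omega, a₂, q₂,
      fun r hr hr' => by rw [k₂ r hr hr', k₁ r hr hr']⟩
  | cond e c c', d, Q, s, u, hw, hd, ha, h => by
    simp only [wf, Bool.and_eq_true] at hw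
    obtain ⟨u₁, h₁, r₁, a₁, k₁⟩ := e.exec_compile u hw.1.1 hd
    have hag : Agree D s u₁ :=
      ⟨fun r hr => by rw [k₁ r (hr.trans_le hd), ha.1 r hr], by rw [a₁, ha.2]⟩
    rw [ha.eval hw.1.1] at r₁
    by_cases he : e.eval s = 0
    · obtain ⟨t₂, u₂, s₂, e₂, b₂, a₂, q₂, k₂⟩ := exec_compile c' hw.2 hd hag (h.2 he)
      exact ⟨_, _, s₂, .seq h₁ (.iteFalse (by rw [r₁, he]) e₂), by simp only [bound]; omega, a₂, q₂,
        fun r hr hr' => by rw [k₂ r hr hr', k₁ r hr']⟩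
    · obtain ⟨t₂, u₂, s₂, e₂, b₂, a₂, q₂, k₂⟩ := exec_compile c hw.1.2 hd hag (h.1 he)
      exact ⟨_, _, s₂, .seq h₁ (.iteTrue (by rwa [r₁]) e₂), by simp only [bound]; omega, a₂, q₂,
        fun r hr hr' => by rw [k₂ r hr hr', k₁ r hr']⟩
  | loop v e c, d, Q, s, u, hw, hd, ha, h => by
    simp only [wf, Bool.and_eq_true, decide_eq_true_eq] at hw
    obtain ⟨u₁, h₁, r₁, a₁, k₁⟩ := e.exec_compile u hw.1.2 hd
    rw [ha.eval hw.1.2] at r₁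
    -- Register `d` counts the remaining rounds down and `d + 1` counts the index up. The body has
    -- its scratch registers from `d + 2` on and so preserves both counters.
    have key : ∀ n k s u, Agree D s u → u.reg d = n → u.reg (d + 1) = k →
        loopWp (wp M c) v Q n k s → ∃ t u' s', Exec (.loop d
      (.seq (.const (d + 2) 0) (.seq (.add v (d + 1) (d + 2)) (.seq (c.compile (d + 2))
        (.seq (.const (d + 2) 1) (.seq (.add (d + 1) (d + 1) (d + 2)) (.sub d d (d + 2)))))))) u t u' ∧
        t ≤ n * (c.bound M + 6) + 1 ∧ Agree D s' u' ∧ Q s' ∧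
        ∀ r, D ≤ r → r < d → u'.reg r = u.reg r := by
      intro n
      induction n with
      | zero => exact fun k s u ha hn hk h => ⟨_, _, s, .loopDone hn, by omega, ha, h, fun _ _ _ => rfl⟩
      | succ n ih =>
        intro k s u ha hn hk h
        have hag : Agree D (s.setReg v k) ((u.setReg (d + 2) 0).setReg v
            (((u.setReg (d + 2) 0).reg (d + 1)) + ((u.setReg (d + 2) 0).reg (d + 2)))) := by
          refine ⟨fun x hx => ?_, by simp [ha.2]⟩
          have : x ≠ d + 2 := by omega
          simp [hk, this, ha.1 x hx]
        obtain ⟨t₂, u₂, s₂, e₂, b₂, a₂, q₂, k₂⟩ := exec_compile c (d := d + 2) hw.2 (by omega) hag h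
        have k2d : u₂.reg d = n + 1 := by
          have : d ≠ v := by omega
          rw [k₂ d hd (by omega)]; simp [this, hn]
        have k2d1 : u₂.reg (d + 1) = k := by
          have : d + 1 ≠ v := by omega
          rw [k₂ (d + 1) (by omega) (by omega)]; simp [this, hk]
        obtain ⟨t₃, u₃, s₃, e₃, b₃, a₃, q₃, k₃⟩ := ih (k + 1) s₂
          (((u₂.setReg (d + 2) 1).setReg (d + 1) (u₂.reg (d + 1) + 1)).setReg d (u₂.reg d - 1))
          ⟨fun x hx => by
            have h1 : x ≠ d := by omega
            have h2 : x ≠ d + 1 := by omega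
            have h3 : x ≠ d + 2 := by omega
            simp [h1, h2, h3, a₂.1 x hx], by simp [a₂.2]⟩
          (by simp [k2d]) (by simp [k2d1]) q₂
        refine ⟨t₂ + 6 + t₃, u₃, s₃, ?_, by rw [Nat.succ_mul]; omega, a₃, q₃, fun x hx hx' => ?_⟩
        -- The six extra steps of a round are five elementary instructions and the test of the loop
        -- register.
        · have e₃' : t₂ + 6 + t₃ = (1 + (1 + (t₂ + (1 + (1 + 1))))) + 1 + t₃ := by omega
          rw [e₃']
          refine .loopStep (by omega) (.seq (.const _ _ _) (.seq (.add _ _ _ _) (.seq e₂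
            (.seq (.const _ _ _) (.seq (.add _ _ _ _) (.sub _ _ _ _)))))) ?_
          simpa using e₃
        · rw [k₃ x hx hx']
          have h1 : x ≠ d := by omega
          have h2 : x ≠ d + 1 := by omega
          have h3 : x ≠ d + 2 := by omega
          have h4 : x ≠ v := by omega
          simp [h1, h2, h3, h4, k₂ x hx (by omega)]
    obtain ⟨t₂, u₂, s₂, e₂, b₂, a₂, q₂, k₂⟩ := key (e.eval s) 0 s (u₁.setReg (d + 1) 0)
      ⟨fun x hx => by
        have h2 : x ≠ d + 1 := by omega
        simp [h2, k₁ x (by omega), ha.1 x hx], by simp [a₁, ha.2]⟩ (by simp [r₁]) (by simp) h.2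
    refine ⟨_, _, s₂, .seq h₁ (.seq (.const _ _ _) e₂), ?_, a₂, q₂, fun x hx hx' => ?_⟩
    · have := Nat.mul_le_mul_right (c.bound M + 6) h.1
      simp only [bound]; omega
    · have h2 : x ≠ d + 1 := by omega
      rw [k₂ x hx hx']; simp [h2, k₁ x hx']

/-- The time bound is polynomial. -/
theorem exists_bound_le_pow : ∀ c : Stmt, ∃ k, ∀ M, 2 ≤ M → c.bound M ≤ M ^ k := by
  have hlt : ∀ n M : ℕ, 2 ≤ M → n ≤ M ^ n := fun n M hM =>
    (Nat.lt_pow_self (by omega)).le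
  -- The assumption `2 ≤ M` lets one more factor `M` absorb the factor two of a sum.
  have hadd : ∀ M a b i j : ℕ, 2 ≤ M → a ≤ M ^ i → b ≤ M ^ j → a + b ≤ M ^ (i + j + 1) := by
    intro M a b i j hM ha hb
    have h1 : M ^ i ≤ M ^ (i + j) := Nat.pow_le_pow_right (by omega) (by omega)
    have h2 : M ^ j ≤ M ^ (i + j) := Nat.pow_le_pow_right (by omega) (by omega)
    calc a + b ≤ M ^ (i + j) * 2 := by omega
      _ ≤ M ^ (i + j) * M := Nat.mul_le_mul_left _ hM
  intro c
  induction c with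
  | skip => exact ⟨1, fun M hM => hlt 1 M hM⟩
  | set r e => exact ⟨_, fun M hM => hlt _ M hM⟩
  | put a i e => exact ⟨_, fun M hM => hlt _ M hM⟩
  | seq c d hc hd =>
    obtain ⟨k, hk⟩ := hc
    obtain ⟨l, hl⟩ := hd
    exact ⟨_, fun M hM => hadd M _ _ _ _ hM (hk M hM) (hl M hM)⟩
  | cond e c d hc hd =>
    obtain ⟨k, hk⟩ := hc
    obtain ⟨l, hl⟩ := hd
    exact ⟨_, fun M hM => hadd M _ _ _ _ hM (hlt _ M hM) (hadd M _ _ _ _ hM (hk M hM) (hl M hM))⟩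
  | loop r e c hc =>
    obtain ⟨k, hk⟩ := hc
    refine ⟨_, fun M hM => hadd M _ _ (e.time + 2) (1 + (k + 6 + 1)) hM (hlt _ M hM) ?_⟩
    rw [pow_add M 1, pow_one]
    exact Nat.mul_le_mul_left _ (hadd M _ _ _ _ hM (hk M hM) (hlt _ M hM))

end Stmt

/-! ### Edge moves, shifted graphs and domination of degree sequences -/

open scoped Classical in
/-- The number of neighbours below `n` in a graph on the natural numbers. -/
noncomputable def deg (n : ℕ) (A : SimpleGraph ℕ) (v : ℕ) : ℕ :=
  ((Finset.range n).filter (A.Adj v)).card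

/-- Replace the edge `iw` by the edge `jw`. -/
def moveEdge (A : SimpleGraph ℕ) (i j w : ℕ) : SimpleGraph ℕ :=
  A.deleteEdges {s(i, w)} ⊔ SimpleGraph.edge j w

theorem moveEdge_adj {A : SimpleGraph ℕ} {i j w u v : ℕ} (hjw : j ≠ w) :
    (moveEdge A i j w).Adj u v ↔ (A.Adj u v ∧ ¬ (u = i ∧ v = w) ∧ ¬ (u = w ∧ v = i)) ∨
      (u = j ∧ v = w) ∨ (u = w ∧ v = j) := by
  simp only [moveEdge, SimpleGraph.sup_adj, SimpleGraph.deleteEdges_adj, Set.mem_singleton_iff,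
    Sym2.eq_iff, SimpleGraph.edge_adj]
  constructor
  · rintro (h | h) <;> grind
  · rintro (h | h) <;> grind

/-- Vertex `i` loses the neighbour `w`, `j` gains it, and `w` trades `i` for `j`, so its own degree
stays. The indicators stand on both sides in order to avoid truncated subtraction. -/
theorem deg_moveEdge {n : ℕ} {A : SimpleGraph ℕ} {i j w : ℕ} (hij : i ≠ j) (hi : i < n)
    (hj : j < n) (hw : w < n) (hiw : A.Adj i w) (hjw : ¬ A.Adj j w) (hne : j ≠ w) (v : ℕ) :
    deg n (moveEdge A i j w) v + (if v = i then 1 else 0) =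
      deg n A v + (if v = j then 1 else 0) := by
  classical
  have hiw' := hiw.ne
  have hwi := hiw.symm
  have hwj : ¬ A.Adj w j := fun h => hjw h.symm
  by_cases h1 : v = i
  · subst h1
    have : (Finset.range n).filter ((moveEdge A v j w).Adj v) =
        ((Finset.range n).filter (A.Adj v)).erase w := by
      ext u; simp only [Finset.mem_filter, Finset.mem_erase, moveEdge_adj hne]; grind
    have hm : w ∈ (Finset.range n).filter (A.Adj v) := by simp [hw, hiw]
    have := congrArg Finset.card this
    rw [Finset.card_erase_of_mem hm] at this
    have hpos := Finset.card_pos.2 ⟨w, hm⟩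
    simp only [deg, if_true, if_neg hij]
    omega
  by_cases h2 : v = j
  · subst h2
    have : (Finset.range n).filter ((moveEdge A i v w).Adj v) =
        insert w ((Finset.range n).filter (A.Adj v)) := by
      ext u; simp only [Finset.mem_filter, Finset.mem_insert, Finset.mem_range, moveEdge_adj hne]
      grind
    have := congrArg Finset.card this
    rw [Finset.card_insert_of_notMem (by simp [hjw])] at this
    simp only [deg, if_true, if_neg h1]
    omega
  simp only [if_neg h1, if_neg h2, deg, Nat.add_zero]
  by_cases h3 : v = w
  · subst h3
    have : (Finset.range n).filter ((moveEdge A i j v).Adj v) =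
        insert j (((Finset.range n).filter (A.Adj v)).erase i) := by
      ext u
      simp only [Finset.mem_filter, Finset.mem_insert, Finset.mem_erase, Finset.mem_range,
        moveEdge_adj hne]
      grind
    have hm : i ∈ (Finset.range n).filter (A.Adj v) := by simp [hi, hwi]
    rw [this, Finset.card_insert_of_notMem (by simp [hwj]), Finset.card_erase_of_mem hm]
    have hpos := Finset.card_pos.2 ⟨i, hm⟩
    omega
  · congr 1
    ext u
    simp only [Finset.mem_filter, moveEdge_adj hne]
    grind

theorem sum_deg_moveEdge {n : ℕ} {A : SimpleGraph ℕ} {i j w : ℕ} (hij : i ≠ j) (hi : i < n)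
    (hj : j < n) (hw : w < n) (hiw : A.Adj i w) (hjw : ¬ A.Adj j w) (hne : j ≠ w) (k : ℕ) :
    ∑ v ∈ Finset.range k, deg n (moveEdge A i j w) v + (if i < k then 1 else 0) =
      ∑ v ∈ Finset.range k, deg n A v + (if j < k then 1 else 0) := by
  have := Finset.sum_congr (rfl : Finset.range k = Finset.range k)
    fun v _ => deg_moveEdge hij hi hj hw hiw hjw hne v
  simpa [Finset.sum_add_distrib] using this

/-- `t` dominates `d` on `[0, n)`: the prefix sums of `t` are at least those of `d`, and the
totals are equal. -/
structure Dominates (n : ℕ) (t d : ℕ → ℕ) : Prop where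
  prefix_le : ∀ k ≤ n, ∑ v ∈ Finset.range k, d v ≤ ∑ v ∈ Finset.range k, t v
  total : ∑ v ∈ Finset.range n, d v = ∑ v ∈ Finset.range n, t v

theorem Dominates.refl (n : ℕ) (t : ℕ → ℕ) : Dominates n t t := ⟨fun _ _ => le_rfl, rfl⟩

theorem Dominates.trans {n : ℕ} {t u d : ℕ → ℕ} (h : Dominates n t u) (h' : Dominates n u d) :
    Dominates n t d :=
  ⟨fun k hk => (h'.prefix_le k hk).trans (h.prefix_le k hk), h'.total.trans h.total⟩

/-- Neighbourhoods below `n` shrink along the natural order. -/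
def Shifted (n : ℕ) (A : SimpleGraph ℕ) : Prop :=
  ∀ i j w, i < j → j < n → w < n → w ≠ i → A.Adj j w → A.Adj i w

/-- Moving edges upwards leads to a shifted graph. -/
theorem exists_shifted (n : ℕ) (A : SimpleGraph ℕ) :
    ∃ A', Shifted n A' ∧ Dominates n (deg n A') (deg n A) := by
  -- The sum of v · deg v is a potential: where shiftedness fails for `i < j`, replacing the edge
  -- `jw` by `iw` lowers it by j - i, so the process ends.
  induction hN : ∑ v ∈ Finset.range n, v * deg n A v using Nat.strong_induction_on generalizing A with
  | _ N ih =>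
    subst hN
    by_cases hs : Shifted n A
    · exact ⟨A, hs, .refl _ _⟩
    simp only [Shifted, not_forall] at hs
    obtain ⟨i, j, w, hij, hj, hw, hwi, hjw, hiw⟩ := hs
    have hi := hij.trans hj
    have hsum := sum_deg_moveEdge hij.ne' hj hi hw hjw hiw hwi.symm
    have hdeg := deg_moveEdge hij.ne' hj hi hw hjw hiw hwi.symm
    have hlt : ∑ v ∈ Finset.range n, v * deg n (moveEdge A j i w) v <
        ∑ v ∈ Finset.range n, v * deg n A v := by
      have h := Finset.sum_congr (rfl : Finset.range n = Finset.range n)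
        fun v _ => congrArg (v * ·) (hdeg v)
      simp only [Nat.mul_add, Finset.sum_add_distrib, mul_ite, mul_one, mul_zero,
        Finset.sum_ite_eq', Finset.mem_range, hi, hj, if_true] at h
      omega
    obtain ⟨A', hA', hd⟩ := ih _ hlt _ rfl
    refine ⟨A', hA', hd.trans ⟨fun k hk => ?_, ?_⟩⟩
    · have := hsum k
      split_ifs at this <;> omega
    · have := hsum n
      simp only [hi, hj, if_true] at this
      omega

/-- The totals are equal, so a termwise inequality is an equality everywhere. This is why the
transfers may stop as soon as no vertex has a surplus. -/
theorem exists_surplus {n : ℕ} {t d : ℕ → ℕ} (h : Dominates n t d)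
    (hle : ∀ v < n, t v ≤ d v) : ∀ v < n, t v = d v := by
  have := (Finset.sum_eq_sum_iff_of_le (s := Finset.range n) (f := t) (g := d)
    (fun i hi => hle i (by simpa using hi))).1 h.total.symm
  exact fun v hv => this v (by simpa using hv)

theorem exists_deficit {n : ℕ} {t d : ℕ → ℕ} (h : Dominates n t d) {i : ℕ} (hi : i < n)
    (hlt : d i < t i) : ∃ j < n, t j < d j := by
  by_contra! hc
  exact absurd h.total (Finset.sum_lt_sum (fun v hv => hc v (by simpa using hv))
    ⟨i, by simpa using hi, hlt⟩).ne

/-- One transfer from the first surplus to the first deficit. -/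
theorem transfer {n : ℕ} {A : SimpleGraph ℕ} {d : ℕ → ℕ} {i j : ℕ}
    (hanti : ∀ u v, u ≤ v → v < n → d v ≤ d u) (hdom : Dominates n (deg n A) d)
    (hi : i < n) (hdi : d i < deg n A i) (hmini : ∀ u < i, deg n A u ≤ d u)
    (hj : j < n) (hdj : deg n A j < d j) (hminj : ∀ u < j, d u ≤ deg n A u) :
    i < j ∧ (∃ w < n, A.Adj i w ∧ ¬ A.Adj j w ∧ j ≠ w) ∧
    ∀ w < n, A.Adj i w → ¬ A.Adj j w → j ≠ w →
      Dominates n (deg n (moveEdge A i j w)) d ∧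
      ∑ v ∈ Finset.range n, (deg n (moveEdge A i j w) v - d v) + 1 =
        ∑ v ∈ Finset.range n, (deg n A v - d v) := by
  classical
  -- If `j ≤ i`, no vertex before `j` has a surplus while `j` has a deficit, which contradicts the
  -- prefix inequality at `j + 1`.
  have hij : i < j := by
    by_contra hc
    have hji : j ≤ i := by omega
    have h1 := hdom.prefix_le (j + 1) hj
    rw [Finset.sum_range_succ, Finset.sum_range_succ] at h1
    have h2 : ∑ v ∈ Finset.range j, deg n A v ≤ ∑ v ∈ Finset.range j, d v :=
      Finset.sum_le_sum fun v hv => hmini v (by simp at hv; omega)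
    omega
  refine ⟨hij, ?_, ?_⟩
  -- From deg i > d i ≥ d j > deg j the two degrees differ by at least two, so the neighbours of `i`
  -- cannot all be `j` or neighbours of `j`.
  · by_contra! hc
    have hsub : (Finset.range n).filter (A.Adj i) ⊆
        insert j ((Finset.range n).filter (A.Adj j)) := by
      intro w hw
      simp only [Finset.mem_filter, Finset.mem_range, Finset.mem_insert] at hw ⊢
      by_cases h : A.Adj j w
      · exact Or.inr ⟨hw.1, h⟩
      · exact Or.inl (hc w hw.1 hw.2 h).symm
    have h1 := (Finset.card_le_card hsub).trans (Finset.card_insert_le _ _)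
    have h2 := hanti i j hij.le hj
    simp only [deg] at *
    omega
  · intro w hw hiw hjw hne
    have hsum := sum_deg_moveEdge hij.ne hi hj hw hiw hjw hne
    have hdeg := deg_moveEdge hij.ne hi hj hw hiw hjw hne
    refine ⟨⟨fun k hk => ?_, ?_⟩, ?_⟩
    · have h := hsum k
      have h1 := hdom.prefix_le k hk
      split_ifs at h with h2 h3 h3
      · omega
      -- Only here, for i < k ≤ j, does the prefix sum drop. There is room for the loss: before `j`
      -- there is no deficit, and the surplus at `i` makes the inequality strict.
      · have h4 : ∑ v ∈ Finset.range k, d v < ∑ v ∈ Finset.range k, deg n A v :=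
          Finset.sum_lt_sum (fun v hv => hminj v (by simp at hv; omega)) ⟨i, by simpa using h2, hdi⟩
        omega
      · omega
      · omega
    · have h := hsum n
      simp only [hi, hj, if_true] at h
      have := hdom.total
      omega
    · have h1 : ∀ v ∈ Finset.range n, (deg n (moveEdge A i j w) v - d v) +
          (if v = i then 1 else 0) = deg n A v - d v := by
        intro v _
        have := hdeg v
        split_ifs at this ⊢ with h2 h3 h3 <;> subst_vars <;> omega
      have := Finset.sum_congr rfl h1
      simpa [Finset.sum_add_distrib, hi] using this

/-! ### Certificates for graphic sequences -/

/-- A state of the search: the interval `[x, y)` of vertices that are not yet treated, the range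
`[lo, hi]` of their degrees, the surplus `p` of the treated vertices below `x`, the deficit `q` of
the treated vertices from `y` on, and the weight `s` of all treated vertices. -/
structure Cfg where
  x : ℕ
  y : ℕ
  lo : ℕ
  hi : ℕ
  p : ℕ
  q : ℕ
  s : ℕ

namespace Cfg

/-- The start of the search on `n` vertices. -/
def root (n : ℕ) : Cfg := ⟨0, n, 0, n, 0, 0, 0⟩

/-- Vertex `x` is joined to the rest of the interval and has degree `a` in the end. -/
def top (w : ℕ → ℕ) (c : Cfg) (a : ℕ) : Cfg :=
  ⟨c.x + 1, c.y, c.lo, a, c.p + (c.y - 1) - a, c.q, c.s + w a⟩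

/-- Vertex `y - 1` is not joined to the rest of the interval and has degree `a` in the end. -/
def bot (w : ℕ → ℕ) (c : Cfg) (a : ℕ) : Cfg :=
  ⟨c.x, c.y - 1, a, c.hi, c.p, c.q + a - c.x, c.s + w a⟩

/-- The degree `a` is possible for the next vertex. -/
def Fits (w : ℕ → ℕ) (T : ℕ) (c : Cfg) (a : ℕ) : Prop :=
  c.x < c.y ∧ c.lo ≤ a ∧ a ≤ c.hi ∧ c.s + w a ≤ T

/-- One step of the search. -/
def Step (w : ℕ → ℕ) (T : ℕ) (c c' : Cfg) : Prop :=
  ∃ a, c.Fits w T a ∧ ((a ≤ c.p + (c.y - 1) ∧ c' = c.top w a) ∨ (c.x ≤ c.q + a ∧ c' = c.bot w a))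

/-- The search has succeeded. -/
def Goal (T : ℕ) (c : Cfg) : Prop := c.x = c.y ∧ c.p = c.q ∧ c.s = T

end Cfg

/-- Vertex `u` is joined to the vertices `v` with `u < v < e u`. -/
def upTo (e : ℕ → ℕ) : SimpleGraph ℕ where
  Adj u v := u ≠ v ∧ max u v < e (min u v)
  symm := ⟨fun u v h => ⟨h.1.symm, by rw [max_comm, min_comm]; exact h.2⟩⟩
  loopless := ⟨fun u h => h.1 rfl⟩

theorem upTo_adj {e : ℕ → ℕ} {u v : ℕ} :
    (upTo e).Adj u v ↔ u ≠ v ∧ max u v < e (min u v) := Iff.rfl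

open scoped Classical in
/-- The degrees `d`, the degrees `g` in the shifted graph, and the ends `e` of its
neighbourhoods complete the configuration `c`. -/
structure Completes (w : ℕ → ℕ) (T : ℕ) (c : Cfg) (d g e : ℕ → ℕ) : Prop where
  le : c.x ≤ c.y
  anti : ∀ i j, c.x ≤ i → i ≤ j → j < c.y → d j ≤ d i
  lo_le : ∀ i, c.x ≤ i → i < c.y → c.lo ≤ d i
  le_hi : ∀ i, c.x ≤ i → i < c.y → d i ≤ c.hi
  prefix_le : ∀ k, c.x ≤ k → k ≤ c.y →
    ∑ i ∈ Finset.Ico c.x k, d i ≤ c.p + ∑ i ∈ Finset.Ico c.x k, g i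
  total : c.p + ∑ i ∈ Finset.Ico c.x c.y, g i = c.q + ∑ i ∈ Finset.Ico c.x c.y, d i
  weight : c.s + ∑ i ∈ Finset.Ico c.x c.y, w (d i) = T
  end_le : ∀ i, c.x ≤ i → i < c.y → e i ≤ c.y
  deg_eq : ∀ i, c.x ≤ i → i < c.y →
    g i = c.x + ((Finset.Ico c.x c.y).filter ((upTo e).Adj i)).card

/-- The interval of a goal is empty, so no value of the three functions matters. Tracing back
therefore starts with arbitrary array contents. -/
theorem completes_of_goal {w : ℕ → ℕ} {T : ℕ} {c : Cfg} (h : c.Goal T) (d g e : ℕ → ℕ) :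
    Completes w T c d g e := by
  obtain ⟨h1, h2, h3⟩ := h
  constructor <;> intros <;> first | omega | simp_all

theorem sum_Ico_update_of_lt {f : ℕ → ℕ} {x k b v : ℕ} (hx : b < x) :
    ∑ i ∈ Finset.Ico x k, Function.update f b v i = ∑ i ∈ Finset.Ico x k, f i :=
  Finset.sum_congr rfl fun i hi => by
    rw [Function.update_of_ne]; simp at hi; omega

theorem sum_Ico_update_of_le {f : ℕ → ℕ} {x k b v : ℕ} (hx : k ≤ b) :
    ∑ i ∈ Finset.Ico x k, Function.update f b v i = ∑ i ∈ Finset.Ico x k, f i :=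
  Finset.sum_congr rfl fun i hi => by
    rw [Function.update_of_ne]; simp at hi; omega

/-- A vertex joined to all of the interval is put back in front. It has `c.x` earlier neighbours and
the `c.y - 1 - c.x` others of the interval, together `c.y - 1`. Every other vertex of the interval
gains it as a neighbour, which the offset `c.x + 1` of the smaller configuration already counts. The
hypothesis `hp` makes the subtraction in the new surplus exact. -/
theorem Completes.top {w : ℕ → ℕ} {T : ℕ} {c : Cfg} {a : ℕ} {d g e : ℕ → ℕ}
    (ha : c.Fits w T a) (hp : a ≤ c.p + (c.y - 1)) (h : Completes w T (c.top w a) d g e) :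
    Completes w T c (Function.update d c.x a) (Function.update g c.x (c.y - 1))
      (Function.update e c.x c.y) := by
  classical
  obtain ⟨x, y, lo, hi, p, q, s⟩ := c
  obtain ⟨hxy, hlo, hhi, hs⟩ := ha
  obtain ⟨h0, h1, h2, h3, h4, h5, h6, h8, h7⟩ := h
  simp only [Cfg.top] at *
  have hd : ∀ i, x < i → Function.update d x a i = d i :=
    fun i hi => Function.update_of_ne (by omega) _ _
  have hg : ∀ i, x < i → Function.update g x (y - 1) i = g i :=
    fun i hi => Function.update_of_ne (by omega) _ _
  have he : ∀ i, x < i → Function.update e x y i = e i :=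
    fun i hi => Function.update_of_ne (by omega) _ _
  constructor
  · exact hxy.le
  · intro i j hi hij hj
    dsimp only at *
    rcases Nat.eq_or_lt_of_le hi with rfl | hi'
    · rcases Nat.eq_or_lt_of_le hij with rfl | hj'
      · rfl
      · rw [hd j hj', Function.update_self]; exact h3 j hj' hj
    · rw [hd i hi', hd j (by omega)]; exact h1 i j hi' hij hj
  · intro i hi hiy
    dsimp only at *
    rcases Nat.eq_or_lt_of_le hi with rfl | hi'
    · simpa using hlo
    · rw [hd i hi']; exact h2 i hi' hiy
  · intro i hi hiy
    dsimp only at *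
    rcases Nat.eq_or_lt_of_le hi with rfl | hi'
    · simpa using hhi
    · rw [hd i hi']; exact (h3 i hi' hiy).trans hhi
  · intro k hk hky
    dsimp only at *
    rcases Nat.eq_or_lt_of_le hk with rfl | hk'
    · simp
    · rw [Finset.sum_eq_sum_Ico_succ_bot hk', Finset.sum_eq_sum_Ico_succ_bot hk',
        sum_Ico_update_of_lt (by omega), sum_Ico_update_of_lt (by omega), Function.update_self,
        Function.update_self]
      have := h4 k hk' hky
      omega
  · dsimp only at *
    rw [Finset.sum_eq_sum_Ico_succ_bot hxy, Finset.sum_eq_sum_Ico_succ_bot hxy,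
        sum_Ico_update_of_lt (by omega), sum_Ico_update_of_lt (by omega), Function.update_self,
        Function.update_self]
    omega
  · dsimp only at *
    rw [Finset.sum_eq_sum_Ico_succ_bot hxy, Function.update_self, ← add_assoc, ← h6]
    congr 1
    refine Finset.sum_congr rfl fun i hi => ?_
    rw [hd i (by simp at hi; omega)]
  · intro i hi hiy
    dsimp only at *
    rcases Nat.eq_or_lt_of_le hi with rfl | hi'
    · simp
    · rw [he i hi']; exact h8 i hi' hiy
  · intro i hi hiy
    dsimp only at *
    have hadj : ∀ u v, x < u → x < v →
        ((upTo (Function.update e x y)).Adj u v ↔ (upTo e).Adj u v) := by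
      intro u v hu hv
      simp only [upTo_adj]
      rw [he _ (by omega)]
    rcases Nat.eq_or_lt_of_le hi with rfl | hi'
    · have : (Finset.Ico x y).filter ((upTo (Function.update e x y)).Adj x) =
          Finset.Ico (x + 1) y := by
        ext v
        simp only [Finset.mem_filter, Finset.mem_Ico, upTo_adj]
        constructor
        · omega
        · intro hv
          refine ⟨by omega, by omega, ?_⟩
          rw [min_eq_left (by omega), Function.update_self]
          omega
      rw [this, Function.update_self, Nat.card_Ico]
      omega
    · rw [hg i hi', h7 i hi' hiy]
      have : (Finset.Ico x y).filter ((upTo (Function.update e x y)).Adj i) =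
          insert x ((Finset.Ico (x + 1) y).filter ((upTo e).Adj i)) := by
        ext v
        simp only [Finset.mem_filter, Finset.mem_Ico, Finset.mem_insert]
        constructor
        · rintro ⟨hv, hv'⟩
          by_cases hvx : v = x
          · exact Or.inl hvx
          · exact Or.inr ⟨by omega, (hadj i v hi' (by omega)).1 hv'⟩
        · rintro (rfl | ⟨hv, hv'⟩)
          · refine ⟨by omega, by omega, ?_⟩
            rw [min_eq_right (by omega), Function.update_self]
            omega
          · exact ⟨by omega, (hadj i v hi' (by omega)).2 hv'⟩
      rw [this, Finset.card_insert_of_notMem (by simp)]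
      omega

/-- A vertex without neighbours in the interval is put back at the end, so only the `c.x` earlier
vertices contribute to its degree. The end `0` and the field `end_le` exclude all edges at it inside
the interval. The hypothesis `hp` makes the subtraction in the new deficit exact. -/
theorem Completes.bot {w : ℕ → ℕ} {T : ℕ} {c : Cfg} {a : ℕ} {d g e : ℕ → ℕ}
    (ha : c.Fits w T a) (hp : c.x ≤ c.q + a) (h : Completes w T (c.bot w a) d g e) :
    Completes w T c (Function.update d (c.y - 1) a) (Function.update g (c.y - 1) c.x)
      (Function.update e (c.y - 1) 0) := by
  classical
  obtain ⟨x, y, lo, hi, p, q, s⟩ := c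
  obtain ⟨hxy, hlo, hhi, hs⟩ := ha
  obtain ⟨h0, h1, h2, h3, h4, h5, h6, h8, h7⟩ := h
  simp only [Cfg.bot] at *
  obtain ⟨y, rfl⟩ : ∃ z, y = z + 1 := ⟨y - 1, by omega⟩
  simp only [Nat.add_sub_cancel] at *
  have hxy' : x ≤ y := by omega
  have hd : ∀ i, i < y → Function.update d y a i = d i :=
    fun i hi => Function.update_of_ne (by omega) _ _
  have hg : ∀ i, i < y → Function.update g y x i = g i :=
    fun i hi => Function.update_of_ne (by omega) _ _
  have he : ∀ i, i < y → Function.update e y 0 i = e i :=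
    fun i hi => Function.update_of_ne (by omega) _ _
  -- The totals come first, because the prefix inequality for the whole interval follows from them:
  -- the deficit `q` is a natural number.
  have htot : p + ∑ i ∈ Finset.Ico x (y + 1), Function.update g y x i =
      q + ∑ i ∈ Finset.Ico x (y + 1), Function.update d y a i := by
    rw [Finset.sum_Ico_succ_top hxy', Finset.sum_Ico_succ_top hxy',
      sum_Ico_update_of_le le_rfl, sum_Ico_update_of_le le_rfl, Function.update_self,
      Function.update_self]
    omega
  constructor
  · exact hxy.le
  · intro i j hi hij hj
    dsimp only at *
    rcases Nat.eq_or_lt_of_le (Nat.le_of_lt_succ hj) with rfl | hj'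
    · rcases Nat.eq_or_lt_of_le hij with rfl | hj'
      · rfl
      · rw [hd i hj', Function.update_self]; exact h2 i hi hj'
    · rw [hd i (by omega), hd j (by omega)]; exact h1 i j hi hij hj'
  · intro i hi hiy
    dsimp only at *
    rcases Nat.eq_or_lt_of_le (Nat.le_of_lt_succ hiy) with rfl | hi'
    · simpa using hlo
    · rw [hd i hi']; exact hlo.trans (h2 i hi hi')
  · intro i hi hiy
    dsimp only at *
    rcases Nat.eq_or_lt_of_le (Nat.le_of_lt_succ hiy) with rfl | hi'
    · simpa using hhi
    · rw [hd i hi']; exact h3 i hi hi'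
  · intro k hk hky
    dsimp only at *
    rcases Nat.eq_or_lt_of_le hky with rfl | hk'
    · omega
    · rw [sum_Ico_update_of_le (by omega), sum_Ico_update_of_le (by omega)]
      exact h4 k hk (by omega)
  · exact htot
  · dsimp only at *
    rw [Finset.sum_Ico_succ_top hxy', Function.update_self, ← h6]
    rw [Finset.sum_congr rfl fun i hi => by rw [hd i (by simp at hi; omega)]]
    omega
  · intro i hi hiy
    dsimp only at *
    rcases Nat.eq_or_lt_of_le (Nat.le_of_lt_succ hiy) with rfl | hi'
    · simp
    · rw [he i hi']; exact (h8 i hi hi').trans (Nat.le_succ _)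
  · intro i hi hiy
    dsimp only at *
    have hadj : ∀ u v, u < y → v < y →
        ((upTo (Function.update e y 0)).Adj u v ↔ (upTo e).Adj u v) := by
      intro u v hu hv
      simp only [upTo_adj]
      rw [he _ (by omega)]
    have hend : ∀ v, x ≤ v → v ≤ y → ¬ (upTo (Function.update e y 0)).Adj v y := by
      intro v hxv hv hadj'
      rw [upTo_adj, max_eq_right hv, min_eq_left hv] at hadj'
      have hvy : v < y := by omega
      rw [he v hvy] at hadj'
      have := h8 v hxv hvy
      omega
    rcases Nat.eq_or_lt_of_le (Nat.le_of_lt_succ hiy) with rfl | hi'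
    · have : (Finset.Ico x (i + 1)).filter ((upTo (Function.update e i 0)).Adj i) = ∅ := by
        ext v
        simp only [Finset.mem_filter, Finset.mem_Ico, Finset.notMem_empty, iff_false]
        rintro ⟨hv, hv'⟩
        exact hend v (by omega) (by omega) hv'.symm
      rw [this, Function.update_self]
      rfl
    · rw [hg i hi', h7 i hi hi']
      congr 2
      ext v
      simp only [Finset.mem_filter, Finset.mem_Ico]
      constructor
      · rintro ⟨hv, hv'⟩
        exact ⟨by omega, (hadj i v hi' (by omega)).2 hv'⟩
      · rintro ⟨hv, hv'⟩
        have hvy : v ≠ y := by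
          rintro rfl
          exact hend i hi hi'.le hv'
        exact ⟨by omega, (hadj i v hi' (by omega)).1 hv'⟩

/-- The search finds every graphic sequence. -/
theorem exists_goal {w : ℕ → ℕ} {T n : ℕ} {A : SimpleGraph ℕ} {d : ℕ → ℕ} {R : Cfg → Prop}
    (hR : ∀ c c', R c → Cfg.Step w T c c' → R c') (hroot : R (Cfg.root n)) (hA : Shifted n A)
    (hdom : Dominates n (deg n A) d) (hanti : ∀ u v, u ≤ v → v < n → d v ≤ d u)
    (hdn : ∀ u < n, d u ≤ n) (hT : ∑ v ∈ Finset.range n, w (d v) = T) :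
    ∃ c, R c ∧ c.Goal T := by
  classical
  -- Vertices below `x` are joined to all others below `y`, and no vertex from `y` on has a
  -- neighbour from `x` on. Under this invariant the configuration is determined by `x`, `y`, `d`
  -- and `A`; the induction is on the length `k` of the interval.
  have main : ∀ k x y, y = x + k → y ≤ n →
      (∀ i j, i < x → j < y → i ≠ j → A.Adj i j) →
      (∀ i j, y ≤ j → j < n → x ≤ i → i < n → ¬ A.Adj j i) →
      R ⟨x, y, if y < n then d y else 0, if 0 < x then d (x - 1) else n,
        ∑ v ∈ Finset.range x, deg n A v - ∑ v ∈ Finset.range x, d v,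
        ∑ v ∈ Finset.Ico y n, d v - ∑ v ∈ Finset.Ico y n, deg n A v,
        ∑ v ∈ Finset.range x, w (d v) + ∑ v ∈ Finset.Ico y n, w (d v)⟩ → ∃ c, R c ∧ c.Goal T := by
    intro k
    have hsplit : ∀ (f : ℕ → ℕ) k, k ≤ n →
        ∑ v ∈ Finset.range k, f v + ∑ v ∈ Finset.Ico k n, f v = ∑ v ∈ Finset.range n, f v :=
      fun f k hk => Finset.sum_range_add_sum_Ico f hk
    -- Complement of the prefix inequality: in suffix sums `d` is the larger one, so the truncated
    -- difference that stands for the deficit is exact.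
    have hsuff : ∀ k, k ≤ n →
        ∑ v ∈ Finset.Ico k n, deg n A v ≤ ∑ v ∈ Finset.Ico k n, d v := by
      intro k hk
      have h1 := hsplit (deg n A) k hk
      have h2 := hsplit d k hk
      have h3 := hdom.prefix_le k hk
      have h4 := hdom.total
      omega
    induction k with
    | zero =>
      rintro x y rfl hy - - hc
      refine ⟨_, hc, rfl, ?_, ?_⟩
      · have h1 := hsplit (deg n A) y hy
        have h2 := hsplit d y hy
        have h4 := hdom.total
        have h5 := hsuff y hy
        have h6 := hdom.prefix_le y hy
        dsimp only
        omega
      · rw [← hT]; exact hsplit (fun v => w (d v)) y hy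
    | succ k ih =>
      rintro x y rfl hy htop hbot hc
      have hxn : x < n := by omega
      have hwle : ∀ z, x ≤ z → z < x + (k + 1) → ∑ v ∈ Finset.range x, w (d v) +
          ∑ v ∈ Finset.Ico (x + (k + 1)) n, w (d v) + w (d z) ≤ T := by
        intro z hz hz'
        rw [← hT, ← hsplit (fun v => w (d v)) x hxn.le]
        have h1 : ∑ v ∈ Finset.Ico x (x + (k + 1)), w (d v) +
            ∑ v ∈ Finset.Ico (x + (k + 1)) n, w (d v) = ∑ v ∈ Finset.Ico x n, w (d v) :=
          Finset.sum_Ico_consecutive _ (by omega) hy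
        have h2 : w (d z) ≤ ∑ v ∈ Finset.Ico x (x + (k + 1)), w (d v) :=
          Finset.single_le_sum (f := fun v => w (d v)) (fun _ _ => Nat.zero_le _) (by simp; omega)
        omega
      have hfit : ∀ z, x ≤ z → z < x + (k + 1) → Cfg.Fits w T ⟨x, x + (k + 1),
          if x + (k + 1) < n then d (x + (k + 1)) else 0, if 0 < x then d (x - 1) else n,
          ∑ v ∈ Finset.range x, deg n A v - ∑ v ∈ Finset.range x, d v,
          ∑ v ∈ Finset.Ico (x + (k + 1)) n, d v - ∑ v ∈ Finset.Ico (x + (k + 1)) n, deg n A v,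
          ∑ v ∈ Finset.range x, w (d v) + ∑ v ∈ Finset.Ico (x + (k + 1)) n, w (d v)⟩ (d z) := by
        intro z hz hz'
        refine ⟨by dsimp only; omega, ?_, ?_, hwle z hz hz'⟩ <;> dsimp only <;> split_ifs
        · exact hanti _ _ (by omega) (by assumption)
        · omega
        · exact hanti _ _ (by omega) (by omega)
        · exact hdn _ (by omega)
      -- By nestedness one pair decides. If the two ends of the interval are adjacent, the first
      -- vertex is joined to the whole rest; otherwise the last vertex is joined to nothing in the
      -- interval. An interval with a single vertex falls under the second case.
      by_cases hadj : x ≠ x + k ∧ A.Adj x (x + k)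
      · have hall : ∀ j < x + (k + 1), x ≠ j → A.Adj x j := by
          intro j hj hxj
          rcases lt_or_gt_of_ne hxj with h | h
          · rcases Nat.eq_or_lt_of_le (show j ≤ x + k by omega) with rfl | h'
            · exact hadj.2
            · exact (hA j (x + k) x h' (by omega) hxn (by omega) hadj.2.symm).symm
          · exact (htop j x h (by omega) (by omega)).symm
        have hdegx : deg n A x = x + k := by
          have : (Finset.range n).filter (A.Adj x) = (Finset.range (x + (k + 1))).erase x := by
            ext j
            simp only [Finset.mem_filter, Finset.mem_range, Finset.mem_erase]
            constructor
            · rintro ⟨hj, hj'⟩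
              refine ⟨hj'.ne', ?_⟩
              by_contra hc
              exact hbot x j (by omega) hj le_rfl hxn hj'.symm
            · rintro ⟨hj, hj'⟩
              exact ⟨by omega, hall j hj' (Ne.symm hj)⟩
          rw [deg, this, Finset.card_erase_of_mem (by simp), Finset.card_range]
          omega
        have h1 := hdom.prefix_le (x + 1) hxn
        have h2 := hdom.prefix_le x hxn.le
        rw [Finset.sum_range_succ, Finset.sum_range_succ, hdegx] at h1
        refine ih (x + 1) (x + (k + 1)) (by omega) hy ?_ ?_ ?_
        · intro i j hi hj hij
          rcases Nat.eq_or_lt_of_le (Nat.le_of_lt_succ hi) with rfl | hi'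
          · exact hall j hj hij
          · exact htop i j hi' hj hij
        · intro i j hj hjn hi hin
          exact hbot i j hj hjn (by omega) hin
        · refine hR _ _ hc ⟨d x, hfit x le_rfl (by omega), Or.inl ⟨?_, ?_⟩⟩
          · dsimp only; omega
          · simp only [Cfg.top, Cfg.mk.injEq, Finset.sum_range_succ, hdegx, Nat.add_sub_cancel,
              Nat.succ_pos, if_true, true_and]
            omega
      · have hnone : ∀ i, x ≤ i → i < n → ¬ A.Adj (x + k) i := by
          intro i hi hin h
          have hik := h.ne
          by_cases hiy : x + (k + 1) ≤ i
          · exact hbot (x + k) i hiy hin (by omega) (by omega) h.symm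
          rcases Nat.eq_or_lt_of_le hi with rfl | hi'
          · exact hadj ⟨by omega, h.symm⟩
          · exact hadj ⟨by omega, hA x i (x + k) hi' hin (by omega) (by omega) h.symm⟩
        have hdegx : deg n A (x + k) = x := by
          have : (Finset.range n).filter (A.Adj (x + k)) = Finset.range x := by
            ext j
            simp only [Finset.mem_filter, Finset.mem_range]
            constructor
            · rintro ⟨hj, hj'⟩
              by_contra hc
              exact hnone j (by omega) hj hj'
            · intro hj
              exact ⟨by omega, (htop j (x + k) hj (by omega) (by omega)).symm⟩
          rw [deg, this, Finset.card_range]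
        have h1 := hsuff (x + k) (by omega)
        have h2 := hsuff (x + (k + 1)) hy
        have hico : ∀ f : ℕ → ℕ, ∑ v ∈ Finset.Ico (x + k) n, f v =
            f (x + k) + ∑ v ∈ Finset.Ico (x + (k + 1)) n, f v :=
          fun f => Finset.sum_eq_sum_Ico_succ_bot (by omega) f
        rw [hico, hico, hdegx] at h1
        refine ih x (x + k) rfl (by omega) ?_ ?_ ?_
        · intro i j hi hj hij
          exact htop i j hi (by omega) hij
        · intro i j hj hjn hi hin
          rcases Nat.eq_or_lt_of_le hj with rfl | hj'
          · exact hnone i hi hin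
          · exact hbot i j (by omega) hjn hi hin
        · refine hR _ _ hc ⟨d (x + k), hfit (x + k) (by omega) (by omega), Or.inr ⟨?_, ?_⟩⟩
          · dsimp only; omega
          · simp only [Cfg.bot, Cfg.mk.injEq, hico, hdegx, true_and]
            have : x + k < n := by omega
            simp only [this, if_true]
            exact ⟨by omega, trivial, by omega, by omega⟩
  refine main n 0 n (by omega) le_rfl (by omega) (by omega) ?_
  simpa [Cfg.root] using hroot

/-! ### Homomorphisms from stars -/

/-- The centre is a vertex of degree greater than 1, or any vertex if there is none. An edge
avoiding it would have both ends of degree one and so be a whole component, against connectedness.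
Hence the first edge of a walk from another vertex to the centre already arrives there. -/
theorem IsStar.exists_center {V : Type*} [Finite V] {F : SimpleGraph V} (h : IsStar F) :
    ∃ c, ∀ u v, F.Adj u v ↔ (u = c ∧ v ≠ c) ∨ (v = c ∧ u ≠ c) := by
  obtain ⟨hc, hs⟩ := h
  have := hc.nonempty
  obtain ⟨c, hc1⟩ : ∃ c, ∀ v, v ≠ c → (F.neighborSet v).ncard ≤ 1 := by
    by_cases h : ∃ c, 1 < (F.neighborSet c).ncard
    · obtain ⟨c, hc⟩ := h
      refine ⟨c, fun v hv => ?_⟩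
      by_contra! h
      exact hv (hs h hc)
    · push Not at h
      exact ⟨Classical.arbitrary V, fun v _ => h v⟩
  have huniq : ∀ u v w, u ≠ c → F.Adj u v → F.Adj u w → v = w := fun u v w hu hv hw =>
    (Set.ncard_le_one (Set.toFinite _)).1 (hc1 u hu) v hv w hw
  have hno : ∀ u v, u ≠ c → v ≠ c → ¬ F.Adj u v := by
    intro u v hu hv huv
    have hr := (SimpleGraph.reachable_iff_reflTransGen u c).1 (hc.preconnected u c)
    have : ∀ z, Relation.ReflTransGen F.Adj u z → z = u ∨ z = v := by
      intro z hz
      induction hz with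
      | refl => exact Or.inl rfl
      | tail _ hab ih =>
        rcases ih with rfl | rfl
        · exact Or.inr (huniq _ _ _ hu hab huv)
        · exact Or.inl (huniq _ _ _ hv hab huv.symm)
    rcases this c hr with h | h
    · exact hu h.symm
    · exact hv h.symm
  have hcv : ∀ v, v ≠ c → F.Adj c v := by
    intro v hv
    obtain ⟨p⟩ := hc.preconnected v c
    cases p with
    | nil => exact absurd rfl hv
    | @cons _ w _ hvw _ =>
      by_cases hw : w = c
      · subst hw; exact hvw.symm
      · exact absurd hvw (hno _ _ hv hw)
  refine ⟨c, fun u v => ⟨fun h => ?_, ?_⟩⟩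
  · by_cases hu : u = c
    · subst hu; exact Or.inl ⟨rfl, h.ne'⟩
    · by_cases hv : v = c
      · exact Or.inr ⟨hv, hu⟩
      · exact absurd h (hno u v hu hv)
  · rintro (⟨rfl, h⟩ | ⟨rfl, h⟩)
    · exact hcv v h
    · exact (hcv u h).symm

/-- All edges join the centre to the other vertices, so a bijection that matches the centres is an
isomorphism. Thus the order alone identifies a star, which lets the input matrices be skipped and
bounds the number of distinct constraint graphs. -/
theorem IsStar.nonempty_iso {V : Type*} [Finite V] {F F' : SimpleGraph V} (h : IsStar F)
    (h' : IsStar F') : Nonempty (F ≃g F') := by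
  classical
  obtain ⟨c, hc⟩ := h.exists_center
  obtain ⟨c', hc'⟩ := h'.exists_center
  have key : ∀ u, Equiv.swap c c' u = c' ↔ u = c := fun u => by
    rw [← Equiv.eq_symm_apply]; simp
  refine ⟨Equiv.swap c c', ?_⟩
  intro u v
  simp only [hc', hc, key, ne_eq]

/-- The degree of a vertex, without a choice of an instance. -/
noncomputable def ndeg {V : Type*} (G : SimpleGraph V) (v : V) : ℕ := (G.neighborSet v).ncard

/-- The homomorphisms from a star are counted by a power sum of the degrees. -/
theorem IsStar.homCount_eq {q : ℕ} {F : SimpleGraph (Fin q)} (h : IsStar F) {n : ℕ}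
    (G : SimpleGraph (Fin n)) : homCount F G = ∑ v, ndeg G v ^ (q - 1) := by
  obtain ⟨c, hc⟩ := h.exists_center
  -- The pair consists of the image of the centre and of independent choices of a neighbour for the
  -- leaves.
  let E : (F →g G) ≃ Σ w : Fin n, ({v : Fin q // v ≠ c} → G.neighborSet w) :=
    { toFun := fun f => ⟨f c, fun v => ⟨f v, f.map_adj ((hc c v).2 (Or.inl ⟨rfl, v.2⟩))⟩⟩
      invFun := fun x =>
        { toFun := fun v => if hv : v = c then x.1 else (x.2 ⟨v, hv⟩ : Fin n)
          map_rel' := by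
            intro u v huv
            rcases (hc u v).1 huv with ⟨rfl, hv⟩ | ⟨rfl, hu⟩
            · rw [dif_pos rfl, dif_neg hv]; exact (x.2 ⟨v, hv⟩).2
            · rw [dif_pos rfl, dif_neg hu]; exact (x.2 ⟨u, hu⟩).2.symm }
      left_inv := by
        intro f
        ext v
        by_cases hv : v = c
        · subst hv; simp
        · simp [hv]
      right_inv := by
        rintro ⟨w, f⟩
        have key : ∀ w' (f' : {v : Fin q // v ≠ c} → G.neighborSet w'), w' = w →
            (∀ v, (f' v : Fin n) = f v) →
            (⟨w', f'⟩ : Σ w : Fin n, ({v : Fin q // v ≠ c} → G.neighborSet w)) = ⟨w, f⟩ := by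
          rintro _ f' rfl h
          exact congrArg _ (funext fun v => Subtype.ext (h v))
        exact key _ _ (dif_pos rfl) fun v => dif_neg v.2 }
  rw [homCount, Nat.card_congr E, Nat.card_sigma]
  refine Finset.sum_congr rfl fun w _ => ?_
  rw [Nat.card_fun, Nat.card_coe_set_eq, ndeg]
  congr 1
  simp

/-! ### Graphs on an initial segment of the natural numbers -/

theorem ndeg_comap {n : ℕ} (A : SimpleGraph ℕ) (v : Fin n) :
    ndeg (A.comap Fin.val : SimpleGraph (Fin n)) v = deg n A v := by
  classical
  rw [ndeg, deg, ← Set.ncard_image_of_injective _ Fin.val_injective, ← Set.ncard_coe_finset]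
  congr 1
  ext u
  simp only [Set.mem_image, SimpleGraph.mem_neighborSet, SimpleGraph.comap_adj, Finset.coe_filter,
    Finset.mem_range]
  constructor
  · rintro ⟨u, hu, rfl⟩; exact ⟨u.2, hu⟩
  · rintro ⟨hu, hu'⟩; exact ⟨⟨u, hu⟩, hu', rfl⟩

theorem sum_ndeg_comap {n : ℕ} (A : SimpleGraph ℕ) (f : ℕ → ℕ) :
    ∑ v, f (ndeg (A.comap Fin.val : SimpleGraph (Fin n)) v) =
      ∑ v ∈ Finset.range n, f (deg n A v) := by
  rw [← Fin.sum_univ_eq_sum_range (fun v => f (deg n A v))]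
  exact Finset.sum_congr rfl fun v _ => by rw [ndeg_comap]

/-- The vertices of a graph can be sorted by degree. -/
theorem exists_antitone_deg {n : ℕ} (G : SimpleGraph (Fin n)) :
    ∃ A : SimpleGraph ℕ, (∀ u v, u ≤ v → v < n → deg n A v ≤ deg n A u) ∧
      ∀ f : ℕ → ℕ, ∑ v ∈ Finset.range n, f (deg n A v) = ∑ v, f (ndeg G v) := by
  -- Sorting by values in the order dual makes the degrees nonincreasing.
  let σ := Tuple.sort (fun v => OrderDual.toDual (ndeg G v))
  have hσ := Tuple.monotone_sort (fun v => OrderDual.toDual (ndeg G v))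
  let A : SimpleGraph ℕ := (G.comap σ).map Fin.valEmbedding
  have hA : (A.comap Fin.val : SimpleGraph (Fin n)) = G.comap σ :=
    SimpleGraph.comap_map_eq Fin.valEmbedding _
  have hdeg : ∀ v : Fin n, deg n A v = ndeg G (σ v) := fun v => by
    rw [← ndeg_comap, hA, ndeg, ndeg, ← Set.ncard_image_of_injective _ σ.injective]
    congr 1
    ext u
    simp only [Set.mem_image, SimpleGraph.mem_neighborSet, SimpleGraph.comap_adj]
    exact ⟨fun ⟨w, hw, h⟩ => h ▸ hw, fun h => ⟨σ.symm u, by simpa using h, by simp⟩⟩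
  refine ⟨A, fun u v huv hv => ?_, fun f => ?_⟩
  · have := hσ (show (⟨u, huv.trans_lt hv⟩ : Fin n) ≤ ⟨v, hv⟩ from huv)
    have h1 := hdeg ⟨u, huv.trans_lt hv⟩
    have h2 := hdeg ⟨v, hv⟩
    dsimp only at h1 h2
    rw [h1, h2]
    exact this
  · rw [← Fin.sum_univ_eq_sum_range (fun v => f (deg n A v)),
      ← Equiv.sum_comp σ (fun v => f (ndeg G v))]
    exact Finset.sum_congr rfl fun v _ => by rw [hdeg]

theorem ndeg_le {n : ℕ} (G : SimpleGraph (Fin n)) (v : Fin n) : ndeg G v ≤ n := by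
  simpa [ndeg] using Set.ncard_le_card (G.neighborSet v)

theorem deg_le (n : ℕ) (A : SimpleGraph ℕ) (v : ℕ) : deg n A v ≤ n := by
  classical
  exact (Finset.card_filter_le _ _).trans (by simp)

/-! ### The reduction to one weighted sum -/

theorem le_foldr_max {l : List ℕ} {x : ℕ} (h : x ∈ l) : x ≤ l.foldr max 0 := by
  induction l with
  | nil => simp at h
  | cons y l ih =>
    rcases List.mem_cons.1 h with rfl | h
    · exact le_max_left _ _
    · exact (ih h).trans (le_max_right _ _)

theorem order_le_maxOrder {I : List Constraint} {c : Constraint} (h : c ∈ I) :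
    c.order ≤ maxOrder I := le_foldr_max (List.mem_map_of_mem h)

theorem count_le_maxCount {I : List Constraint} {c : Constraint} (h : c ∈ I) :
    c.count ≤ maxCount I := le_foldr_max (List.mem_map_of_mem h)

theorem IsStar.order_pos {q : ℕ} {F : SimpleGraph (Fin q)} (h : IsStar F) : 0 < q := by
  obtain ⟨v⟩ := h.1.nonempty
  exact v.pos

/-- A solvable instance has a solution with at most `maxCount I` vertices. -/
theorem Solvable.exists_le {I : List Constraint} (hI : ∀ c ∈ I, IsStar c.graph)
    (h : Solvable I) : ∃ n ≤ maxCount I, ∃ G : SimpleGraph (Fin n), Satisfies G I := by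
  classical
  obtain ⟨n, G, hG⟩ := h
  -- The one-vertex star counts the vertices, so its count bounds `n`. Without it all exponents are
  -- positive, isolated vertices contribute nothing and can be deleted, and each remaining vertex
  -- contributes at least one to every power sum.
  by_cases h1 : ∃ c ∈ I, c.order = 1
  · obtain ⟨c, hc, hc1⟩ := h1
    refine ⟨n, ?_, G, hG⟩
    have := hG c hc
    rw [(hI c hc).homCount_eq, hc1] at this
    simp only [Nat.sub_self, pow_zero, Finset.sum_const, Finset.card_univ, Fintype.card_fin,
      smul_eq_mul, mul_one] at this
    exact this ▸ count_le_maxCount hc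
  have h2 : ∀ c ∈ I, 2 ≤ c.order := by
    intro c hc
    have := (hI c hc).order_pos
    by_contra h
    exact h1 ⟨c, hc, by omega⟩
  cases hIe : I with
  | nil => exact ⟨0, Nat.zero_le _, ⊥, by simp [Satisfies]⟩
  | cons c₀ I' =>
  rw [← hIe]
  have hc₀ : c₀ ∈ I := by rw [hIe]; exact List.mem_cons_self
  let S : Set (Fin n) := {v | 0 < ndeg G v}
  let e := (Finite.equivFin S)
  let H : SimpleGraph (Fin (Nat.card S)) := (G.induce S).comap e.symm
  have hdeg : ∀ u, ndeg H u = ndeg G (e.symm u) := by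
    intro u
    rw [ndeg, ndeg, ← Set.ncard_image_of_injective _
      (Subtype.val_injective.comp e.symm.injective)]
    congr 1
    ext v
    simp only [Set.mem_image, SimpleGraph.mem_neighborSet]
    constructor
    · rintro ⟨w, hw, rfl⟩; exact hw
    · intro h
      have hv : v ∈ S := (Set.ncard_pos (Set.toFinite _)).2 ⟨_, h.symm⟩
      have he : e.symm (e ⟨v, hv⟩) = ⟨v, hv⟩ := e.symm_apply_apply _
      refine ⟨e ⟨v, hv⟩, ?_, congrArg Subtype.val he⟩
      change G.Adj _ (e.symm (e ⟨v, hv⟩)).val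
      rwa [he]
  have hsum : ∀ k, 0 < k → ∑ u, ndeg H u ^ k = ∑ v, ndeg G v ^ k := by
    intro k hk
    have h3 : ∑ u, ndeg H u ^ k = ∑ v : S, ndeg G v ^ k := by
      rw [← Equiv.sum_comp e.symm]
      exact Finset.sum_congr rfl fun u _ => by rw [hdeg]
    rw [h3, ← Finset.sum_filter_add_sum_filter_not Finset.univ (fun v => v ∈ S)
      (fun v => ndeg G v ^ k)]
    rw [Finset.sum_eq_zero (s := Finset.univ.filter fun v => ¬ v ∈ S), add_zero]
    · exact (Finset.sum_subtype _ (by simp) (fun v => ndeg G v ^ k)).symm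
    · intro v hv
      simp only [S, Finset.mem_filter, Set.mem_ofPred_eq, Nat.pos_iff_ne_zero, not_not] at hv
      rw [hv.2, zero_pow hk.ne']
  have hH : Satisfies H I := by
    intro c hc
    have := h2 c hc
    rw [← hG c hc, (hI c hc).homCount_eq, (hI c hc).homCount_eq, hsum _ (by omega)]
  refine ⟨_, ?_, H, hH⟩
  refine le_trans ?_ (count_le_maxCount hc₀)
  rw [← hH c₀ hc₀, (hI c₀ hc₀).homCount_eq]
  calc Nat.card S = ∑ u : Fin (Nat.card S), 1 := by
          rw [Finset.sum_const, Finset.card_univ, Fintype.card_fin, smul_eq_mul, mul_one]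
    _ ≤ _ := Finset.sum_le_sum fun u _ => by
      rw [hdeg]
      exact Nat.one_le_pow _ _ (e.symm u).2

/-- The tables `has` and `val` describe the instance `I`. -/
structure Table (I : List Constraint) (has val : ℕ → ℕ) : Prop where
  has_ne : ∀ c ∈ I, has c.order ≠ 0
  val_eq : ∀ c ∈ I, val c.order = c.count
  exists_of_has : ∀ q, has q ≠ 0 → ∃ c ∈ I, c.order = q

/-- The base of the encoding of the power sums by one number. -/
def base (I : List Constraint) : ℕ := (maxCount I + 2) ^ (maxOrder I + 1)

/-- The weight of a vertex of degree `a`: its contributions to the power sums that occur in the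
instance, as the digits of one number in base `B`. -/
def weight (has : ℕ → ℕ) (B l a : ℕ) : ℕ :=
  ∑ j ∈ Finset.range l, if has (j + 1) ≠ 0 then (a * B) ^ j else 0

/-- The required power sums as the digits of one number in base `B`. -/
def target (has val : ℕ → ℕ) (B l : ℕ) : ℕ :=
  ∑ j ∈ Finset.range l, if has (j + 1) ≠ 0 then val (j + 1) * B ^ j else 0

/-- Reduction modulo `B` isolates the lowest digit; cancelling it and a factor `B` leaves a shorter
expansion. -/
theorem digits_unique {B : ℕ} : ∀ {l : ℕ} {a b : ℕ → ℕ}, (∀ j < l, a j < B) → (∀ j < l, b j < B) →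
    ∑ j ∈ Finset.range l, a j * B ^ j = ∑ j ∈ Finset.range l, b j * B ^ j → ∀ j < l, a j = b j
  | 0, _, _, _, _, _ => by simp
  | l + 1, a, b, ha, hb, h => by
    have key : ∀ a : ℕ → ℕ, ∑ j ∈ Finset.range (l + 1), a j * B ^ j =
        a 0 + B * ∑ j ∈ Finset.range l, a (j + 1) * B ^ j := by
      intro a
      rw [Finset.sum_range_succ', Finset.mul_sum, add_comm]
      congr 1
      · simp
      · exact Finset.sum_congr rfl fun j _ => by ring
    rw [key, key] at h
    have h0 : a 0 = b 0 := by
      have := congrArg (· % B) h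
      simpa [Nat.add_mul_mod_self_left, Nat.mod_eq_of_lt (ha 0 (Nat.succ_pos l)),
        Nat.mod_eq_of_lt (hb 0 (Nat.succ_pos l))] using this
    have hB : 0 < B := (Nat.zero_le _).trans_lt (ha 0 (Nat.succ_pos l))
    rw [h0] at h
    have h1 := Nat.eq_of_mul_eq_mul_left hB (Nat.add_left_cancel h)
    have ih := digits_unique (a := fun j => a (j + 1)) (b := fun j => b (j + 1))
      (fun j hj => ha _ (by omega)) (fun j hj => hb _ (by omega)) h1
    intro j hj
    cases j with
    | zero => exact h0
    | succ j => exact ih j (by omega)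

theorem sum_digits_lt {B : ℕ} {a : ℕ → ℕ} : ∀ {l : ℕ}, (∀ j < l, a j < B) →
    ∑ j ∈ Finset.range l, a j * B ^ j < B ^ l
  | 0, _ => by simp
  | l + 1, ha => by
    have ih := sum_digits_lt (l := l) fun j hj => ha j (by omega)
    have h1 : (a l + 1) * B ^ l ≤ B * B ^ l := Nat.mul_le_mul_right _ (ha l (by omega))
    rw [Finset.sum_range_succ, pow_succ, mul_comm (B ^ l)]
    rw [Nat.add_mul] at h1
    omega

theorem Table.val_lt {I : List Constraint} {has val : ℕ → ℕ} (hT : Table I has val) (q : ℕ) :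
    (if has q ≠ 0 then val q else 0) < base I := by
  have h2 : maxCount I + 2 ≤ base I := Nat.le_self_pow (by omega) _
  split_ifs with h
  · obtain ⟨c, hc, rfl⟩ := hT.exists_of_has q h
    rw [hT.val_eq c hc]
    have := count_le_maxCount hc
    omega
  · omega

theorem target_eq (has val : ℕ → ℕ) (B l : ℕ) : target has val B l =
    ∑ j ∈ Finset.range l, (if has (j + 1) ≠ 0 then val (j + 1) else 0) * B ^ j :=
  Finset.sum_congr rfl fun j _ => by split_ifs <;> simp

theorem Table.target_lt {I : List Constraint} {has val : ℕ → ℕ} (hT : Table I has val) :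
    target has val (base I) (maxOrder I) < base I ^ maxOrder I := by
  rw [target_eq]
  exact sum_digits_lt fun j _ => hT.val_lt _

/-- A small graph satisfies the instance iff the sum of the weights is the target. -/
theorem Table.satisfies_iff {I : List Constraint} {has val : ℕ → ℕ} (hT : Table I has val)
    (hI : ∀ c ∈ I, IsStar c.graph) {n : ℕ} (hn : n ≤ maxCount I) (G : SimpleGraph (Fin n)) :
    Satisfies G I ↔ ∑ v, weight has (base I) (maxOrder I) (ndeg G v) =
      target has val (base I) (maxOrder I) := by
  have hsum : ∑ v, weight has (base I) (maxOrder I) (ndeg G v) =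
      ∑ j ∈ Finset.range (maxOrder I),
        (if has (j + 1) ≠ 0 then ∑ v, ndeg G v ^ j else 0) * base I ^ j := by
    simp only [weight]
    rw [Finset.sum_comm]
    refine Finset.sum_congr rfl fun j _ => ?_
    split_ifs
    · simp [mul_pow, Finset.sum_mul]
    · simp
  rw [hsum, target_eq]
  constructor
  · intro h
    refine Finset.sum_congr rfl fun j _ => ?_
    split_ifs with hj
    · obtain ⟨c, hc, hcq⟩ := hT.exists_of_has _ hj
      rw [← hcq, hT.val_eq c hc, ← h c hc, (hI c hc).homCount_eq, hcq, Nat.add_sub_cancel]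
    · rfl
  · intro h c hc
    -- No carries occur: at most m vertices of degree at most m give a power sum below (m+2)^(j+1),
    -- which is at most the base.
    have hlt : ∀ j < maxOrder I,
        (if has (j + 1) ≠ 0 then ∑ v, ndeg G v ^ j else 0) < base I := by
      intro j hj
      split_ifs
      · calc ∑ v, ndeg G v ^ j ≤ ∑ v : Fin n, (maxCount I + 2) ^ j :=
              Finset.sum_le_sum fun v _ => Nat.pow_le_pow_left
                ((ndeg_le G v).trans (by omega)) _
          _ = n * (maxCount I + 2) ^ j := by simp
          _ < (maxCount I + 2) * (maxCount I + 2) ^ j :=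
              Nat.mul_lt_mul_of_pos_right (by omega) (by positivity)
          _ = (maxCount I + 2) ^ (j + 1) := by ring
          _ ≤ base I := Nat.pow_le_pow_right (by omega) (by omega)
      · exact Nat.pow_pos (by omega)
    have hpos := (hI c hc).order_pos
    have := digits_unique hlt (fun j _ => hT.val_lt _) h (c.order - 1)
      (by have := order_le_maxOrder hc; omega)
    rw [Nat.sub_add_cancel hpos, if_pos (hT.has_ne c hc), if_pos (hT.has_ne c hc),
      hT.val_eq c hc] at this
    rw [(hI c hc).homCount_eq, this]

/-- If the instance is solvable then every set of configurations that is closed under the steps of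
the search and contains the starting points contains a goal. -/
theorem Table.exists_goal {I : List Constraint} {has val : ℕ → ℕ} (hT : Table I has val)
    (hI : ∀ c ∈ I, IsStar c.graph) (h : Solvable I) {R : Cfg → Prop}
    (hroot : ∀ n ≤ maxCount I, R (Cfg.root n))
    (hstep : ∀ c c', R c → Cfg.Step (weight has (base I) (maxOrder I))
      (target has val (base I) (maxOrder I)) c c' → R c') :
    ∃ c, R c ∧ c.Goal (target has val (base I) (maxOrder I)) := by
  classical
  obtain ⟨n, hn, G, hG⟩ := h.exists_le hI
  obtain ⟨A, hA, hsum⟩ := exists_antitone_deg G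
  obtain ⟨A', hs, hd⟩ := exists_shifted n A
  refine StarHomRec.exists_goal hstep (hroot n hn) hs hd hA (fun u _ => deg_le n A u) ?_
  rw [hsum]
  exact (hT.satisfies_iff hI hn G).1 hG

/-- A graph on `[0, n)` whose degrees are the completion of a starting point is a solution. -/
theorem Table.satisfies_of_completes {I : List Constraint} {has val : ℕ → ℕ}
    (hT : Table I has val) (hI : ∀ c ∈ I, IsStar c.graph) {n : ℕ} (hn : n ≤ maxCount I)
    {d g e : ℕ → ℕ} (hc : Completes (weight has (base I) (maxOrder I))
      (target has val (base I) (maxOrder I)) (Cfg.root n) d g e) {A : SimpleGraph ℕ}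
    (hA : ∀ v < n, deg n A v = d v) : Satisfies (A.comap Fin.val : SimpleGraph (Fin n)) I := by
  classical
  rw [hT.satisfies_iff hI hn, sum_ndeg_comap A (weight has (base I) (maxOrder I)), ← hc.weight]
  simp only [Cfg.root, Nat.Ico_zero_eq_range, Nat.zero_add]
  exact Finset.sum_congr rfl fun v hv => by rw [hA v (by simpa using hv)]

/-- The completion of a starting point is dominated by the degrees of the shifted graph. -/
theorem Completes.dominates {w : ℕ → ℕ} {T n : ℕ} {d g e : ℕ → ℕ}
    (hc : Completes w T (Cfg.root n) d g e) :
    (∀ v < n, deg n (upTo e) v = g v) ∧ Dominates n (deg n (upTo e)) d := by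
  have h1 : ∀ v < n, deg n (upTo e) v = g v := fun v hv => by
    simpa [deg, Cfg.root] using (hc.deg_eq v (Nat.zero_le v) hv).symm
  refine ⟨h1, fun k hk => ?_, ?_⟩
  · have := hc.prefix_le k (Nat.zero_le k) hk
    simp only [Cfg.root, Nat.Ico_zero_eq_range, Nat.zero_add] at this
    rwa [Finset.sum_congr rfl fun v hv => h1 v (by simp at hv; omega)]
  · have := hc.total
    simp only [Cfg.root, Nat.Ico_zero_eq_range, Nat.zero_add] at this
    rw [← this]
    exact Finset.sum_congr rfl fun v hv => (h1 v (by simpa using hv)).symm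

-- Notation and rewriting rules for weakest preconditions

infixr:60 " ;; " => Stmt.seq

namespace Stmt

variable {M : ℕ} {Q : State → Prop} {s : State}

@[simp] theorem wp_skip_iff : wp M skip Q s ↔ Q s := Iff.rfl

@[simp] theorem wp_set_iff {r : ℕ} {e : AExp} : wp M (set r e) Q s ↔ Q (s.setReg r (e.eval s)) :=
  Iff.rfl

@[simp] theorem wp_put_iff {a : ℕ} {i e : AExp} :
    wp M (put a i e) Q s ↔ Q (s.setArr a (i.eval s) (e.eval s)) := Iff.rfl

@[simp] theorem wp_seq_iff {c d : Stmt} : wp M (c ;; d) Q s ↔ wp M c (wp M d Q) s := Iff.rfl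

@[simp] theorem wp_cond_iff {e : AExp} {c d : Stmt} : wp M (cond e c d) Q s ↔
    (e.eval s ≠ 0 → wp M c Q s) ∧ (e.eval s = 0 → wp M d Q s) := Iff.rfl

end Stmt

open AExp Stmt

/-! ### Reading the input -/

/-- The state of the automaton that reads the input. -/
@[ext] structure Scan where
  mode : ℕ
  q : ℕ
  sq : ℕ
  rest : ℕ
  cnt : ℕ
  bad : ℕ
  l : ℕ
  m : ℕ
  has : ℕ → ℕ
  val : ℕ → ℕ

namespace Scan

/-- The initial state. -/
def init : Scan := ⟨0, 0, 0, 0, 0, 0, 0, 0, fun _ => 0, fun _ => 0⟩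

/-- Enter a constraint of order `q` and count `c` into the tables. -/
def enter (σ : Scan) (q c : ℕ) : Scan :=
  { σ with
    bad := if σ.has q ≠ 0 ∧ σ.val q ≠ c then 1 else σ.bad
    l := max σ.l q
    m := max σ.m c
    has := Function.update σ.has q 1
    val := Function.update σ.val q c }

/-- Read one bit. -/
def step (σ : Scan) (b : Bool) : Scan :=
  if σ.mode = 0 then
    if b then { σ with sq := σ.sq + σ.q + σ.q + 1, q := σ.q + 1 }
    else { σ with mode := 1, rest := σ.sq }
  else if σ.mode = 1 then
    if σ.rest - 1 = 0 then { σ with rest := σ.rest - 1, mode := 2, cnt := 0 }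
    else { σ with rest := σ.rest - 1 }
  else if b then { σ with cnt := σ.cnt + 1 }
  else { σ.enter σ.q σ.cnt with mode := 0, q := 0, sq := 0 }

/-- The field `sq` follows the square of `q` by (q+1)² = q² + 2q + 1, so the length of the matrix is
known without a multiplication. -/
theorem foldl_order (n : ℕ) : ∀ σ : Scan, σ.mode = 0 →
    (List.replicate n true).foldl step σ =
      { σ with q := σ.q + n, sq := σ.sq + (2 * σ.q * n + n ^ 2) } := by
  induction n with
  | zero => intro σ _; simp
  | succ n ih =>
    intro σ h
    rw [List.replicate_succ, List.foldl_cons, ih _ (by simp [step, h])]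
    simp only [step, h, if_true]
    ext <;> simp <;> ring

/-- The matrix is only skipped, since the order determines a star. The automaton tests `rest` after
it has consumed a bit, so the word must be nonempty. -/
theorem foldl_matrix : ∀ (w : List Bool) (σ : Scan), σ.mode = 1 → w.length = σ.rest → w ≠ [] →
    w.foldl step σ = { σ with mode := 2, rest := 0, cnt := 0 }
  | [], _, _, _, h => absurd rfl h
  | [b], σ, h, hl, _ => by
    have : σ.rest = 1 := hl.symm
    simp [step, h, this]
  | b :: b' :: w, σ, h, hl, _ => by
    have hl' : σ.rest = w.length + 2 := hl.symm
    have hs : step σ b = { σ with rest := σ.rest - 1 } := by simp [step, h, hl']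
    rw [List.foldl_cons, hs, foldl_matrix (b' :: w) { σ with rest := σ.rest - 1 } h (by simp [hl']) (by simp)]

theorem foldl_count (n : ℕ) : ∀ σ : Scan, σ.mode = 2 →
    (List.replicate n true).foldl step σ = { σ with cnt := σ.cnt + n } := by
  induction n with
  | zero => intro σ _; simp
  | succ n ih =>
    intro σ h
    rw [List.replicate_succ, List.foldl_cons, ih _ (by simp [step, h])]
    simp only [step, h]
    ext <;> simp
    ring

/-- The automaton is ready for the next constraint. -/
def Ready (σ : Scan) : Prop := σ.mode = 0 ∧ σ.q = 0 ∧ σ.sq = 0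

/-- The two states have the same tables. -/
def Same (σ τ : Scan) : Prop :=
  σ.bad = τ.bad ∧ σ.l = τ.l ∧ σ.m = τ.m ∧ σ.has = τ.has ∧ σ.val = τ.val

theorem length_encodeGraph {n : ℕ} (F : SimpleGraph (Fin n)) :
    (encodeGraph F).length = n ^ 2 := by
  simp [encodeGraph, List.length_flatMap, _root_.sq]

theorem foldl_encode (c : Constraint) (hc : 0 < c.order) (σ : Scan) (h : σ.Ready) :
    (c.encode.foldl step σ).Ready ∧ Same (c.encode.foldl step σ) (σ.enter c.order c.count) := by
  obtain ⟨h1, h2, h3⟩ := h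
  have hlen := length_encodeGraph c.graph
  have hne : encodeGraph c.graph ≠ [] := by
    intro h
    rw [h] at hlen
    have := pow_pos hc 2
    rw [← hlen, List.length_nil] at this
    omega
  rw [Constraint.encode, encodeUnary, encodeUnary, List.foldl_append, List.foldl_append,
    List.foldl_append, List.foldl_append, foldl_order _ _ h1]
  rw [show List.foldl step { σ with
      q := σ.q + c.order, sq := σ.sq + (2 * σ.q * c.order + c.order ^ 2) } [false] =
      { σ with mode := 1, q := c.order, sq := c.order ^ 2, rest := c.order ^ 2 } by
    simp [step, h1, h2, h3]]
  rw [foldl_matrix _ _ rfl hlen hne, foldl_count _ _ rfl]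
  simp [step, Ready, Same, enter]

/-- The tables describe the list `J` of constraints. -/
structure Describes (σ : Scan) (J : List Constraint) : Prop where
  l_eq : σ.l = maxOrder J
  m_eq : σ.m = maxCount J
  has_ne : ∀ c ∈ J, σ.has c.order ≠ 0
  exists_of_has : ∀ q, σ.has q ≠ 0 → ∃ c ∈ J, c.order = q ∧ c.count = σ.val q
  val_eq : σ.bad = 0 → ∀ c ∈ J, σ.val c.order = c.count
  conflict : σ.bad ≠ 0 → ∃ c ∈ J, ∃ d ∈ J, c.order = d.order ∧ c.count ≠ d.count

theorem foldr_max_eq (l : List ℕ) (x : ℕ) : l.foldr max x = max (l.foldr max 0) x := by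
  induction l with
  | nil => simp
  | cons y l ih => rw [List.foldr_cons, List.foldr_cons, ih, max_assoc]

/-- The table keeps the last count entered for an order, so `exists_of_has` survives a conflict,
while `val_eq` can be claimed only as long as no two counts for one order have clashed. -/
theorem Describes.enter {σ τ : Scan} {J : List Constraint} (h : Describes σ J) (c : Constraint)
    (hτ : Same τ (σ.enter c.order c.count)) : Describes τ (J ++ [c]) := by
  obtain ⟨h1, h2, h3, h4, h5⟩ := hτ
  simp only [Scan.enter] at h1 h2 h3 h4 h5
  constructor
  · rw [h2, h.l_eq]; simp [maxOrder, foldr_max_eq _ c.order]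
  · rw [h3, h.m_eq]; simp [maxCount, foldr_max_eq _ c.count]
  · intro d hd
    rw [h4]
    by_cases hdc : d.order = c.order
    · simp [hdc]
    · rw [Function.update_of_ne hdc]
      rcases List.mem_append.1 hd with hd | hd
      · exact h.has_ne d hd
      · simp at hd; exact absurd (by rw [hd]) hdc
  · intro q hq
    rw [h4] at hq
    rw [h5]
    by_cases hqc : q = c.order
    · exact ⟨c, by simp, hqc.symm, by simp [hqc]⟩
    · rw [Function.update_of_ne hqc] at hq ⊢
      obtain ⟨d, hd, hd'⟩ := h.exists_of_has q hq
      exact ⟨d, by simp [hd], hd'⟩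
  · intro hb d hd
    rw [h1] at hb
    split_ifs at hb with hcon
    rw [h5]
    by_cases hdc : d.order = c.order
    · rw [hdc, Function.update_self]
      rcases List.mem_append.1 hd with hd | hd
      · have h6 := h.val_eq hb d hd
        have h7 := h.has_ne d hd
        rw [hdc] at h6 h7
        rw [← h6]
        by_contra hne
        exact hcon ⟨h7, fun h => hne h.symm⟩
      · simp at hd; rw [hd]
    · rw [Function.update_of_ne hdc]
      rcases List.mem_append.1 hd with hd | hd
      · exact h.val_eq hb d hd
      · simp at hd; exact absurd (by rw [hd]) hdc
  · intro hb
    rw [h1] at hb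
    split_ifs at hb with hcon
    · obtain ⟨d, hd, hd1, hd2⟩ := h.exists_of_has _ hcon.1
      exact ⟨d, by simp [hd], c, by simp, hd1, by rw [hd2]; exact hcon.2⟩
    · obtain ⟨d, hd, e, he, h'⟩ := h.conflict hb
      exact ⟨d, by simp [hd], e, by simp [he], h'⟩

theorem describes_foldl (I : List Constraint) (hI : ∀ c ∈ I, 0 < c.order) :
    Ready ((encode I).foldl step init) ∧ Describes ((encode I).foldl step init) I := by
  induction I using List.reverseRecOn with
  | nil => exact ⟨⟨rfl, rfl, rfl⟩, by
      constructor <;> simp [encode, init, maxOrder, maxCount]⟩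
  | append_singleton J c ih =>
    obtain ⟨h1, h2⟩ := ih fun c hc => hI c (by simp [hc])
    have h3 : encode (J ++ [c]) = encode J ++ c.encode := by simp [encode]
    rw [h3, List.foldl_append]
    obtain ⟨h4, h5⟩ := foldl_encode c (hI c (by simp)) _ h1
    exact ⟨h4, h2.enter c h5⟩

/-- The machine state holds the state of the automaton. -/
structure Rep (σ : Scan) (s : State) : Prop where
  mode : s.reg 2 = σ.mode
  q : s.reg 3 = σ.q
  sq : s.reg 4 = σ.sq
  rest : s.reg 5 = σ.rest
  cnt : s.reg 6 = σ.cnt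
  bad : s.reg 7 = σ.bad
  l : s.reg 8 = σ.l
  m : s.reg 9 = σ.m
  has : s.arr 2 = σ.has
  val : s.arr 3 = σ.val

/-- Read the bit in register `11`. -/
def stepStmt : Stmt :=
  cond (eq (var 2) (lit 0))
    (cond (var 11)
      (set 4 (add (add (add (var 4) (var 3)) (var 3)) (lit 1)) ;; set 3 (add (var 3) (lit 1)))
      (set 2 (lit 1) ;; set 5 (var 4)))
    (cond (eq (var 2) (lit 1))
      (set 5 (sub (var 5) (lit 1)) ;;
        cond (var 5) skip (set 2 (lit 2) ;; set 6 (lit 0)))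
      (cond (var 11)
        (set 6 (add (var 6) (lit 1)))
        (cond (and (load 2 (var 3)) (sub (lit 1) (eq (load 3 (var 3)) (var 6))))
            (set 7 (lit 1)) skip ;;
          put 2 (var 3) (lit 1) ;;
          put 3 (var 3) (var 6) ;;
          set 8 (add (var 8) (sub (var 3) (var 8))) ;;
          set 9 (add (var 9) (sub (var 6) (var 9))) ;;
          set 2 (lit 0) ;; set 3 (lit 0) ;; set 4 (lit 0))))

theorem wp_stepStmt {M : ℕ} {σ : Scan} {s : State} (h : Rep σ s) (b : Bool)
    (hb : s.reg 11 = b.toNat) : wp M stepStmt (Rep (σ.step b)) s := by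
  obtain ⟨h1, h2, h3, h4, h5, h6, h7, h8, h9, h10⟩ := h
  have hsub : ∀ x : ℕ, 1 - x = 0 ↔ x ≠ 0 := by omega
  have e1 := State.arr_setArr_eq
  simp only [stepStmt, wp_cond_iff, wp_seq_iff, wp_set_iff, wp_put_iff, wp_skip_iff, ne_eq,
    eval_eq, eval_var, eval_lit, eval_and, eval_load, eval_sub, eval_add, hsub,
    State.reg_setReg, State.reg_setArr, h1, h2, h3, h4, h5, h7, h8, hb,
    Bool.toNat_eq_zero, step]
  refine ⟨fun hm => ⟨fun hb => ?_, fun hb => ?_⟩, fun hm => ⟨fun hm1 => ⟨fun hr => ?_, fun hr => ?_⟩,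
    fun hm1 => ⟨fun hb => ?_, fun hb => ?_⟩⟩⟩
  · constructor <;> simp_all
  · constructor <;> simp_all
  · constructor <;> simp_all
  · constructor <;> simp_all
  · constructor <;> simp_all
  · have hmax : ∀ x y : ℕ, x + (y - x) = max x y := by omega
    rw [if_neg hm, if_neg hm1, hb, if_neg (by decide)]
    refine ⟨fun hc => ?_, fun hc => ?_⟩
    · constructor <;> simp_all [enter]
    · constructor
      case bad => simp_all [enter]
      all_goals simp_all [enter]

/-- Read the whole input. -/
def readStmt : Stmt := loop 10 (var 0) (set 11 (load 0 (var 10)) ;; stepStmt)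

theorem wp_readStmt (I : List Constraint) :
    wp (encode I).length readStmt (Rep ((encode I).foldl step init)) (initState (encode I)) := by
  set w := encode I
  have hlen : (var 0).eval (initState w) = w.length := by simp [initState]
  refine wp_loop (fun k s => Rep ((w.take k).foldl step init) s) hlen.le ?_ ?_ ?_
  · constructor <;> simp [init, initState]
  · intro k s hk hf hs
    rw [hlen] at hk
    have ha : s.arr 0 = (initState w).arr 0 := hf.arr 0 rfl
    rw [List.take_add_one, List.foldl_append]
    have : w[k]?.toList = [w[k]] := by simp [hk]
    rw [this]
    simp only [wp_seq_iff, wp_set_iff]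
    refine wp_stepStmt ?_ _ ?_
    · obtain ⟨h1, h2, h3, h4, h5, h6, h7, h8, h9, h10⟩ := hs
      constructor <;> simp_all
    · simp [ha, initState, hk]
  · intro s _ hs
    rw [hlen, List.take_length] at hs
    exact hs

/-- Reading the input takes linear time. -/
theorem readStmt_bound : ∃ C, ∀ M, readStmt.bound M ≤ C * (M + 1) := by
  refine ⟨stepStmt.bound 0 + 20, fun M => ?_⟩
  have : stepStmt.bound M = stepStmt.bound 0 := rfl
  simp only [readStmt, bound, this, AExp.time]
  nlinarith

end Scan

/-! ### Arithmetic -/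

/-- `reg r := reg x * reg y`. -/
def mulStmt (r x y : ℕ) : Stmt := set r (lit 0) ;; loop 90 (var y) (set r (add (var r) (var x)))

/-- Repeated addition: the second factor is the number of rounds, so it has to be at most `M`, while
the product may be larger. -/
theorem wp_mulStmt {M r x y : ℕ} {Q : State → Prop} {s : State} (hxr : x ≠ r) (hyr : y ≠ r)
    (hx : x ≠ 90) (hr : r ≠ 90) (hM : s.reg y ≤ M)
    (h : ∀ s', (∀ z, z ≠ r → z ≠ 90 → s'.reg z = s.reg z) → s'.arr = s.arr →
      s'.reg r = s.reg x * s.reg y → Q s') :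
    wp M (mulStmt r x y) Q s := by
  simp only [mulStmt, wp_seq_iff, wp_set_iff, eval_lit]
  have he : (var y).eval (s.setReg r 0) = s.reg y := by simp [hyr]
  refine wp_loop (fun k s' => s'.reg r = s.reg x * k) (by rwa [he]) (by simp) ?_ ?_
  · intro k s' _ hf hk
    have h1 := hf.reg x (by simp [regs, hxr, hx])
    simp only [State.reg_setReg, if_neg hxr] at h1
    simp [hr, hx, hk, h1]
    ring
  · intro s' hf hk
    rw [he] at hk
    refine h s' (fun z hz hz' => ?_) ?_ hk
    · have h1 := hf.reg z (by simp [regs, hz, hz'])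
      simpa [hz] using h1
    · funext a
      exact hf.arr a rfl

/-- Compute `m + 2` and the base. -/
def baseStmt : Stmt :=
  set 20 (add (var 9) (lit 2)) ;; set 21 (lit 1) ;;
    loop 91 (add (var 8) (lit 1)) (mulStmt 22 21 20 ;; set 21 (var 22))

theorem wp_baseStmt {M : ℕ} {s : State} (h1 : s.reg 8 + 1 ≤ M) (h2 : s.reg 9 + 2 ≤ M) :
    wp M baseStmt (fun s' => s'.reg 20 = s.reg 9 + 2 ∧
      s'.reg 21 = (s.reg 9 + 2) ^ (s.reg 8 + 1)) s := by
  simp only [baseStmt, wp_seq_iff, wp_set_iff, eval_lit, eval_add, eval_var]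
  refine wp_loop (fun k s' => s'.reg 21 = (s.reg 9 + 2) ^ k) (by simpa using h1) (by simp) ?_ ?_
  · intro k s' _ hf hk
    have h20 : s'.reg 20 = s.reg 9 + 2 := by simpa using hf.reg 20 rfl
    refine wp_mulStmt (by decide) (by decide) (by decide) (by decide) (by simpa [h20]) ?_
    intro t ht _ hv
    simp [hv, h20, hk, pow_succ]
  · intro s' hf hk
    exact ⟨by simpa using hf.reg 20 rfl, by simpa using hk⟩

/-- Compute the weights of all degrees. -/
def weightStmt : Stmt :=
  loop 23 (add (var 9) (lit 1)) (mulStmt 24 23 21 ;; set 25 (lit 0) ;; set 26 (lit 1) ;;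
    loop 27 (var 8) (cond (load 2 (add (var 27) (lit 1))) (set 25 (add (var 25) (var 26))) skip ;;
      mulStmt 28 26 24 ;; set 26 (var 28)) ;;
    put 4 (var 23) (var 25))

theorem wp_weightStmt {M : ℕ} {s : State} (h1 : s.reg 8 ≤ M) (h2 : s.reg 9 + 1 ≤ M)
    (h3 : s.reg 21 ≤ M) (h4 : s.reg 9 * s.reg 21 ≤ M) :
    wp M weightStmt (fun s' => ∀ a ≤ s.reg 9,
      s'.arr 4 a = weight (s.arr 2) (s.reg 21) (s.reg 8) a) s := by
  refine wp_loop (fun k s' => ∀ a < k, s'.arr 4 a = weight (s.arr 2) (s.reg 21) (s.reg 8) a)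
    h2 (by simp) ?_ ?_
  · intro a s' ha hf hk
    simp only [eval_add, eval_var, eval_lit] at ha
    have r21 := hf.reg 21 rfl
    have r8 := hf.reg 8 rfl
    have a2 := hf.arr 2 rfl
    refine wp_mulStmt (by decide) (by decide) (by decide) (by decide) (by simpa [r21]) ?_
    intro t ht hta hv
    simp only [wp_seq_iff, wp_set_iff]
    have r24 : t.reg 24 = a * s.reg 21 := by simpa [r21] using hv
    have t8 : t.reg 8 = s.reg 8 := by simpa [r8] using ht 8
    have t23 : t.reg 23 = a := by simpa using ht 23
    have haM : a * s.reg 21 ≤ M := (Nat.mul_le_mul_right _ (by omega)).trans h4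
    refine wp_loop (fun j u => u.reg 25 = weight (s.arr 2) (s.reg 21) j a ∧
      u.reg 26 = (a * s.reg 21) ^ j) (by simpa [t8]) (by simp [weight]) ?_ ?_
    · rintro j u hj hfu ⟨h5, h6⟩
      have u24 : u.reg 24 = a * s.reg 21 := by simpa [r24] using hfu.reg 24 rfl
      have u2 : u.arr 2 = s.arr 2 := by simpa [hta, a2] using hfu.arr 2 rfl
      have key : ∀ u' : State, u'.reg 24 = a * s.reg 21 → u'.reg 26 = (a * s.reg 21) ^ j →
          u'.reg 25 = weight (s.arr 2) (s.reg 21) (j + 1) a →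
          wp M (mulStmt 28 26 24 ;; set 26 (var 28)) (fun u =>
            u.reg 25 = weight (s.arr 2) (s.reg 21) (j + 1) a ∧
            u.reg 26 = (a * s.reg 21) ^ (j + 1)) u' := by
        intro u' h7 h8 h9
        refine wp_mulStmt (by decide) (by decide) (by decide) (by decide) (by rwa [h7]) ?_
        intro v hv _ hv'
        simp [hv', hv, h7, h8, h9, pow_succ]
      simp only [wp_seq_iff, wp_cond_iff, wp_set_iff, wp_skip_iff]
      refine ⟨fun hc => key _ ?_ ?_ ?_, fun hc => key _ ?_ ?_ ?_⟩
      all_goals simp_all [weight, Finset.sum_range_succ]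
    · rintro u hfu ⟨h5, h6⟩
      have u23 : u.reg 23 = a := by simpa [t23] using hfu.reg 23 rfl
      have u4 : u.arr 4 = s'.arr 4 := by simpa [hta] using hfu.arr 4 rfl
      simp only [eval_var, State.reg_setReg] at h5
      simp [t8] at h5
      simp only [wp_put_iff, eval_var, u23, State.arr_setArr, true_and, h5, u4]
      intro b hb
      split_ifs with hab
      · rw [hab]
      · exact hk b (by omega)
  · intro s' _ hk a ha
    exact hk a (by simpa using Nat.lt_succ_of_le ha)

/-- Compute the target. -/
def targetStmt : Stmt :=
  set 29 (lit 0) ;; set 26 (lit 1) ;;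
    loop 27 (var 8) (cond (load 2 (add (var 27) (lit 1)))
      (set 30 (load 3 (add (var 27) (lit 1))) ;; mulStmt 28 26 30 ;; set 29 (add (var 29) (var 28)))
      skip ;; mulStmt 28 26 21 ;; set 26 (var 28))

theorem wp_targetStmt {M : ℕ} {s : State} (h1 : s.reg 8 ≤ M) (h3 : s.reg 21 ≤ M)
    (h4 : ∀ q, s.arr 2 q ≠ 0 → s.arr 3 q ≤ M) :
    wp M targetStmt (fun s' => s'.reg 29 = target (s.arr 2) (s.arr 3) (s.reg 21) (s.reg 8)) s := by
  simp only [targetStmt, wp_seq_iff, wp_set_iff]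
  refine wp_loop (fun j u => u.reg 29 = target (s.arr 2) (s.arr 3) (s.reg 21) j ∧
      u.reg 26 = s.reg 21 ^ j) (by simpa) (by simp [target]) ?_ ?_
  · rintro j u hj hfu ⟨h5, h6⟩
    have u21 : u.reg 21 = s.reg 21 := by simpa using hfu.reg 21 rfl
    have u2 : u.arr 2 = s.arr 2 := by simpa using hfu.arr 2 rfl
    have u3 : u.arr 3 = s.arr 3 := by simpa using hfu.arr 3 rfl
    have key : ∀ u' : State, u'.reg 21 = s.reg 21 → u'.reg 26 = s.reg 21 ^ j →
        u'.reg 29 = target (s.arr 2) (s.arr 3) (s.reg 21) (j + 1) →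
        wp M (mulStmt 28 26 21 ;; set 26 (var 28)) (fun u =>
          u.reg 29 = target (s.arr 2) (s.arr 3) (s.reg 21) (j + 1) ∧
          u.reg 26 = s.reg 21 ^ (j + 1)) u' := by
      intro u' h7 h8 h9
      refine wp_mulStmt (by decide) (by decide) (by decide) (by decide) (by rwa [h7]) ?_
      intro v hv _ hv'
      simp [hv', hv, h7, h8, h9, pow_succ]
    simp only [wp_seq_iff, wp_cond_iff, wp_set_iff, wp_skip_iff]
    refine ⟨fun hc => ?_, fun hc => key _ ?_ ?_ ?_⟩
    · have hc' : s.arr 2 (j + 1) ≠ 0 := by simpa [u2] using hc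
      have hM := h4 _ hc'
      refine wp_mulStmt (by decide) (by decide) (by decide) (by decide) (by simpa [u3]) ?_
      intro v hv _ hv'
      refine key _ ?_ ?_ ?_
      · simp [hv, u21]
      · simp [hv, h6]
      · simp [hv, hv', h5, h6, u3, target, Finset.sum_range_succ, hc', mul_comm]
    all_goals simp_all [target, Finset.sum_range_succ]
  · rintro u _ ⟨h5, _⟩
    simpa using h5

/-- Compute a bound for the number of configurations. -/
def cfgBoundStmt : Stmt :=
  set 31 (add (var 29) (lit 1)) ;; loop 27 (lit 8) (mulStmt 28 31 20 ;; set 31 (var 28))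

theorem wp_cfgBoundStmt {M : ℕ} {s : State} (h1 : s.reg 20 ≤ M) (h2 : 8 ≤ M) :
    wp M cfgBoundStmt (fun s' => s'.reg 31 = (s.reg 29 + 1) * s.reg 20 ^ 8) s := by
  simp only [cfgBoundStmt, wp_seq_iff, wp_set_iff]
  refine wp_loop (fun j u => u.reg 31 = (s.reg 29 + 1) * s.reg 20 ^ j) h2 (by simp) ?_ ?_
  · intro j u _ hfu hj
    have u20 : u.reg 20 = s.reg 20 := by simpa using hfu.reg 20 rfl
    refine wp_mulStmt (by decide) (by decide) (by decide) (by decide) (by simpa [u20]) ?_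
    intro v hv _ hv'
    simp [hv', u20, hj]
    ring
  · intro u _ h
    exact h

/-- Prepare the search. -/
def setupStmt : Stmt := baseStmt ;; weightStmt ;; targetStmt ;; cfgBoundStmt

theorem wp_setupStmt {M : ℕ} {s : State} {I : List Constraint} (hl : s.reg 8 = maxOrder I)
    (hm : s.reg 9 = maxCount I) (hT : Table I (s.arr 2) (s.arr 3))
    (h1 : maxOrder I + 8 ≤ M) (h2 : maxCount I + 2 ≤ M) (h3 : (maxCount I + 1) * base I ≤ M) :
    wp M setupStmt (fun s' =>
      (∀ a ≤ maxCount I, s'.arr 4 a = weight (s.arr 2) (base I) (maxOrder I) a) ∧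
      s'.reg 29 = target (s.arr 2) (s.arr 3) (base I) (maxOrder I) ∧
      s'.reg 31 = (target (s.arr 2) (s.arr 3) (base I) (maxOrder I) + 1) * (maxCount I + 2) ^ 8) s := by
  rw [Nat.add_mul] at h3
  refine wp_seq _ (wp_baseStmt (by omega) (by omega)) ?_
  rintro s₁ f₁ ⟨r20, r21⟩
  have hb : s₁.reg 21 = base I := by rw [r21, hl, hm, base]
  have l₁ : s₁.reg 8 = maxOrder I := by rw [f₁.reg 8 rfl, hl]
  have m₁ : s₁.reg 9 = maxCount I := by rw [f₁.reg 9 rfl, hm]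
  refine wp_seq _ (wp_weightStmt (by omega) (by omega) (by omega) ?_) ?_
  · rw [hb, m₁]; omega
  intro s₂ f₂ hw
  refine wp_seq _ (wp_targetStmt ?_ ?_ ?_) ?_
  · rw [f₂.reg 8 rfl]; omega
  · rw [f₂.reg 21 rfl]; omega
  · intro q hq
    rw [f₂.arr 2 rfl, f₁.arr 2 rfl] at hq
    rw [f₂.arr 3 rfl, f₁.arr 3 rfl]
    obtain ⟨c, hc, rfl⟩ := hT.exists_of_has q hq
    rw [hT.val_eq c hc]
    have := count_le_maxCount hc
    omega
  intro s₃ f₃ ht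
  have ht' : s₃.reg 29 = target (s.arr 2) (s.arr 3) (base I) (maxOrder I) := by
    rw [ht, f₂.arr 2 rfl, f₁.arr 2 rfl, f₂.arr 3 rfl, f₁.arr 3 rfl, f₂.reg 21 rfl, f₂.reg 8 rfl,
      hb, l₁]
  have r20' : s₃.reg 20 = maxCount I + 2 := by rw [f₃.reg 20 rfl, f₂.reg 20 rfl, r20, hm]
  refine wp_mono (wp_frame (wp_cfgBoundStmt (by omega) (by omega))) ?_
  rintro s₄ ⟨hk, f₄⟩
  refine ⟨fun a ha => ?_, ?_, ?_⟩
  · rw [f₄.arr 4 rfl, f₃.arr 4 rfl, hw a (by omega), hb, l₁, f₁.arr 2 rfl]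
  · rw [f₄.reg 29 rfl, ht']
  · rw [hk, ht', r20']

/-! ### The search -/

/-- The configuration in entry `i` of the list. -/
def cfgAt (s : State) (i : ℕ) : Cfg :=
  ⟨s.arr 5 i, s.arr 6 i, s.arr 7 i, s.arr 8 i, s.arr 9 i, s.arr 10 i, s.arr 11 i⟩

theorem cfgAt_congr {s s' : State} (h : ∀ a, 5 ≤ a → a ≤ 11 → s'.arr a = s.arr a) (i : ℕ) :
    cfgAt s' i = cfgAt s i := by
  simp [cfgAt, h]

/-- The configuration in the registers `51` to `57`. -/
def newCfg (s : State) : Cfg :=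
  ⟨s.reg 51, s.reg 52, s.reg 53, s.reg 54, s.reg 55, s.reg 56, s.reg 57⟩

/-- The list of the first `reg 40` configurations consists of distinct reachable configurations,
and array `12` points to the parents. -/
structure Search (w : ℕ → ℕ) (T m : ℕ) (s : State) : Prop where
  lt : m < s.reg 40
  roots : ∀ n ≤ m, cfgAt s n = Cfg.root n
  parent : ∀ i < s.reg 40, (i ≤ m ∧ s.arr 12 i = i) ∨
    (m < i ∧ s.arr 12 i < i ∧ Cfg.Step w T (cfgAt s (s.arr 12 i)) (cfgAt s i))
  inj : ∀ i j, i < s.reg 40 → j < s.reg 40 → cfgAt s i = cfgAt s j → i = j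

/-- The configuration is in the list. -/
def Present (s : State) (c : Cfg) : Prop := ∃ j < s.reg 40, cfgAt s j = c

/-- The list of `s'` extends the list of `s`. -/
def Extends (s s' : State) : Prop :=
  s.reg 40 ≤ s'.reg 40 ∧ ∀ i < s.reg 40, cfgAt s' i = cfgAt s i

theorem Extends.refl (s : State) : Extends s s := ⟨le_rfl, fun _ _ => rfl⟩

theorem Extends.trans {s t u : State} (h : Extends s t) (h' : Extends t u) : Extends s u :=
  ⟨h.1.trans h'.1, fun i hi => (h'.2 i (hi.trans_le h.1)).trans (h.2 i hi)⟩

theorem Present.extends {s s' : State} {c : Cfg} (h : Present s c) (he : Extends s s') :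
    Present s' c := by
  obtain ⟨j, hj, rfl⟩ := h
  exact ⟨j, hj.trans_le he.1, he.2 j hj⟩

theorem Search.congr {w : ℕ → ℕ} {T m : ℕ} {s s' : State} (h : Search w T m s)
    (hr : s'.reg 40 = s.reg 40) (ha : ∀ a, 5 ≤ a → a ≤ 12 → s'.arr a = s.arr a) :
    Search w T m s' := by
  have hc := cfgAt_congr (s := s) (s' := s') fun a h5 h11 => ha a h5 (by omega)
  have h12 := ha 12 (by omega) le_rfl
  constructor
  · rw [hr]; exact h.lt
  · simpa only [hc] using h.roots
  · simpa only [hc, hr, h12] using h.parent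
  · simpa only [hc, hr] using h.inj

theorem Extends.of_eq {s s' : State} (hr : s'.reg 40 = s.reg 40)
    (ha : ∀ a, 5 ≤ a → a ≤ 11 → s'.arr a = s.arr a) : Extends s s' :=
  ⟨hr.ge, fun i _ => cfgAt_congr ha i⟩

/-- The configurations lie in a box. -/
theorem Search.box {w : ℕ → ℕ} {T m : ℕ} {s : State} (h : Search w T m s) : ∀ i < s.reg 40,
    (cfgAt s i).x ≤ (cfgAt s i).y ∧ (cfgAt s i).y ≤ m ∧ (cfgAt s i).lo ≤ m ∧ (cfgAt s i).hi ≤ m ∧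
    (cfgAt s i).p ≤ (cfgAt s i).x * m ∧ (cfgAt s i).q ≤ (m - (cfgAt s i).y) * m ∧
    (cfgAt s i).s ≤ T := by
  intro i
  induction i using Nat.strong_induction_on with
  | _ i ih =>
    intro hi
    rcases h.parent i hi with ⟨him, _⟩ | ⟨_, hp, a, hfit, hstep⟩
    · rw [h.roots i him]
      simp [Cfg.root, him]
    · obtain ⟨h1, h2, h3, h4, h5, h6, h7⟩ := ih _ hp (hp.trans hi)
      obtain ⟨g1, g2, g3, g4⟩ := hfit
      generalize cfgAt s (s.arr 12 i) = c at *
      rcases hstep with ⟨hc, hs⟩ | ⟨hc, hs⟩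
      · rw [hs]
        simp only [Cfg.top]
        have e1 : (c.x + 1) * m = c.x * m + m := by ring
        refine ⟨by omega, h2, h3, by omega, by omega, h6, g4⟩
      · rw [hs]
        simp only [Cfg.bot]
        have e1 : (m - (c.y - 1)) * m = (m - c.y) * m + m := by
          rw [show m - (c.y - 1) = m - c.y + 1 by omega]; ring
        refine ⟨by omega, by omega, by omega, h4, h5, by omega, g4⟩

/-- The length of the list is bounded. -/
theorem Search.length_le {w : ℕ → ℕ} {T m : ℕ} {s : State} (h : Search w T m s) :
    s.reg 40 ≤ (T + 1) * (m + 2) ^ 8 := by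
  let R := Finset.range (m + 2)
  let P := Finset.range ((m + 2) ^ 2)
  -- Four coordinates are at most m, surplus and deficit are at most m², and the weight is at most
  -- `T`.
  let box := Finset.range (T + 1) ×ˢ (R ×ˢ R ×ˢ R ×ˢ R ×ˢ P ×ˢ P)
  have hbox : box.card = (T + 1) * (m + 2) ^ 8 := by
    simp only [box, R, P, Finset.card_product, Finset.card_range]
    ring
  rw [← hbox, ← Finset.card_range (s.reg 40)]
  refine Finset.card_le_card_of_injOn (fun i => ((cfgAt s i).s, (cfgAt s i).x, (cfgAt s i).y,
    (cfgAt s i).lo, (cfgAt s i).hi, (cfgAt s i).p, (cfgAt s i).q)) ?_ ?_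
  · intro i hi
    obtain ⟨h1, h2, h3, h4, h5, h6, h7⟩ := h.box i (by simpa using hi)
    have e1 : (cfgAt s i).x * m ≤ m * m := Nat.mul_le_mul_right _ (by omega)
    have e2 : (m - (cfgAt s i).y) * m ≤ m * m := Nat.mul_le_mul_right _ (by omega)
    have e3 : m * m < (m + 2) ^ 2 := by nlinarith
    simp only [box, R, P, Finset.coe_product, Set.mem_prod, Finset.coe_range, Set.mem_Iio]
    refine ⟨?_, ?_, ?_, ?_, ?_, ?_, ?_⟩ <;> omega
  · intro i hi j hj hij
    simp only [Prod.mk.injEq] at hij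
    refine h.inj i j (by simpa using hi) (by simpa using hj) ?_
    obtain ⟨h1, h2, h3, h4, h5, h6, h7⟩ := hij
    cases hci : cfgAt s i
    cases hcj : cfgAt s j
    simp_all

/-- Look for the configuration in the registers `51` to `57` and append it if it is new. -/
def pushStmt : Stmt :=
  set 58 (lit 0) ;;
  loop 59 (var 40)
    (cond (and (eq (load 5 (var 59)) (var 51)) (and (eq (load 6 (var 59)) (var 52))
      (and (eq (load 7 (var 59)) (var 53)) (and (eq (load 8 (var 59)) (var 54))
      (and (eq (load 9 (var 59)) (var 55)) (and (eq (load 10 (var 59)) (var 56))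
        (eq (load 11 (var 59)) (var 57))))))))
      (set 58 (lit 1)) skip) ;;
  cond (var 58) skip
    (put 5 (var 40) (var 51) ;; put 6 (var 40) (var 52) ;; put 7 (var 40) (var 53) ;;
      put 8 (var 40) (var 54) ;; put 9 (var 40) (var 55) ;; put 10 (var 40) (var 56) ;;
      put 11 (var 40) (var 57) ;; put 12 (var 40) (var 42) ;; set 40 (add (var 40) (lit 1)))

/-- Appending only what is absent keeps the entries distinct. Together with the box that contains
them this bounds the list, and hence the number of rounds of the scan. -/
theorem wp_pushStmt {M : ℕ} {w : ℕ → ℕ} {T m : ℕ} {s : State} (h : Search w T m s)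
    (hM : (T + 1) * (m + 2) ^ 8 ≤ M) (h42 : s.reg 42 < s.reg 40)
    (hstep : Cfg.Step w T (cfgAt s (s.reg 42)) (newCfg s)) :
    wp M pushStmt (fun s' => Search w T m s' ∧ Extends s s' ∧ Present s' (newCfg s)) s := by
  have hlen := h.length_le.trans hM
  simp only [pushStmt, wp_seq_iff, wp_set_iff]
  refine wp_loop (fun k s' => s'.reg 58 ≠ 0 ↔ ∃ j < k, cfgAt s j = newCfg s) (by simpa)
    (by simp) ?_ ?_
  · intro k s' _ hf hk
    have hr : ∀ z, z ≠ 58 → z ≠ 59 → s'.reg z = s.reg z := fun z hz hz' => by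
      simpa [hz] using hf.reg z (by simp [regs, hz, hz'])
    have ha : ∀ a, s'.arr a = s.arr a := fun a => hf.arr a rfl
    have hiff : (∃ j < k + 1, cfgAt s j = newCfg s) ↔
        (∃ j < k, cfgAt s j = newCfg s) ∨ cfgAt s k = newCfg s := by
      constructor
      · rintro ⟨j, hj, hjc⟩
        rcases Nat.eq_or_lt_of_le (Nat.le_of_lt_succ hj) with rfl | hj'
        · exact Or.inr hjc
        · exact Or.inl ⟨j, hj', hjc⟩
      · rintro (⟨j, hj, hjc⟩ | hk)
        · exact ⟨j, hj.trans (Nat.lt_succ_self k), hjc⟩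
        · exact ⟨k, Nat.lt_succ_self k, hk⟩
    have hcfg : cfgAt s k = newCfg s ↔ s.arr 5 k = s.reg 51 ∧ s.arr 6 k = s.reg 52 ∧
        s.arr 7 k = s.reg 53 ∧ s.arr 8 k = s.reg 54 ∧ s.arr 9 k = s.reg 55 ∧
        s.arr 10 k = s.reg 56 ∧ s.arr 11 k = s.reg 57 := by
      simp [cfgAt, newCfg]
    simp only [hiff, hcfg, ← hk]
    constructor
    · intro hc
      simp [hr, ha] at hc
      simp [hc]
    · intro hc
      simp [hr, ha] at hc
      simp only [wp_skip_iff, State.reg_setReg, if_neg (show 58 ≠ 59 by decide)]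
      tauto
  · intro s' hf hk
    have hr : ∀ z, z ≠ 58 → z ≠ 59 → s'.reg z = s.reg z := fun z hz hz' => by
      simpa [hz] using hf.reg z (by simp [regs, hz, hz'])
    have ha : ∀ a, s'.arr a = s.arr a := fun a => hf.arr a rfl
    simp only [eval_var, State.reg_setReg, if_neg (show 40 ≠ 58 by decide)] at hk
    constructor
    · intro hc
      have hp : Present s (newCfg s) := hk.1 hc
      have he : Extends s s' := .of_eq (hr 40 (by decide) (by decide)) fun a _ _ => ha a
      exact ⟨h.congr (hr 40 (by decide) (by decide)) fun a _ _ => ha a, he, hp.extends he⟩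
    · intro hc
      have hnew : ¬ Present s (newCfg s) := fun hp => hk.2 hp hc
      simp only [wp_seq_iff, wp_put_iff, wp_set_iff]
      generalize hu : State.setReg _ 40 _ = u
      have u40 : u.reg 40 = s.reg 40 + 1 := by rw [← hu]; simp [hr]
      have uold : ∀ i < s.reg 40, cfgAt u i = cfgAt s i := by
        intro i hi
        rw [← hu]
        simp [cfgAt, hr, ha, hi.ne]
      have u12 : ∀ i < s.reg 40, u.arr 12 i = s.arr 12 i := by
        intro i hi
        rw [← hu]
        simp [hr, ha, hi.ne]
      have unew : cfgAt u (s.reg 40) = newCfg s := by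
        rw [← hu]; simp [cfgAt, newCfg, hr]
      have u12' : u.arr 12 (s.reg 40) = s.reg 42 := by
        rw [← hu]; simp [hr]
      have hcase : ∀ i < u.reg 40, i < s.reg 40 ∨ i = s.reg 40 := fun i hi => by omega
      refine ⟨⟨?_, ?_, ?_, ?_⟩, ⟨by omega, uold⟩, ⟨s.reg 40, by omega, unew⟩⟩
      · have := h.lt; omega
      · intro n hn
        rw [uold n (hn.trans_lt h.lt), h.roots n hn]
      · intro i hi
        rcases hcase i hi with hi | rfl
        · rw [u12 i hi, uold i hi]
          rcases h.parent i hi with h1 | ⟨h1, h2, h3⟩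
          · exact Or.inl h1
          · rw [uold _ (h2.trans hi)]; exact Or.inr ⟨h1, h2, h3⟩
        · rw [u12', unew, uold _ h42]
          exact Or.inr ⟨h.lt, h42, hstep⟩
      · intro i j hi hj hij
        rcases hcase i hi with hi | rfl <;> rcases hcase j hj with hj | rfl
        · rw [uold i hi, uold j hj] at hij
          exact h.inj i j hi hj hij
        · rw [uold i hi, unew] at hij
          exact absurd ⟨i, hi, hij⟩ hnew
        · rw [uold j hj, unew] at hij
          exact absurd ⟨j, hj, hij.symm⟩ hnew
        · rfl

/-- The data of the search that do not change. -/
structure Params (w : ℕ → ℕ) (T m : ℕ) (s : State) : Prop where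
  m_eq : s.reg 9 = m
  T_eq : s.reg 29 = T
  w_eq : ∀ a ≤ m, s.arr 4 a = w a

/-- The configuration under treatment. -/
structure Current (c : Cfg) (s : State) : Prop where
  lt : s.reg 42 < s.reg 40
  at_eq : cfgAt s (s.reg 42) = c
  x : s.reg 43 = c.x
  y : s.reg 44 = c.y
  lo : s.reg 45 = c.lo
  hi : s.reg 46 = c.hi
  p : s.reg 47 = c.p
  q : s.reg 48 = c.q
  s : s.reg 49 = c.s

/-- Push the configuration that arises by a top step. -/
def topStmt : Stmt :=
  cond (le (var 50) (add (var 47) (sub (var 44) (lit 1))))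
    (set 51 (add (var 43) (lit 1)) ;; set 52 (var 44) ;; set 53 (var 45) ;; set 54 (var 50) ;;
      set 55 (sub (add (var 47) (sub (var 44) (lit 1))) (var 50)) ;; set 56 (var 48) ;;
      set 57 (add (var 49) (load 4 (var 50))) ;; pushStmt) skip

/-- Push the configuration that arises by a bottom step. -/
def botStmt : Stmt :=
  cond (le (var 43) (add (var 48) (var 50)))
    (set 51 (var 43) ;; set 52 (sub (var 44) (lit 1)) ;; set 53 (var 50) ;; set 54 (var 46) ;;
      set 55 (var 47) ;; set 56 (sub (add (var 48) (var 50)) (var 43)) ;;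
      set 57 (add (var 49) (load 4 (var 50))) ;; pushStmt) skip

theorem wp_topStmt {M : ℕ} {w : ℕ → ℕ} {T m a : ℕ} {s : State} {c : Cfg} (h : Search w T m s)
    (hM : (T + 1) * (m + 2) ^ 8 ≤ M) (hp : Params w T m s) (hc : Current c s)
    (ha : s.reg 50 = a) (ham : a ≤ m) (hfit : c.Fits w T a) :
    wp M topStmt (fun s' => Search w T m s' ∧ Extends s s' ∧
      (a ≤ c.p + (c.y - 1) → Present s' (c.top w a))) s := by
  simp only [topStmt, wp_cond_iff, ne_eq, eval_le, not_not, eval_var, eval_add, eval_sub, eval_lit,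
    wp_skip_iff, ha, hc.p, hc.y]
  refine ⟨fun hle => ?_, fun hle => ⟨h, .refl s, fun h' => absurd h' hle⟩⟩
  simp only [wp_seq_iff, wp_set_iff]
  generalize hu : State.setReg _ 57 _ = u
  have hr : ∀ z, z < 51 → u.reg z = s.reg z := fun z hz => by
    rw [← hu]
    simp [(show z ≠ 51 by omega), (show z ≠ 52 by omega), (show z ≠ 53 by omega),
      (show z ≠ 54 by omega), (show z ≠ 55 by omega), (show z ≠ 56 by omega),
      (show z ≠ 57 by omega)]
  have har : ∀ a, u.arr a = s.arr a := fun a => by rw [← hu]; rfl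
  have hnew : newCfg u = c.top w a := by
    rw [← hu]
    simp [newCfg, Cfg.top, hc.x, hc.y, hc.lo, hc.p, hc.q, hc.s, ha, hp.w_eq a ham]
  have h40 := hr 40 (by decide)
  have he : Extends s u := .of_eq h40 fun a _ _ => har a
  refine wp_mono (wp_pushStmt (h.congr h40 fun a _ _ => har a) hM ?_ ?_) ?_
  · rw [hr 42 (by decide), h40]; exact hc.lt
  · rw [hr 42 (by decide), hnew, he.2 _ hc.lt, hc.at_eq]
    exact ⟨a, hfit, Or.inl ⟨hle, rfl⟩⟩
  · rintro s' ⟨h1, h2, h3⟩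
    exact ⟨h1, he.trans h2, fun _ => hnew ▸ h3⟩

theorem wp_botStmt {M : ℕ} {w : ℕ → ℕ} {T m a : ℕ} {s : State} {c : Cfg} (h : Search w T m s)
    (hM : (T + 1) * (m + 2) ^ 8 ≤ M) (hp : Params w T m s) (hc : Current c s)
    (ha : s.reg 50 = a) (ham : a ≤ m) (hfit : c.Fits w T a) :
    wp M botStmt (fun s' => Search w T m s' ∧ Extends s s' ∧
      (c.x ≤ c.q + a → Present s' (c.bot w a))) s := by
  simp only [botStmt, wp_cond_iff, ne_eq, eval_le, not_not, eval_var, eval_add,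
    wp_skip_iff, ha, hc.q, hc.x]
  refine ⟨fun hle => ?_, fun hle => ⟨h, .refl s, fun h' => absurd h' hle⟩⟩
  simp only [wp_seq_iff, wp_set_iff]
  generalize hu : State.setReg _ 57 _ = u
  have hr : ∀ z, z < 51 → u.reg z = s.reg z := fun z hz => by
    rw [← hu]
    simp [(show z ≠ 51 by omega), (show z ≠ 52 by omega), (show z ≠ 53 by omega),
      (show z ≠ 54 by omega), (show z ≠ 55 by omega), (show z ≠ 56 by omega),
      (show z ≠ 57 by omega)]
  have har : ∀ a, u.arr a = s.arr a := fun a => by rw [← hu]; rfl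
  have hnew : newCfg u = c.bot w a := by
    rw [← hu]
    simp [newCfg, Cfg.bot, hc.x, hc.y, hc.hi, hc.p, hc.q, hc.s, ha, hp.w_eq a ham]
  have h40 := hr 40 (by decide)
  have he : Extends s u := .of_eq h40 fun a _ _ => har a
  refine wp_mono (wp_pushStmt (h.congr h40 fun a _ _ => har a) hM ?_ ?_) ?_
  · rw [hr 42 (by decide), h40]; exact hc.lt
  · rw [hr 42 (by decide), hnew, he.2 _ hc.lt, hc.at_eq]
    exact ⟨a, hfit, Or.inr ⟨hle, rfl⟩⟩
  · rintro s' ⟨h1, h2, h3⟩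
    exact ⟨h1, he.trans h2, fun _ => hnew ▸ h3⟩

theorem Params.frame {w : ℕ → ℕ} {T m : ℕ} {s s' : State} {c : Stmt} (h : Params w T m s)
    (hf : Frame c s s') (h9 : c.regs 9 = false) (h29 : c.regs 29 = false)
    (h4 : c.arrs 4 = false) : Params w T m s' :=
  ⟨(hf.reg 9 h9).trans h.m_eq, (hf.reg 29 h29).trans h.T_eq, fun a ha => by
    rw [hf.arr 4 h4, h.w_eq a ha]⟩

theorem Current.frame {c : Cfg} {s s' : State} {d : Stmt} (h : Current c s) (hf : Frame d s s')
    (he : Extends s s') (hd : ∀ z, 42 ≤ z → z ≤ 49 → d.regs z = false) : Current c s' := by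
  have hr : ∀ z, 42 ≤ z → z ≤ 49 → s'.reg z = s.reg z := fun z h1 h2 => hf.reg z (hd z h1 h2)
  have h42 := hr 42 (by omega) (by omega)
  obtain ⟨h0, h1, h2, h3, h4, h5, h6, h7, h8⟩ := h
  constructor
  · rw [h42]; exact h0.trans_le he.1
  · rw [h42, he.2 _ h0, h1]
  all_goals rw [hr _ (by omega) (by omega)]; assumption

/-- Push all successors of the configuration under treatment. -/
def expandStmt : Stmt :=
  loop 50 (add (var 9) (lit 1))
    (cond (and (le (var 45) (var 50)) (and (le (var 50) (var 46))
        (le (add (var 49) (load 4 (var 50))) (var 29))))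
      (topStmt ;; botStmt) skip)

theorem wp_expandStmt {M : ℕ} {w : ℕ → ℕ} {T m : ℕ} {s : State} {c : Cfg} (h : Search w T m s)
    (hM : (T + 1) * (m + 2) ^ 8 ≤ M) (hmM : m + 1 ≤ M) (hp : Params w T m s) (hc : Current c s)
    (hxy : c.x < c.y) :
    wp M expandStmt (fun s' => Search w T m s' ∧ Extends s s' ∧
      ∀ c', Cfg.Step w T c c' → Present s' c') s := by
  refine wp_loop (fun k s' => Search w T m s' ∧ Extends s s' ∧ ∀ a < k, c.Fits w T a →
    (a ≤ c.p + (c.y - 1) → Present s' (c.top w a)) ∧ (c.x ≤ c.q + a → Present s' (c.bot w a)))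
    (by simpa [hp.m_eq]) ⟨h, .refl s, by simp⟩ ?_ ?_
  · rintro a s₀ ha hf ⟨h₀, e₀, k₀⟩
    have ham : a ≤ m := by simpa [hp.m_eq, Nat.lt_succ_iff] using ha
    have p₀ := hp.frame hf rfl rfl rfl
    have c₀ := hc.frame hf e₀ fun z h1 h2 => by interval_cases z <;> rfl
    generalize hs₁ : s₀.setReg 50 a = s₁
    have hr : ∀ z, z ≠ 50 → s₁.reg z = s₀.reg z := fun z hz => by rw [← hs₁]; simp [hz]
    have har : ∀ b, s₁.arr b = s₀.arr b := fun b => by rw [← hs₁]; rfl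
    have e₁ : Extends s₀ s₁ := .of_eq (hr 40 (by decide)) fun b _ _ => har b
    have h₁ : Search w T m s₁ := h₀.congr (hr 40 (by decide)) fun b _ _ => har b
    have p₁ : Params w T m s₁ := ⟨by rw [hr 9 (by decide), p₀.m_eq],
      by rw [hr 29 (by decide), p₀.T_eq], fun b hb => by rw [har, p₀.w_eq b hb]⟩
    have c₁ : Current c s₁ := by
      refine c₀.frame (d := set 50 (lit a)) ⟨fun z hz => ?_, fun b _ => har b⟩ e₁
        fun z h1 h2 => by interval_cases z <;> rfl
      exact hr z (by simpa [regs] using hz)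
    have a₁ : s₁.reg 50 = a := by rw [← hs₁]; simp
    simp only [wp_cond_iff, ne_eq, eval_and, not_not, eval_le, eval_var, eval_add, eval_load,
      wp_skip_iff, a₁, c₁.lo, c₁.hi, c₁.s, p₁.T_eq, p₁.w_eq a ham]
    refine ⟨fun hfit => ?_, fun hfit => ⟨h₁, e₀.trans e₁, fun b hb hb' => ?_⟩⟩
    · have hfit' : c.Fits w T a := ⟨hxy, hfit⟩
      refine wp_seq _ (wp_topStmt h₁ hM p₁ c₁ a₁ ham hfit') ?_
      rintro s₂ f₂ ⟨h₂, e₂, k₂⟩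
      refine wp_mono (wp_botStmt h₂ hM (p₁.frame f₂ rfl rfl rfl)
        (c₁.frame f₂ e₂ fun z h1 h2 => by interval_cases z <;> rfl)
        ((f₂.reg 50 rfl).trans a₁) ham hfit') ?_
      rintro s₃ ⟨h₃, e₃, k₃⟩
      refine ⟨h₃, e₀.trans (e₁.trans (e₂.trans e₃)), fun b hb hb' => ?_⟩
      rcases Nat.eq_or_lt_of_le (Nat.le_of_lt_succ hb) with rfl | hb
      · exact ⟨fun h => (k₂ h).extends e₃, k₃⟩
      · exact ⟨fun h => ((k₀ b hb hb').1 h).extends (e₁.trans (e₂.trans e₃)),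
          fun h => ((k₀ b hb hb').2 h).extends (e₁.trans (e₂.trans e₃))⟩
    · rcases Nat.eq_or_lt_of_le (Nat.le_of_lt_succ hb) with rfl | hb
      · exact absurd hb'.2 hfit
      · exact ⟨fun h => ((k₀ b hb hb').1 h).extends e₁, fun h => ((k₀ b hb hb').2 h).extends e₁⟩
  · rintro s' _ ⟨h', e', k'⟩
    refine ⟨h', e', ?_⟩
    rintro c' ⟨a, hfit, hcase⟩
    -- The loop tries no degree above `m`, and none is missed: the upper limit `hi` of a listed
    -- configuration is at most `m`.
    have ham : a ≤ m := by
      have := (h.box _ hc.lt).2.2.2.1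
      rw [hc.at_eq] at this
      exact hfit.2.2.1.trans this
    have := k' a (by simpa [hp.m_eq] using Nat.lt_succ_of_le ham) hfit
    rcases hcase with ⟨h1, rfl⟩ | ⟨h1, rfl⟩
    · exact this.1 h1
    · exact this.2 h1

/-- Write the starting points. -/
def rootsStmt : Stmt :=
  loop 41 (add (var 9) (lit 1))
    (put 5 (var 41) (lit 0) ;; put 6 (var 41) (var 41) ;; put 7 (var 41) (lit 0) ;;
      put 8 (var 41) (var 41) ;; put 9 (var 41) (lit 0) ;; put 10 (var 41) (lit 0) ;;
      put 11 (var 41) (lit 0) ;; put 12 (var 41) (var 41)) ;;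
  set 40 (add (var 9) (lit 1))

theorem wp_rootsStmt {M : ℕ} {w : ℕ → ℕ} {T m : ℕ} {s : State} (hmM : m + 1 ≤ M)
    (hm : s.reg 9 = m) : wp M rootsStmt (Search w T m) s := by
  simp only [rootsStmt, wp_seq_iff]
  refine wp_loop (fun k s' => ∀ i < k, cfgAt s' i = Cfg.root i ∧ s'.arr 12 i = i)
    (by simpa [hm]) (by simp) ?_ ?_
  · intro k s' _ _ hk i hi
    rcases Nat.eq_or_lt_of_le (Nat.le_of_lt_succ hi) with rfl | hi'
    · simp [cfgAt, Cfg.root]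
    · have := hk i hi'
      simp only [cfgAt] at this
      simp [cfgAt, hi'.ne, this]
  · intro s' hf hk
    have h9 : s'.reg 9 = m := (hf.reg 9 rfl).trans hm
    have he : (add (var 9) (lit 1)).eval s' = m + 1 := by simp [h9]
    simp only [eval_add, eval_var, eval_lit, hm] at hk
    rw [wp_set_iff, he]
    have hc : ∀ i, cfgAt (s'.setReg 40 (m + 1)) i = cfgAt s' i := fun i => rfl
    constructor
    · simp
    · exact fun n hn => (hk n (by omega)).1
    · intro i hi
      simp only [State.reg_setReg, if_true] at hi
      exact Or.inl ⟨by omega, (hk i hi).2⟩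
    · intro i j hi hj hij
      simp only [State.reg_setReg, if_true] at hi hj
      rw [hc, hc, (hk i hi).1, (hk j hj).1] at hij
      exact congrArg Cfg.y hij

/-- The whole search. -/
def searchStmt : Stmt :=
  rootsStmt ;;
  loop 42 (var 31) (cond (lt (var 42) (var 40))
    (set 43 (load 5 (var 42)) ;; set 44 (load 6 (var 42)) ;; set 45 (load 7 (var 42)) ;;
      set 46 (load 8 (var 42)) ;; set 47 (load 9 (var 42)) ;; set 48 (load 10 (var 42)) ;;
      set 49 (load 11 (var 42)) ;; cond (lt (var 43) (var 44)) expandStmt skip) skip)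

/-- The list is its own queue: round `k` expands entry `k` if it exists by then. The number of
rounds is fixed in advance as the bound for the length of the list, so in the end every entry has
been expanded and the list is closed under steps. -/
theorem wp_searchStmt {M : ℕ} {w : ℕ → ℕ} {T m : ℕ} {s : State} (hmM : m + 1 ≤ M)
    (hM : (T + 1) * (m + 2) ^ 8 ≤ M) (hp : Params w T m s)
    (h31 : s.reg 31 = (T + 1) * (m + 2) ^ 8) :
    wp M searchStmt (fun s' => Search w T m s' ∧
      ∀ c c', Present s' c → Cfg.Step w T c c' → Present s' c') s := by
  refine wp_seq _ (wp_rootsStmt (w := w) (T := T) hmM hp.m_eq) ?_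
  intro s₀ f₀ h₀
  have hp₀ := hp.frame f₀ rfl rfl rfl
  have h31₀ : s₀.reg 31 = (T + 1) * (m + 2) ^ 8 := (f₀.reg 31 rfl).trans h31
  refine wp_loop (fun k s' => Search w T m s' ∧ ∀ i < k, i < s'.reg 40 →
    ∀ c', Cfg.Step w T (cfgAt s' i) c' → Present s' c') (by simpa [h31₀]) ⟨h₀, by simp⟩ ?_ ?_
  · rintro k s' _ hf ⟨h', k'⟩
    have hp' := hp₀.frame hf rfl rfl rfl
    generalize hs₁ : s'.setReg 42 k = s₁
    have s42 : s₁.reg 42 = k := by rw [← hs₁]; simp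
    have hr : ∀ z, z ≠ 42 → s₁.reg z = s'.reg z := fun z hz => by rw [← hs₁]; simp [hz]
    have har : ∀ b, s₁.arr b = s'.arr b := fun b => by rw [← hs₁]; rfl
    have e₁ : Extends s' s₁ := .of_eq (hr 40 (by decide)) fun b _ _ => har b
    have h₁ : Search w T m s₁ := h'.congr (hr 40 (by decide)) fun b _ _ => har b
    simp only [wp_cond_iff, ne_eq, eval_lt, not_not, eval_var, wp_skip_iff, s42]
    refine ⟨fun hlt => ?_, fun hlt => ⟨h₁, fun i hi hi' c' hc' => ?_⟩⟩
    · simp only [wp_seq_iff, wp_set_iff]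
      generalize hu : State.setReg _ 49 _ = u
      have ur : ∀ z, z < 43 → u.reg z = s₁.reg z := fun z hz => by
        rw [← hu]
        simp [(show z ≠ 43 by omega), (show z ≠ 44 by omega), (show z ≠ 45 by omega),
          (show z ≠ 46 by omega), (show z ≠ 47 by omega), (show z ≠ 48 by omega),
          (show z ≠ 49 by omega)]
      have uar : ∀ b, u.arr b = s₁.arr b := fun b => by rw [← hu]; rfl
      have e₂ : Extends s₁ u := .of_eq (ur 40 (by decide)) fun b _ _ => uar b
      have h₂ : Search w T m u := h₁.congr (ur 40 (by decide)) fun b _ _ => uar b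
      have u42 : u.reg 42 = k := (ur 42 (by decide)).trans s42
      have p₂ : Params w T m u := ⟨by rw [ur 9 (by decide), hr 9 (by decide), hp'.m_eq],
        by rw [ur 29 (by decide), hr 29 (by decide), hp'.T_eq],
        fun b hb => by rw [uar, har, hp'.w_eq b hb]⟩
      have hk40 : k < u.reg 40 := by rw [ur 40 (by decide)]; exact hlt
      have c₂ : Current (cfgAt u k) u := by
        constructor
        · rwa [u42]
        · rw [u42]
        all_goals
          simp only [cfgAt, uar]
          rw [← hu]
          simp [s42]
      have huk : ∀ i < s'.reg 40, cfgAt u i = cfgAt s' i := (e₁.trans e₂).2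
      have h40 : u.reg 40 = s'.reg 40 := (ur 40 (by decide)).trans (hr 40 (by decide))
      have hold : ∀ {v : State}, Extends u v → ∀ i < k,
          ∀ c', Cfg.Step w T (cfgAt v i) c' → Present v c' := by
        intro v hv i hi c' hc'
        have hi' : i < s'.reg 40 := by omega
        rw [hv.2 i (by omega), huk i hi'] at hc'
        exact (k' i hi hi' c' hc').extends ((e₁.trans e₂).trans hv)
      simp only [wp_cond_iff, ne_eq, eval_lt, not_not, eval_var, wp_skip_iff]
      refine ⟨fun hxy => ?_, fun hxy => ⟨h₂, fun i hi hi' c' hc' => ?_⟩⟩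
      · rw [c₂.x, c₂.y] at hxy
        refine wp_mono (wp_expandStmt h₂ hM hmM p₂ c₂ hxy) ?_
        rintro v ⟨h₃, e₃, k₃⟩
        refine ⟨h₃, fun i hi hi' c' hc' => ?_⟩
        rcases Nat.eq_or_lt_of_le (Nat.le_of_lt_succ hi) with rfl | hi
        · rw [e₃.2 i hk40] at hc'
          exact k₃ c' hc'
        · exact hold e₃ i hi c' hc'
      · rcases Nat.eq_or_lt_of_le (Nat.le_of_lt_succ hi) with rfl | hi
        · obtain ⟨a, hfit, _⟩ := hc'
          rw [c₂.x, c₂.y] at hxy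
          exact absurd hfit.1 hxy
        · exact hold (.refl u) i hi c' hc'
    · have hi₁ : i < s'.reg 40 := by rwa [hr 40 (by decide)] at hi'
      have hik : i < k := by omega
      rw [e₁.2 i hi₁] at hc'
      exact (k' i hik hi₁ c' hc').extends e₁
  · rintro s' _ ⟨h', k'⟩
    refine ⟨h', ?_⟩
    rintro _ c' ⟨i, hi, rfl⟩ hc'
    refine k' i ?_ hi c' hc'
    have := h'.length_le
    simp only [eval_var, h31₀]
    omega

/-! ### Reading off the certificate -/

/-- Look for a goal in the list. -/
def findStmt : Stmt :=
  set 60 (lit 0) ;;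
  loop 61 (var 40) (cond (and (eq (load 5 (var 61)) (load 6 (var 61)))
      (and (eq (load 9 (var 61)) (load 10 (var 61))) (eq (load 11 (var 61)) (var 29))))
    (set 60 (lit 1) ;; set 62 (var 61)) skip)

theorem wp_findStmt {M T : ℕ} {s : State} (hM : s.reg 40 ≤ M) (hT : s.reg 29 = T) :
    wp M findStmt (fun s' => (s'.reg 60 = 0 → ∀ c, Present s c → ¬ c.Goal T) ∧
      (s'.reg 60 ≠ 0 → s'.reg 62 < s.reg 40 ∧ (cfgAt s (s'.reg 62)).Goal T)) s := by
  simp only [findStmt, wp_seq_iff, wp_set_iff]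
  refine wp_loop (fun k s' => (s'.reg 60 = 0 → ∀ i < k, ¬ (cfgAt s i).Goal T) ∧
      (s'.reg 60 ≠ 0 → s'.reg 62 < k ∧ (cfgAt s (s'.reg 62)).Goal T)) (by simpa) (by simp) ?_ ?_
  · rintro k s' _ hf ⟨h1, h2⟩
    have ha : ∀ a, s'.arr a = s.arr a := fun a => hf.arr a rfl
    have hr : s'.reg 29 = T := by simpa [hT] using hf.reg 29 rfl
    have hg : (cfgAt s k).Goal T ↔
        s.arr 5 k = s.arr 6 k ∧ s.arr 9 k = s.arr 10 k ∧ s.arr 11 k = T := Iff.rfl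
    simp only [wp_cond_iff, wp_skip_iff, wp_seq_iff, wp_set_iff]
    refine ⟨fun hc => ?_, fun hc => ?_⟩
    · simp [ha, hr] at hc
      simp [hg, hc]
    · simp [ha, hr] at hc
      simp only [State.reg_setReg, if_neg (show 60 ≠ 61 by decide),
        if_neg (show 62 ≠ 61 by decide)]
      refine ⟨fun h i hi => ?_, fun h => ⟨(h2 h).1.trans (Nat.lt_succ_self k), (h2 h).2⟩⟩
      rcases Nat.eq_or_lt_of_le (Nat.le_of_lt_succ hi) with rfl | hi
      · rw [hg]; tauto
      · exact h1 h i hi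
  · rintro s' _ ⟨h1, h2⟩
    simp only [eval_var, State.reg_setReg, if_neg (show 40 ≠ 60 by decide)] at h1 h2
    refine ⟨fun h c hc hg => ?_, h2⟩
    obtain ⟨i, hi, rfl⟩ := hc
    exact h1 h i hi hg

/-- Follow the parents from the goal to a starting point and write the degrees to array `13`, the
degrees in the shifted graph to array `14`, and the ends of its neighbourhoods to array `15`. -/
def traceStmt : Stmt :=
  set 42 (var 62) ;;
  loop 63 (add (var 9) (lit 1)) (set 64 (load 12 (var 42)) ;;
    cond (eq (var 64) (var 42)) skip
      (cond (eq (load 5 (var 64)) (load 5 (var 42)))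
        (set 65 (load 6 (var 42)) ;; put 13 (var 65) (load 7 (var 42)) ;;
          put 14 (var 65) (load 5 (var 42)) ;; put 15 (var 65) (lit 0))
        (set 65 (load 5 (var 64)) ;; put 13 (var 65) (load 8 (var 42)) ;;
          put 14 (var 65) (sub (load 6 (var 64)) (lit 1)) ;; put 15 (var 65) (load 6 (var 64))) ;;
      set 42 (var 64))) ;;
  set 1 (load 6 (var 42))

/-- Each passage to a parent lengthens the interval by one, and no interval is longer than `m`, so
`m + 1` rounds reach a starting point. Starting points are their own parents, which makes surplus
rounds harmless. -/
theorem wp_traceStmt {M : ℕ} {w : ℕ → ℕ} {T m : ℕ} {s : State} (h : Search w T m s)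
    (hmM : m + 1 ≤ M) (hm : s.reg 9 = m) (h62 : s.reg 62 < s.reg 40)
    (hg : (cfgAt s (s.reg 62)).Goal T) :
    wp M traceStmt (fun s' => ∃ n ≤ m, s'.reg 1 = n ∧
      Completes w T (Cfg.root n) (s'.arr 13) (s'.arr 14) (s'.arr 15)) s := by
  simp only [traceStmt, wp_seq_iff, wp_set_iff]
  refine wp_loop (fun k s' => s'.reg 42 < s.reg 40 ∧
    Completes w T (cfgAt s (s'.reg 42)) (s'.arr 13) (s'.arr 14) (s'.arr 15) ∧
    (s'.reg 42 ≤ m ∨ k + (cfgAt s (s'.reg 42)).x ≤ (cfgAt s (s'.reg 42)).y))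
    (by simpa [hm]) ?_ ?_ ?_
  · refine ⟨by simpa, completes_of_goal (by simpa using hg) _ _ _, Or.inr ?_⟩
    simpa using hg.1.le
  · rintro k s' _ hf ⟨h1, h2, h3⟩
    have har : ∀ a, 5 ≤ a → a ≤ 12 → s'.arr a = s.arr a := fun a h5 h12 =>
      hf.arr a (by interval_cases a <;> rfl)
    have a5 := har 5 (by decide) (by decide)
    have a6 := har 6 (by decide) (by decide)
    have a7 := har 7 (by decide) (by decide)
    have a8 := har 8 (by decide) (by decide)
    have a12 := har 12 (by decide) (by decide)
    have hc := h2.le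
    simp only [wp_seq_iff, wp_set_iff, wp_cond_iff, wp_skip_iff, wp_put_iff]
    generalize hh : s'.reg 42 = i at *
    have heq : (eq (var 64) (var 42)).eval ((s'.setReg 63 k).setReg 64
        ((load 12 (var 42)).eval (s'.setReg 63 k))) = 0 ↔ s.arr 12 i ≠ i := by
      simp [hh, a12]
    refine ⟨fun hroot => ?_, fun hroot => ?_⟩
    · have hroot' : s.arr 12 i = i := by
        by_contra hne; exact hroot (heq.2 hne)
      simp only [State.reg_setReg, if_neg (show 42 ≠ 64 by decide),
        if_neg (show 42 ≠ 63 by decide), hh]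
      refine ⟨h1, h2, Or.inl ?_⟩
      rcases h.parent i h1 with h4 | h4
      · exact h4.1
      · omega
    · have hroot' := heq.1 hroot
      obtain ⟨h4, h5, a, hfit, hstep⟩ := (h.parent i h1).resolve_left fun h => hroot' h.2
      have hk : k + (cfgAt s i).x ≤ (cfgAt s i).y := h3.resolve_left (by omega)
      have hp : s.arr 12 i < s.reg 40 := h5.trans h1
      have hx : (cfgAt s (s.arr 12 i)).x = s.arr 5 (s.arr 12 i) := rfl
      have hy : (cfgAt s (s.arr 12 i)).y = s.arr 6 (s.arr 12 i) := rfl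
      have hx' : (cfgAt s i).x = s.arr 5 i := rfl
      have hy' : (cfgAt s i).y = s.arr 6 i := rfl
      have hlo' : (cfgAt s i).lo = s.arr 7 i := rfl
      have hhi' : (cfgAt s i).hi = s.arr 8 i := rfl
      -- The kind of step is visible from `x`, which a bottom step keeps and a top step raises. The
      -- degree chosen in the step is stored in the child, as `lo` after a bottom step and as `hi`
      -- after a top step.
      refine ⟨fun hxx => ?_, fun hxx => ?_⟩
      · simp [hh, a12, a5] at hxx
        rcases hstep with ⟨hle, hs⟩ | ⟨hle, hs⟩
        · have := congrArg Cfg.x hs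
          simp only [Cfg.top] at this
          omega
        have e1 := congrArg Cfg.y hs
        have e2 := congrArg Cfg.lo hs
        simp only [Cfg.bot] at e1 e2
        rw [hs] at h2
        have h6 := h2.bot hfit hle
        rw [← e1, hy', hx, hxx, ← e2, hlo'] at h6
        simp [hh, a12, a5, a6, a7, State.arr_setArr_eq]
        refine ⟨hp, h6, Or.inr ?_⟩
        have := hfit.1
        omega
      · simp [hh, a12, a5] at hxx
        rcases hstep with ⟨hle, hs⟩ | ⟨hle, hs⟩
        swap
        · have := congrArg Cfg.x hs
          simp only [Cfg.bot] at this
          omega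
        have e1 := congrArg Cfg.x hs
        have e2 := congrArg Cfg.hi hs
        have e3 := congrArg Cfg.y hs
        simp only [Cfg.top] at e1 e2 e3
        rw [hs] at h2
        have h6 := h2.top hfit hle
        rw [hx, ← e2, hhi', hy] at h6
        simp [hh, a12, a5, a6, a8, State.arr_setArr_eq]
        refine ⟨hp, h6, Or.inr ?_⟩
        have := hfit.1
        omega
  · rintro s' hf ⟨h1, h2, h3⟩
    have a6 : s'.arr 6 = s.arr 6 := hf.arr 6 rfl
    have hroot : s'.reg 42 ≤ m := by
      refine h3.resolve_right fun h4 => ?_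
      have h5 := (h.box _ h1).2.1
      simp [hm] at h4
      omega
    rw [h.roots _ hroot] at h2
    have hy : s.arr 6 (s'.reg 42) = s'.reg 42 := congrArg Cfg.y (h.roots _ hroot)
    exact ⟨s'.reg 42, hroot, by simp [a6, hy], h2⟩

/-! ### Constructing the graph -/

open scoped Classical in
/-- The array `f` holds the adjacency matrix of `A` on `[0, n)`. -/
def HoldsMatrix (n : ℕ) (f : ℕ → ℕ) (A : SimpleGraph ℕ) : Prop :=
  ∀ u < n, ∀ v < n, f (u * n + v) = if A.Adj u v then 1 else 0

theorem index_inj {n u v u' v' : ℕ} (hv : v < n) (hv' : v' < n) :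
    u * n + v = u' * n + v' ↔ u = u' ∧ v = v' := by
  refine ⟨fun h => ?_, by rintro ⟨rfl, rfl⟩; rfl⟩
  rcases lt_trichotomy u u' with h1 | rfl | h1
  · have := Nat.mul_le_mul_right n (show u + 1 ≤ u' from h1)
    rw [Nat.add_mul] at this
    omega
  · exact ⟨rfl, by omega⟩
  · have := Nat.mul_le_mul_right n (show u' + 1 ≤ u from h1)
    rw [Nat.add_mul] at this
    omega

theorem upTo_adj_iff {e : ℕ → ℕ} {u v : ℕ} :
    (upTo e).Adj u v ↔ (u < v ∧ v < e u) ∨ (v < u ∧ u < e v) := by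
  rw [upTo_adj]
  rcases lt_trichotomy u v with h | rfl | h
  · rw [max_eq_right h.le, min_eq_left h.le]; omega
  · simp
  · rw [max_eq_left h.le, min_eq_right h.le]; omega

/-- Write the adjacency matrix of the shifted graph. -/
def fillStmt : Stmt :=
  loop 66 (var 1) (loop 67 (var 1) (mulStmt 68 66 1 ;; set 68 (add (var 68) (var 67)) ;;
    set 69 (lit 0) ;;
    cond (and (lt (var 66) (var 67)) (lt (var 67) (load 15 (var 66)))) (set 69 (lit 1)) skip ;;
    cond (and (lt (var 67) (var 66)) (lt (var 66) (load 15 (var 67)))) (set 69 (lit 1)) skip ;;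
    put 1 (var 68) (var 69)))

theorem wp_fillStmt {M n : ℕ} {s : State} (hn : s.reg 1 = n) (hM : n ≤ M) :
    wp M fillStmt (fun s' => HoldsMatrix n (s'.arr 1) (upTo (s.arr 15))) s := by
  classical
  refine wp_loop (fun k s' => ∀ u < k, ∀ v < n,
    s'.arr 1 (u * n + v) = if (upTo (s.arr 15)).Adj u v then 1 else 0) (by simpa [hn]) (by simp) ?_ ?_
  · intro u s₀ hu f₀ h₀
    have hu' : u < n := by simpa [hn] using hu
    have n₀ : s₀.reg 1 = n := (f₀.reg 1 rfl).trans hn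
    have a₀ : s₀.arr 15 = s.arr 15 := f₀.arr 15 rfl
    refine wp_loop (fun k s' => (∀ u' < u, ∀ v < n,
      s'.arr 1 (u' * n + v) = if (upTo (s.arr 15)).Adj u' v then 1 else 0) ∧ ∀ v < k,
      s'.arr 1 (u * n + v) = if (upTo (s.arr 15)).Adj u v then 1 else 0)
      (by simpa [n₀]) ⟨h₀, by simp⟩ ?_ ?_
    · rintro v s₁ hv f₁ ⟨h₁, k₁⟩
      have hv' : v < n := by simpa [n₀] using hv
      have n₁ : s₁.reg 1 = n := by simpa [n₀] using f₁.reg 1 rfl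
      have u₁ : s₁.reg 66 = u := by simpa using f₁.reg 66 rfl
      have a₁ : s₁.arr 15 = s.arr 15 := (f₁.arr 15 rfl).trans a₀
      refine wp_mulStmt (by decide) (by decide) (by decide) (by decide) (by simpa [n₁]) ?_
      intro s₂ hr₂ ha₂ hm₂
      have m₂ : s₂.reg 68 = u * n := by simpa [n₁, u₁] using hm₂
      have u₂ : s₂.reg 66 = u := by simpa [u₁] using hr₂ 66
      have v₂ : s₂.reg 67 = v := by simpa using hr₂ 67
      have a₂ : s₂.arr 15 = s.arr 15 := by rw [ha₂]; exact a₁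
      have b₂ : s₂.arr 1 = s₁.arr 1 := by rw [ha₂]; rfl
      have fin : ∀ s₃ : State, s₃.arr 1 = s₁.arr 1 → s₃.reg 68 = u * n + v →
          s₃.reg 69 = (if (upTo (s.arr 15)).Adj u v then 1 else 0) →
          wp M (put 1 (var 68) (var 69)) (fun s' => (∀ u' < u, ∀ v < n,
            s'.arr 1 (u' * n + v) = if (upTo (s.arr 15)).Adj u' v then 1 else 0) ∧ ∀ v' < v + 1,
            s'.arr 1 (u * n + v') = if (upTo (s.arr 15)).Adj u v' then 1 else 0) s₃ := by
        intro s₃ b₃ m₃ e₃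
        simp only [wp_put_iff, eval_var, State.arr_setArr, true_and, m₃, e₃, b₃]
        refine ⟨fun u' hu' v'' hv'' => ?_, fun v'' hv'' => ?_⟩
        · rw [if_neg, h₁ u' hu' v'' hv'']
          rw [index_inj hv'' hv']
          omega
        · by_cases hvv : v'' = v
          · rw [hvv, if_pos rfl]
          · rw [if_neg, k₁ v'' (by omega)]
            omega
      simp only [wp_seq_iff, wp_set_iff, wp_cond_iff, wp_skip_iff]
      refine ⟨fun c1 => ⟨fun c2 => ?_, fun c2 => ?_⟩, fun c1 => ⟨fun c2 => ?_, fun c2 => ?_⟩⟩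
      all_goals
        simp [u₂, v₂, a₂] at c1 c2
        refine fin _ (by simp [b₂]) (by simp [m₂, v₂]) ?_
        simp only [upTo_adj_iff, State.reg_setReg]
        simp
      · omega
      · omega
      · omega
      · exact ⟨c1, c2⟩
    · rintro s₁ _ ⟨h₁, k₁⟩ u' hu' v hv
      simp only [eval_var, State.reg_setReg, if_neg (show 1 ≠ 66 by decide), n₀] at k₁
      rcases Nat.eq_or_lt_of_le (Nat.le_of_lt_succ hu') with rfl | hu'
      · exact k₁ v hv
      · exact h₁ u' hu' v hv
  · intro s' _ h'
    simpa [HoldsMatrix, hn] using h'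

/-- Find the first index `u < n` with `arr a u < arr b u`, or `n` if there is none. -/
def firstStmt (r a b : ℕ) : Stmt :=
  set r (var 1) ;; loop 74 (var 1)
    (cond (and (eq (var r) (var 1)) (lt (load a (var 74)) (load b (var 74)))) (set r (var 74)) skip)

theorem wp_firstStmt {M n r a b : ℕ} {s : State} (hr : r ≠ 1) (hr' : r ≠ 74) (hn : s.reg 1 = n)
    (hM : n ≤ M) :
    wp M (firstStmt r a b) (fun s' => s'.reg r ≤ n ∧
      (s'.reg r < n → s.arr a (s'.reg r) < s.arr b (s'.reg r)) ∧
      ∀ u < s'.reg r, s.arr b u ≤ s.arr a u) s := by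
  simp only [firstStmt, wp_seq_iff, wp_set_iff]
  refine wp_loop (fun k s' => s'.reg r ≤ n ∧
      (s'.reg r < n → s.arr a (s'.reg r) < s.arr b (s'.reg r) ∧ s'.reg r < k) ∧
      ∀ u < k, u < s'.reg r → s.arr b u ≤ s.arr a u) (by simpa [hr.symm, hn]) ?_ ?_ ?_
  · simp [hn]
  · rintro k s' hk hf ⟨h1, h2, h3⟩
    have hk' : k < n := by simpa [hr.symm, hn] using hk
    have n' : s'.reg 1 = n := by
      have := hf.reg 1 (by simp [regs, hr.symm])
      simpa [hr.symm, hn] using this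
    have ha : ∀ c, s'.arr c = s.arr c := fun c => hf.arr c rfl
    simp only [wp_cond_iff, wp_set_iff, wp_skip_iff]
    refine ⟨fun hc => ?_, fun hc => ?_⟩
    · simp [hr', ha, n'] at hc
      simp only [eval_var, State.reg_setReg, if_true]
      refine ⟨hk'.le, fun _ => ⟨hc.2, Nat.lt_succ_self k⟩, fun u _ huk => h3 u huk ?_⟩
      omega
    · simp [hr', ha, n'] at hc
      simp only [State.reg_setReg, if_neg hr']
      refine ⟨h1, fun h => ⟨(h2 h).1, (h2 h).2.trans (Nat.lt_succ_self k)⟩, fun u huk hur => ?_⟩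
      rcases Nat.eq_or_lt_of_le (Nat.le_of_lt_succ huk) with rfl | huk
      · refine hc (le_antisymm h1 ?_)
        by_contra hlt
        have := (h2 (by omega)).2
        omega
      · exact h3 u huk hur
  · rintro s' _ ⟨h1, h2, h3⟩
    simp only [eval_var, State.reg_setReg, if_neg hr.symm, hn] at h2 h3
    exact ⟨h1, fun h => (h2 h).1, fun u hu => h3 u (by omega) hu⟩

/-- Find a neighbour of `reg 73` that is neither a neighbour of `reg 75` nor equal to it. -/
def neighborStmt : Stmt :=
  loop 74 (var 1) (mulStmt 77 73 1 ;; set 77 (add (var 77) (var 74)) ;;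
    mulStmt 78 75 1 ;; set 78 (add (var 78) (var 74)) ;;
    cond (and (load 1 (var 77)) (and (eq (load 1 (var 78)) (lit 0))
      (sub (lit 1) (eq (var 75) (var 74))))) (set 76 (var 74)) skip)

theorem wp_neighborStmt {M n i j : ℕ} {A : SimpleGraph ℕ} {s : State} (hn : s.reg 1 = n)
    (hM : n ≤ M) (hA : HoldsMatrix n (s.arr 1) A) (hi : s.reg 73 = i) (hj : s.reg 75 = j)
    (hin : i < n) (hjn : j < n) (hex : ∃ w < n, A.Adj i w ∧ ¬ A.Adj j w ∧ j ≠ w) :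
    wp M neighborStmt (fun s' => s'.reg 76 < n ∧ A.Adj i (s'.reg 76) ∧ ¬ A.Adj j (s'.reg 76) ∧
      j ≠ s'.reg 76) s := by
  classical
  refine wp_loop (fun k s' => (∃ w < k, A.Adj i w ∧ ¬ A.Adj j w ∧ j ≠ w) → s'.reg 76 < n ∧
    A.Adj i (s'.reg 76) ∧ ¬ A.Adj j (s'.reg 76) ∧ j ≠ s'.reg 76) (by simpa [hn]) (by simp) ?_ ?_
  · intro k s' hk hf hinv
    have hk' : k < n := by simpa [hn] using hk
    have n' : s'.reg 1 = n := (hf.reg 1 rfl).trans hn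
    have i' : s'.reg 73 = i := (hf.reg 73 rfl).trans hi
    have j' : s'.reg 75 = j := (hf.reg 75 rfl).trans hj
    have a' : s'.arr 1 = s.arr 1 := hf.arr 1 rfl
    refine wp_mulStmt (by decide) (by decide) (by decide) (by decide) (by simpa [n']) ?_
    intro t ht hta hm
    rw [wp_seq_iff, wp_set_iff]
    refine wp_mulStmt (by decide) (by decide) (by decide) (by decide) (by simpa [ht, n']) ?_
    intro u hu hua hmu
    have u77 : u.reg 77 = i * n + k := by simp [hu, ht, hm, i', n']
    have u78 : u.reg 78 = j * n := by simp [hmu, ht, j', n']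
    have u74 : u.reg 74 = k := by simp [hu, ht]
    have u75 : u.reg 75 = j := by simp [hu, ht, j']
    have u76 : u.reg 76 = s'.reg 76 := by simp [hu, ht]
    have ua : u.arr 1 = s.arr 1 := by simp [hua, hta, a']
    have hsub : ∀ x : ℕ, 1 - x = 0 ↔ x ≠ 0 := by omega
    simp only [wp_seq_iff, wp_set_iff, wp_cond_iff, wp_skip_iff]
    refine ⟨fun hc => ?_, fun hc => ?_⟩
    · simp [u77, u78, u74, u75, ua, hsub, hA i hin k hk', hA j hjn k hk'] at hc
      simp only [eval_var, State.reg_setReg, if_true, if_neg (show 74 ≠ 78 by decide), u74]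
      exact fun _ => ⟨hk', hc.1, hc.2.1, hc.2.2⟩
    · simp [u77, u78, u74, u75, ua, hsub, hA i hin k hk', hA j hjn k hk'] at hc
      simp only [State.reg_setReg, if_neg (show 76 ≠ 78 by decide), u76]
      rintro ⟨w, hw, h1, h2, h3⟩
      rcases Nat.eq_or_lt_of_le (Nat.le_of_lt_succ hw) with rfl | hw
      · exact absurd (hc h1 h2) h3
      · exact hinv ⟨w, hw, h1, h2, h3⟩
  · intro s' _ h
    exact h (by simpa [hn] using hex)

/-- Write one entry of the adjacency matrix. -/
def entryStmt (u v b : ℕ) : Stmt :=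
  mulStmt 77 u 1 ;; set 77 (add (var 77) (var v)) ;; put 1 (var 77) (lit b)

theorem wp_entryStmt {M u v b : ℕ} {Q : State → Prop} {s : State} (hu : u ≠ 77) (hv : v ≠ 77)
    (hu' : u ≠ 90) (hv' : v ≠ 90) (hM : s.reg 1 ≤ M)
    (h : ∀ s', (∀ z, z ≠ 77 → z ≠ 90 → s'.reg z = s.reg z) →
      s'.arr 1 = Function.update (s.arr 1) (s.reg u * s.reg 1 + s.reg v) b →
      (∀ a, a ≠ 1 → s'.arr a = s.arr a) → Q s') :
    wp M (entryStmt u v b) Q s := by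
  refine wp_mulStmt hu (by decide) hu' (by decide) hM ?_
  intro t ht hta hm
  simp only [wp_seq_iff, wp_set_iff, wp_put_iff]
  refine h _ (fun z hz hz' => ?_) ?_ fun a ha => ?_
  · simp [hz, ht z hz hz']
  · simp [State.arr_setArr_eq, hta, hm, ht v hv hv']
  · simp [State.arr_setArr_eq, hta, ha]

/-- Replace the edge from `reg 73` to `reg 76` by the edge from `reg 75` to `reg 76`. -/
def moveStmt : Stmt :=
  entryStmt 73 76 0 ;; entryStmt 76 73 0 ;; entryStmt 75 76 1 ;; entryStmt 76 75 1 ;;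
  put 14 (var 73) (sub (load 14 (var 73)) (lit 1)) ;;
  put 14 (var 75) (add (load 14 (var 75)) (lit 1))

theorem wp_moveStmt {M n i j w : ℕ} {A : SimpleGraph ℕ} {s : State} (hn : s.reg 1 = n)
    (hM : n ≤ M) (hA : HoldsMatrix n (s.arr 1) A) (hi : s.reg 73 = i) (hj : s.reg 75 = j)
    (hw : s.reg 76 = w) (hin : i < n) (hjn : j < n) (hwn : w < n) (hij : i ≠ j)
    (hiw : A.Adj i w) (hjw : ¬ A.Adj j w) (hne : j ≠ w) (hdeg : ∀ v < n, s.arr 14 v = deg n A v) :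
    wp M moveStmt (fun s' => HoldsMatrix n (s'.arr 1) (moveEdge A i j w) ∧
      ∀ v < n, s'.arr 14 v = deg n (moveEdge A i j w) v) s := by
  classical
  refine wp_entryStmt (by decide) (by decide) (by decide) (by decide) (by omega) ?_
  intro s₁ r₁ a₁ b₁
  have q₁ : s₁.reg 1 = n ∧ s₁.reg 73 = i ∧ s₁.reg 75 = j ∧ s₁.reg 76 = w := by
    simp [r₁, hn, hi, hj, hw]
  refine wp_entryStmt (by decide) (by decide) (by decide) (by decide) (by omega) ?_
  intro s₂ r₂ a₂ b₂
  have q₂ : s₂.reg 1 = n ∧ s₂.reg 73 = i ∧ s₂.reg 75 = j ∧ s₂.reg 76 = w := by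
    simp [r₂, q₁]
  refine wp_entryStmt (by decide) (by decide) (by decide) (by decide) (by omega) ?_
  intro s₃ r₃ a₃ b₃
  have q₃ : s₃.reg 1 = n ∧ s₃.reg 73 = i ∧ s₃.reg 75 = j ∧ s₃.reg 76 = w := by
    simp [r₃, q₂]
  refine wp_entryStmt (by decide) (by decide) (by decide) (by decide) (by omega) ?_
  intro s₄ r₄ a₄ b₄
  have q₄ : s₄.reg 1 = n ∧ s₄.reg 73 = i ∧ s₄.reg 75 = j ∧ s₄.reg 76 = w := by
    simp [r₄, q₃]
  have d₄ : s₄.arr 14 = s.arr 14 := by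
    rw [b₄ 14 (by decide), b₃ 14 (by decide), b₂ 14 (by decide), b₁ 14 (by decide)]
  have m₄ : s₄.arr 1 = Function.update (Function.update (Function.update (Function.update (s.arr 1)
      (i * n + w) 0) (w * n + i) 0) (j * n + w) 1) (w * n + j) 1 := by
    rw [a₄, a₃, a₂, a₁]
    simp [q₁, q₂, q₃, hn, hi, hw]
  simp only [wp_seq_iff, wp_put_iff]
  refine ⟨?_, fun v hv => ?_⟩
  · intro u hu v hv
    simp [m₄, Function.update_apply, index_inj hv hwn, index_inj hv hin, index_inj hv hjn,
      hA u hu v hv, moveEdge_adj hne]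
    grind
  · have h1 := deg_moveEdge hij hin hjn hwn hiw hjw hne v
    have h2 := hdeg v hv
    have h3 := hdeg i hin
    have h4 := hdeg j hjn
    have hpos : 0 < deg n A i := Finset.card_pos.2 ⟨w, by simp [hwn, hiw]⟩
    simp [d₄, q₄]
    split_ifs at h1 ⊢ <;> subst_vars <;> omega

/-- One transfer. -/
def transferStmt : Stmt :=
  firstStmt 73 13 14 ;; cond (lt (var 73) (var 1))
    (firstStmt 75 14 13 ;; neighborStmt ;; moveStmt) skip

/-- The loop invariant of the transfers: the total excess is at most `x`. -/
def Excess (n x : ℕ) (s : State) : Prop :=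
  ∃ A : SimpleGraph ℕ, HoldsMatrix n (s.arr 1) A ∧ (∀ v < n, s.arr 14 v = deg n A v) ∧
    Dominates n (deg n A) (s.arr 13) ∧ ∑ v ∈ Finset.range n, (deg n A v - s.arr 13 v) ≤ x

/-- If some vertex has a surplus, equality of the totals provides a deficit and the transfer lowers
the excess by one. If none has, the excess is already zero and nothing is done. -/
theorem wp_transferStmt {M n x : ℕ} {s : State} (hn : s.reg 1 = n) (hM : n ≤ M)
    (hanti : ∀ u v, u ≤ v → v < n → s.arr 13 v ≤ s.arr 13 u) (h : Excess n x s) :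
    wp M transferStmt (Excess n (x - 1)) s := by
  obtain ⟨A, hA, hdeg, hdom, hx⟩ := h
  refine wp_seq _ (wp_firstStmt (by decide) (by decide) hn hM) ?_
  rintro s₁ f₁ ⟨h1, h2, h3⟩
  have n₁ : s₁.reg 1 = n := (f₁.reg 1 rfl).trans hn
  have a₁ : s₁.arr 1 = s.arr 1 := f₁.arr 1 rfl
  have d₁ : s₁.arr 13 = s.arr 13 := f₁.arr 13 rfl
  have g₁ : s₁.arr 14 = s.arr 14 := f₁.arr 14 rfl
  simp only [wp_cond_iff, ne_eq, eval_lt, not_not, eval_var, wp_skip_iff, n₁]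
  generalize hi : s₁.reg 73 = i at *
  refine ⟨fun hin => ?_, fun hin => ?_⟩
  · have hdi := h2 hin
    rw [hdeg i hin] at hdi
    refine wp_seq _ (wp_firstStmt (by decide) (by decide) n₁ hM) ?_
    rintro s₂ f₂ ⟨h4, h5, h6⟩
    have n₂ : s₂.reg 1 = n := (f₂.reg 1 rfl).trans n₁
    have i₂ : s₂.reg 73 = i := (f₂.reg 73 rfl).trans hi
    have a₂ : s₂.arr 1 = s.arr 1 := (f₂.arr 1 rfl).trans a₁
    have d₂ : s₂.arr 13 = s.arr 13 := (f₂.arr 13 rfl).trans d₁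
    have g₂ : s₂.arr 14 = s.arr 14 := (f₂.arr 14 rfl).trans g₁
    generalize hj : s₂.reg 75 = j at *
    rw [d₁, g₁] at h5 h6
    have hjn : j < n := by
      obtain ⟨j', hj', hlt⟩ := exists_deficit hdom hin hdi
      by_contra hc
      have := h6 j' (by omega)
      rw [hdeg j' hj'] at this
      omega
    have hdj := h5 hjn
    rw [hdeg j hjn] at hdj
    obtain ⟨hij, hex, hmove⟩ := transfer hanti hdom hin hdi
      (fun u hu => by rw [← hdeg u (hu.trans hin)]; exact h3 u hu) hjn hdj
      (fun u hu => by rw [← hdeg u (hu.trans hjn)]; exact h6 u hu)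
    refine wp_seq _ (wp_neighborStmt n₂ hM (by rwa [a₂]) i₂ hj hin hjn hex) ?_
    rintro s₃ f₃ ⟨h7, h8, h9, h10⟩
    have d₃ : s₃.arr 13 = s.arr 13 := (f₃.arr 13 rfl).trans d₂
    refine wp_mono (wp_frame (wp_moveStmt ((f₃.reg 1 rfl).trans n₂) hM
      (by rw [f₃.arr 1 rfl, a₂]; exact hA)
      ((f₃.reg 73 rfl).trans i₂) ((f₃.reg 75 rfl).trans hj) rfl hin hjn h7 hij.ne h8 h9 h10
      (by rw [f₃.arr 14 rfl, g₂]; exact hdeg))) ?_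
    rintro s₄ ⟨⟨h11, h12⟩, f₄⟩
    have d₄ : s₄.arr 13 = s.arr 13 := (f₄.arr 13 rfl).trans d₃
    obtain ⟨h13, h14⟩ := hmove _ h7 h8 h9 h10
    exact ⟨_, h11, h12, by rwa [d₄], by rw [d₄]; omega⟩
  · refine ⟨A, by rwa [a₁], by rwa [g₁], by rwa [d₁], ?_⟩
    rw [d₁, Finset.sum_eq_zero]
    · exact Nat.zero_le _
    · intro v hv
      have hv' : v < n := by simpa using hv
      have := h3 v (by omega)
      rw [hdeg v hv'] at this
      omega

/-- Transfer until the degrees are right. -/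
def realizeStmt : Stmt := mulStmt 72 1 1 ;; loop 70 (var 72) transferStmt

/-- The excess is at most n² at the start, so n² rounds bring it to zero; then no degree exceeds its
target, and equal totals force all of them to agree. -/
theorem wp_realizeStmt {M n : ℕ} {s : State} (hn : s.reg 1 = n) (hM : n * n ≤ M)
    (hanti : ∀ u v, u ≤ v → v < n → s.arr 13 v ≤ s.arr 13 u) (h : Excess n (n * n) s) :
    wp M realizeStmt (fun s' => ∃ A : SimpleGraph ℕ, HoldsMatrix n (s'.arr 1) A ∧
      ∀ v < n, deg n A v = s.arr 13 v) s := by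
  have hM' : n ≤ M := (Nat.le_mul_self n).trans hM
  refine wp_mulStmt (by decide) (by decide) (by decide) (by decide) (by omega) ?_
  intro s₁ r₁ a₁ m₁
  rw [hn] at m₁
  refine wp_loop (fun k s' => Excess n (n * n - k) s') (by simpa [m₁]) ?_ ?_ ?_
  · simpa [Excess, a₁] using h
  · intro k s' _ hf hk
    have d' : s'.arr 13 = s.arr 13 := (hf.arr 13 rfl).trans (by rw [a₁])
    have n' : s'.reg 1 = n := (hf.reg 1 rfl).trans (by simp [r₁, hn])
    exact wp_transferStmt (by simpa) hM' (by simpa [d']) (by simpa [Excess] using hk)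
  · intro s' hf hk
    have d' : s'.arr 13 = s.arr 13 := (hf.arr 13 rfl).trans (by rw [a₁])
    obtain ⟨A, hA, -, hdom, hx⟩ := hk
    rw [d'] at hdom hx
    simp only [eval_var, m₁, Nat.sub_self, Nat.le_zero, Finset.sum_eq_zero_iff, Finset.mem_range,
      Nat.sub_eq_zero_iff_le] at hx
    exact ⟨A, hA, exists_surplus hdom hx⟩

/-! ### The program -/

/-- Decide the instance from the tables, and construct a solution. -/
def decideStmt : Stmt :=
  cond (var 7) (set 0 (lit 0))
    (setupStmt ;; searchStmt ;; findStmt ;; cond (var 60)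
      (traceStmt ;; fillStmt ;; realizeStmt ;; set 0 (lit 1)) (set 0 (lit 0)))

/-- The final state answers the instance. -/
def Answers (I : List Constraint) (s : State) : Prop :=
  (Solvable I → s.reg 0 = 1) ∧ (¬ Solvable I → s.reg 0 = 0) ∧
    (Solvable I → ∃ (n : ℕ) (G : SimpleGraph (Fin n)), Satisfies G I ∧ HoldsGraph s G)

theorem Answers.congr {I : List Constraint} {s u : State} {D : ℕ} (h : Answers I s)
    (hu : Agree D s u) (hD : 2 ≤ D) : Answers I u := by
  refine ⟨fun hs => ?_, fun hs => ?_, fun hs => ?_⟩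
  · rw [← hu.1 0 (by omega), h.1 hs]
  · rw [← hu.1 0 (by omega), h.2.1 hs]
  · obtain ⟨n, G, hG, h1, h2⟩ := h.2.2 hs
    exact ⟨n, G, hG, by rw [← hu.1 1 (by omega), h1], fun a b => by rw [← hu.2]; exact h2 a b⟩

/-- A bound for all numbers of rounds of the loops of `decideStmt`. -/
def loopBound (I : List Constraint) : ℕ := (maxCount I + 2) ^ ((maxOrder I + 1) ^ 2 + 9)

theorem not_solvable_of_conflict {I : List Constraint} (hI : ∀ c ∈ I, IsStar c.graph)
    (h : ∃ c ∈ I, ∃ d ∈ I, c.order = d.order ∧ c.count ≠ d.count) : ¬ Solvable I := by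
  rintro ⟨n, G, hG⟩
  obtain ⟨c, hc, d, hd, h1, h2⟩ := h
  rw [← hG c hc, ← hG d hd, (hI c hc).homCount_eq, (hI d hd).homCount_eq, h1] at h2
  exact h2 rfl

theorem wp_decideStmt {I : List Constraint} (hI : ∀ c ∈ I, IsStar c.graph) {σ : Scan}
    (hσ : σ.Describes I) {s : State} (hs : Scan.Rep σ s) :
    wp (loopBound I) decideStmt (Answers I) s := by
  classical
  set m := maxCount I with hm
  set l := maxOrder I with hl
  set M := loopBound I with hM
  have hpow : ∀ i, i ≤ (l + 1) ^ 2 + 9 → (m + 2) ^ i ≤ M := fun i hi =>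
    Nat.pow_le_pow_right (by omega) hi
  have hlM : l + 8 ≤ M := by
    refine le_trans ?_ (hpow (l + 8) (by nlinarith))
    exact (Nat.lt_pow_self (by omega)).le
  have hmM : m + 2 ≤ M := by simpa using hpow 1 (by nlinarith)
  have hmm : m * m ≤ M := le_trans (by nlinarith) (hpow 2 (by nlinarith))
  have hbM : (m + 1) * base I ≤ M := by
    refine le_trans ?_ (hpow (l + 2) (by nlinarith))
    rw [pow_succ, mul_comm]
    exact Nat.mul_le_mul_left _ (by omega)
  simp only [decideStmt, wp_cond_iff, wp_set_iff, eval_var, eval_lit, hs.bad]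
  refine ⟨fun hb => ?_, fun hb => ?_⟩
  · have hn := not_solvable_of_conflict hI (hσ.conflict hb)
    exact ⟨fun h => absurd h hn, fun _ => by simp, fun h => absurd h hn⟩
  have hT : Table I (s.arr 2) (s.arr 3) := by
    rw [hs.has, hs.val]
    exact ⟨hσ.has_ne, hσ.val_eq hb, fun q hq => by
      obtain ⟨c, hc, h, _⟩ := hσ.exists_of_has q hq; exact ⟨c, hc, h⟩⟩
  have h9 : s.reg 9 = m := hs.m.trans hσ.m_eq
  set w := weight (s.arr 2) (base I) l with hw
  set T := target (s.arr 2) (s.arr 3) (base I) l with hTd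
  -- Here T + 1 ≤ B^ℓ = (m+2)^((ℓ+1)ℓ), and the remaining coordinates add 8 to the exponent. The
  -- exponent in `loopBound` is chosen to cover this and the smaller bounds above.
  have hTM : (T + 1) * (m + 2) ^ 8 ≤ M := by
    refine le_trans ?_ (hpow ((l + 1) * l + 8) (by nlinarith))
    rw [pow_add, pow_mul]
    exact Nat.mul_le_mul_right _ hT.target_lt
  refine wp_seq _ (wp_setupStmt (hs.l.trans hσ.l_eq) h9 hT hlM hmM hbM) ?_
  rintro s₁ f₁ ⟨w₁, t₁, k₁⟩
  have p₁ : Params w T m s₁ := ⟨(f₁.reg 9 rfl).trans h9, t₁, w₁⟩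
  refine wp_seq _ (wp_searchStmt (by omega) hTM p₁ k₁) ?_
  rintro s₂ f₂ ⟨h₂, c₂⟩
  have p₂ := p₁.frame f₂ rfl rfl rfl
  refine wp_seq _ (wp_findStmt (h₂.length_le.trans hTM) p₂.T_eq) ?_
  rintro s₃ f₃ ⟨n₃, g₃⟩
  simp only [wp_cond_iff, wp_set_iff, eval_var, eval_lit]
  refine ⟨fun h60 => ?_, fun h60 => ?_⟩
  swap
  -- The final list contains all starting points and is closed under steps, so for a solvable
  -- instance it would contain a goal.
  · have hn : ¬ Solvable I := by
      intro hsol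
      obtain ⟨c, hc, hg⟩ := hT.exists_goal hI hsol (R := Present s₂)
        (fun n hn => ⟨n, hn.trans_lt h₂.lt, h₂.roots n hn⟩) c₂
      exact n₃ h60 c hc hg
    exact ⟨fun h => absurd h hn, fun _ => by simp, fun h => absurd h hn⟩
  obtain ⟨h62, hg⟩ := g₃ h60
  have ha₃ : ∀ a, s₃.arr a = s₂.arr a := fun a => f₃.arr a rfl
  have h40 : s₃.reg 40 = s₂.reg 40 := f₃.reg 40 rfl
  have h₃ : Search w T m s₃ := h₂.congr h40 fun a _ _ => ha₃ a
  rw [← cfgAt_congr (fun a _ _ => ha₃ a)] at hg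
  refine wp_seq _ (wp_traceStmt h₃ (by omega) ((f₃.reg 9 rfl).trans p₂.m_eq) (by rwa [h40]) hg) ?_
  rintro s₄ f₄ ⟨n, hnm, n₄, c₄⟩
  obtain ⟨hg₄, hd₄⟩ := c₄.dominates
  refine wp_seq _ (wp_fillStmt n₄ (by omega)) ?_
  intro s₅ f₅ h₅
  have d₅ : s₅.arr 13 = s₄.arr 13 := f₅.arr 13 rfl
  have hnn : n * n ≤ M := (Nat.mul_le_mul hnm hnm).trans hmm
  refine wp_seq _ (wp_realizeStmt ((f₅.reg 1 rfl).trans n₄) hnn ?_ ?_) ?_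
  · rw [d₅]
    exact fun u v huv hv => c₄.anti u v (Nat.zero_le u) huv hv
  · refine ⟨_, h₅, fun v hv => ?_, by rwa [d₅], ?_⟩
    · rw [f₅.arr 14 rfl, hg₄ v hv]
    · calc _ ≤ ∑ v ∈ Finset.range n, n :=
          Finset.sum_le_sum fun v _ => (Nat.sub_le _ _).trans (deg_le n _ v)
        _ = n * n := by simp
  rintro s₆ f₆ ⟨A, hA, hdeg⟩
  have hsat := hT.satisfies_of_completes hI hnm c₄ (A := A)
    (fun v hv => by rw [hdeg v hv, d₅])
  refine ⟨fun _ => by simp, fun h => absurd ⟨n, _, hsat⟩ h, fun _ => ⟨n, _, hsat, ?_, ?_⟩⟩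
  · simpa using (f₆.reg 1 rfl).trans ((f₅.reg 1 rfl).trans n₄)
  · intro u v
    exact hA u u.2 v v.2

/-! ### The running time -/

theorem length_encode (c : Constraint) :
    c.encode.length = c.order + 1 + c.order ^ 2 + (c.count + 1) := by
  simp [Constraint.encode, encodeUnary, Scan.length_encodeGraph]
  ring

theorem eq_nil_of_maxOrder {I : List Constraint} (hI : ∀ c ∈ I, IsStar c.graph)
    (h : maxOrder I = 0) : I = [] := by
  cases I with
  | nil => rfl
  | cons c I =>
    have h1 := (hI c (by simp)).order_pos
    have h2 := order_le_maxOrder (show c ∈ c :: I by simp)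
    omega

/-- An instance without repeated constraint graphs is short. -/
theorem length_encode_le {I : List Constraint} (hI : ∀ c ∈ I, IsStar c.graph)
    (hP : I.Pairwise (fun c d => IsEmpty (c.graph ≃g d.graph))) :
    (encode I).length ≤
      maxOrder I * (maxOrder I + 1 + maxOrder I ^ 2 + (maxCount I + 1)) := by
  have hnodup : (I.map Constraint.order).Nodup := by
    refine List.pairwise_map.2 (hP.imp_of_mem ?_)
    intro c d hc hd hcd heq
    have h1 := hI c hc
    have h2 := hI d hd
    obtain ⟨q, F, x⟩ := c
    obtain ⟨q', F', x'⟩ := d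
    dsimp only at heq h1 h2 hcd
    subst heq
    exact (h1.nonempty_iso h2).elim hcd.elim
  have hlen : I.length ≤ maxOrder I := by
    rw [← List.length_map (f := Constraint.order), ← List.toFinset_card_of_nodup hnodup]
    calc _ ≤ (Finset.Icc 1 (maxOrder I)).card := Finset.card_le_card fun q hq => by
            simp only [List.mem_toFinset, List.mem_map] at hq
            obtain ⟨c, hc, rfl⟩ := hq
            exact Finset.mem_Icc.2 ⟨(hI c hc).order_pos, order_le_maxOrder hc⟩
      _ = maxOrder I := by simp
  calc (encode I).length = (I.map fun c => c.encode.length).sum := by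
        simp [encode, List.length_flatMap]
    _ ≤ (I.map fun c => c.encode.length).length •
        (maxOrder I + 1 + maxOrder I ^ 2 + (maxCount I + 1)) := by
        refine List.sum_le_card_nsmul _ _ fun x hx => ?_
        obtain ⟨c, hc, rfl⟩ := List.mem_map.1 hx
        rw [length_encode]
        have h1 := order_le_maxOrder hc
        have h2 := count_le_maxCount hc
        have h3 := Nat.pow_le_pow_left h1 2
        omega
    _ ≤ _ := by
        rw [List.length_map, smul_eq_mul]
        exact Nat.mul_le_mul_right _ hlen

/-- For ℓ ≥ 1 put Y = X^(ℓ²) with X = max(m, 2). Each of ℓ, ℓ², m and 2 is at most Y, so the length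
is at most 4Y² ≤ Y⁴, and one more factor Y pays for the added 1. -/
theorem length_encode_lt_pow {I : List Constraint} (hI : ∀ c ∈ I, IsStar c.graph)
    (hP : I.Pairwise (fun c d => IsEmpty (c.graph ≃g d.graph))) :
    (encode I).length + 1 ≤ max (maxCount I) 2 ^ (5 * maxOrder I ^ 2) := by
  have h := length_encode_le hI hP
  rcases Nat.eq_zero_or_pos (maxOrder I) with hl | hl
  · rw [hl] at h ⊢
    simpa using h
  set l := maxOrder I
  set X := max (maxCount I) 2 with hX
  have hX2 : 2 ≤ X := le_max_right _ _
  have hl2 : 1 ≤ l ^ 2 := Nat.one_le_pow _ _ hl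
  have hself : X ≤ X ^ (l ^ 2) := Nat.le_self_pow (by omega) X
  have h1 : l ^ 2 ≤ X ^ (l ^ 2) := (Nat.lt_pow_self (by omega)).le
  have h2 : l ≤ X ^ (l ^ 2) := (Nat.le_self_pow two_ne_zero l).trans h1
  have h3 : maxCount I ≤ X ^ (l ^ 2) := (le_max_left _ _).trans hself
  have h4 : 2 ≤ X ^ (l ^ 2) := hX2.trans hself
  rw [mul_comm, pow_mul]
  generalize X ^ (l ^ 2) = Y at *
  have h5 : l * (l + 1 + l ^ 2 + (maxCount I + 1)) ≤ Y * (4 * Y) :=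
    Nat.mul_le_mul h2 (by omega)
  have h6 : Y * (4 * Y) ≤ Y ^ 4 := by
    have : 2 * 2 ≤ Y * Y := Nat.mul_le_mul h4 h4
    calc Y * (4 * Y) = 4 * (Y * Y) := by ring
      _ ≤ (Y * Y) * (Y * Y) := Nat.mul_le_mul_right _ this
      _ = Y ^ 4 := by ring
  have h7 : 1 ≤ Y ^ 4 := Nat.one_le_pow _ _ (by omega)
  calc _ ≤ Y ^ 4 * 2 := by omega
    _ ≤ Y ^ 4 * Y := Nat.mul_le_mul_left _ h4
    _ = Y ^ 5 := by ring

/-- For ℓ ≥ 1 and X = max(m, 2), the estimates m + 2 ≤ X² and (ℓ+1)² + 9 ≤ 13ℓ² give the exponent 26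
= 2 · 13. The empty instance has ℓ = m = 0, where the power of X is 1 and the constant factor has to
cover the value 2^10 of `loopBound`. -/
theorem loopBound_pow_le {I : List Constraint} (hI : ∀ c ∈ I, IsStar c.graph) (k : ℕ) :
    loopBound I ^ k ≤ 2 ^ (10 * k) * max (maxCount I) 2 ^ (26 * k * maxOrder I ^ 2) := by
  rcases Nat.eq_zero_or_pos (maxOrder I) with hl | hl
  · rw [eq_nil_of_maxOrder hI hl]
    simp [loopBound, maxCount, maxOrder, pow_mul]
  rw [loopBound]
  set l := maxOrder I
  set X := max (maxCount I) 2 with hX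
  have hX2 : 2 ≤ X := le_max_right _ _
  have h1 : maxCount I + 2 ≤ X ^ 2 := by
    have : maxCount I ≤ X := le_max_left _ _
    nlinarith
  have h2 : (l + 1) ^ 2 + 9 ≤ 13 * l ^ 2 := by nlinarith
  calc ((maxCount I + 2) ^ ((l + 1) ^ 2 + 9)) ^ k
      ≤ ((X ^ 2) ^ (13 * l ^ 2)) ^ k := by
        refine Nat.pow_le_pow_left ((Nat.pow_le_pow_left h1 _).trans ?_) k
        exact Nat.pow_le_pow_right (Nat.pow_pos (by omega)) h2
    _ = 1 * X ^ (26 * k * l ^ 2) := by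
        rw [← pow_mul, ← pow_mul, one_mul]
        congr 1
        ring
    _ ≤ _ := Nat.mul_le_mul_right _ Nat.one_le_two_pow

end StarHomRec

theorem theorem3 :
    ∃ (p : StarHomRec.Prog) (C : ℕ), ∀ I : List StarHomRec.Constraint,
      (∀ c ∈ I, StarHomRec.IsStar c.graph) →
      ∃ (t : ℕ) (s : StarHomRec.State),
        StarHomRec.Exec p (StarHomRec.initState (StarHomRec.encode I)) t s ∧
        -- the answer to the decision problem
        (StarHomRec.Solvable I → s.reg 0 = 1) ∧
        (¬ StarHomRec.Solvable I → s.reg 0 = 0) ∧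
        -- a witness graph
        (StarHomRec.Solvable I → ∃ (n : ℕ) (G : SimpleGraph (Fin n)),
          StarHomRec.Satisfies G I ∧ StarHomRec.HoldsGraph s G) ∧
        -- the running time if no constraint graph is repeated
        (I.Pairwise (fun c d => IsEmpty (c.graph ≃g d.graph)) →
          t ≤ C * max (StarHomRec.maxCount I) 2 ^ (C * StarHomRec.maxOrder I ^ 2)) ∧
        -- the running time in general
        t ≤ C * ((StarHomRec.encode I).length + 1) *
          max (StarHomRec.maxCount I) 2 ^ (C * StarHomRec.maxOrder I ^ 2) := by
  open StarHomRec in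
  obtain ⟨C₁, hC₁⟩ := Scan.readStmt_bound
  obtain ⟨k, hk⟩ := decideStmt.exists_bound_le_pow
  obtain ⟨E, hE⟩ : ∃ E, E = 2 ^ (10 * k) := ⟨_, rfl⟩
  -- All registers of the two statements are below 100, and scratch registers start there. The
  -- constant collects the linear factor `C₁` of reading, the factor `E`, the exponent `26 * k` of
  -- the computation and the exponent 5 from the length of an input without repetitions.
  refine ⟨.seq (Scan.readStmt.compile 100) (decideStmt.compile 100),
    C₁ + E + (26 * k + 5), fun I hI => ?_⟩
  obtain ⟨-, hσ⟩ := Scan.describes_foldl I fun c hc => (hI c hc).order_pos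
  obtain ⟨t₁, u₁, s₁, e₁, b₁, a₁, q₁, -⟩ := Stmt.exec_compile (D := 100) Scan.readStmt
    (by decide) le_rfl (Agree.refl _ _) (Scan.wp_readStmt I)
  obtain ⟨t₂, u₂, s₂, e₂, b₂, a₂, q₂, -⟩ := Stmt.exec_compile (D := 100) decideStmt
    (by decide) le_rfl a₁ (wp_decideStmt hI hσ q₁)
  obtain ⟨h1, h2, h3⟩ := q₂.congr a₂ (by omega)
  refine ⟨t₁ + t₂, u₂, .seq e₁ e₂, h1, h2, h3, ?_⟩
  have hb₁ := b₁.trans (hC₁ _)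
  have hM : 2 ≤ loopBound I :=
    (show 2 ≤ maxCount I + 2 by omega).trans (Nat.le_self_pow (by omega) _)
  have hb₂ := (b₂.trans (hk _ hM)).trans (loopBound_pow_le hI k)
  rw [← hE] at hb₂
  set X := max (maxCount I) 2 with hX
  set l := maxOrder I
  set N := (encode I).length
  set C := C₁ + E + (26 * k + 5) with hC
  have hX1 : 1 ≤ X := (by decide : 1 ≤ 2).trans (le_max_right _ _)
  have hpow : ∀ i, i ≤ C → X ^ (i * l ^ 2) ≤ X ^ (C * l ^ 2) := fun i hi =>
    Nat.pow_le_pow_right hX1 (Nat.mul_le_mul_right _ hi)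
  have hp1 : E * X ^ (26 * k * l ^ 2) ≤ E * X ^ (C * l ^ 2) :=
    Nat.mul_le_mul_left _ (hpow _ (by omega))
  constructor
  · intro hP
    have hp2 : C₁ * (N + 1) ≤ C₁ * X ^ (C * l ^ 2) :=
      Nat.mul_le_mul_left C₁ ((length_encode_lt_pow hI hP).trans (hpow 5 (by omega)))
    calc t₁ + t₂ ≤ C₁ * X ^ (C * l ^ 2) + E * X ^ (C * l ^ 2) := by omega
      _ = (C₁ + E) * X ^ (C * l ^ 2) := by ring
      _ ≤ C * X ^ (C * l ^ 2) := Nat.mul_le_mul_right _ (by omega)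
  · have hY : 1 ≤ X ^ (C * l ^ 2) := Nat.one_le_pow _ _ hX1
    have hp2 : C₁ * (N + 1) * 1 ≤ C₁ * (N + 1) * X ^ (C * l ^ 2) := Nat.mul_le_mul_left _ hY
    have hp3 : E * 1 * X ^ (C * l ^ 2) ≤ E * (N + 1) * X ^ (C * l ^ 2) :=
      Nat.mul_le_mul_right _ (Nat.mul_le_mul_left _ (by omega))
    calc t₁ + t₂ ≤ C₁ * (N + 1) * X ^ (C * l ^ 2) +
          E * (N + 1) * X ^ (C * l ^ 2) := by
          rw [mul_one] at hp2 hp3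
          omega
      _ = (C₁ + E) * (N + 1) * X ^ (C * l ^ 2) := by ring
      _ ≤ C * (N + 1) * X ^ (C * l ^ 2) :=
          Nat.mul_le_mul_right _ (Nat.mul_le_mul_right _ (by omega))
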